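/- **Setting.** Consider the system $\tilde{\mathcal E}$ (a differential covering $\tau^W$ of the reduced quasi-classical self-dual Yang–Mills equation $\mathcal E$) for the unknown functions $u,\ q_\alpha,\ m_\alpha\ (\alpha\ge 0),\ r_\beta\ (\beta\ge 1)$ of $x,y,z,t$: $$u_{yz}=u_{tx}-u_zu_{xx}+u_xu_{xz},$$ $$q_{\alpha,t}=u_zq_{\alpha,x}+q_{\alpha-1,z},\qquad q_{\alpha,y}=u_xq_{\alpha,x}+q_{\alpha-1,x},$$ $$m_{\alpha,t}=u_zm_{\alpha,x}-\tfrac zt m_{\alpha,z}-\tfrac1t m_{\alpha-1,z},\qquad m_{\alpha,y}=u_xm_{\alpha,x}-\tfrac zt m_{\alpha,x}-\tfrac1t m_{\alpha-1,x},$$ $$r_{\beta,x}=u_xr_{\beta-1,x}-r_{\beta-1,y},\qquad r_{\beta,z}=u_zr_{\beta-1,x}-r_{\beta-1,t},$$ where $q_{-1}=m_{-1}=0$ and $r_0=-u$, together with all its differential consequences. Let $\mathcal L$ be the ring of real Laurent polynomials in the internal coordinates $x,y,z,t$, $u_{x^it^j}$, $u_{x^iy^kt^j}$, $u_{x^iz^lt^j}$,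 $q_{\alpha,x^iz^j}$, $m_{\alpha,x^iz^j}$, $r_{\beta,y^it^j}$ ($i,j,\alpha\ge 0$; $k,l,\beta\ge 1$), each involving finitely many of them, and let $\tilde D_x,\tilde D_y,\tilde D_z,\tilde D_t$ be the total derivatives on $\mathcal L$ (restricted to $\tilde{\mathcal E}$). Let $\mathcal L^{\mathbb N}$ be the space of sequences $P=[p_0,p_0^q,p_0^m,p_1^r,p_1^q,p_1^m,p_2^r,\dots]$ in $\mathcal L$, with one component for each of $u,q_\alpha,m_\alpha,r_\beta$; let $\mathbf E_P$ be the evolutionary vector field with generating function $P$, and $\{P,Q\}=\mathbf E_P(Q)-\mathbf E_Q(P)$ the Jacobi bracket. Let $\mathrm{sym}=\mathrm{sym}^{\tau^W}_{\mathcal L}(\mathcal E)\subset\mathcal L^{\mathbb N}$ be the real vector space of all $P$ on which the linearization of the system vanishes; it is a Lie algebra under the Jacobi bracket. **Recursion operators.** Let $\mathcal R^q$ be the invertible linear operator $P\mapsto\hat P$ on $\mathcal L^{\mathbb N}$ given by $$\hat p_0=u_xp_0+p_1^r,\quad \hat p^q_\alpha=q_{\alpha,x}p_0+p^q_{\alpha-1},\quad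 \hat p^m_\alpha=m_{\alpha,x}p_0-\tfrac1tp^m_{\alpha-1}-\tfrac ztp^m_\alpha,\quad \hat p^r_\beta=r_{\beta,x}p_0-p^r_{\beta+1}$$ (with $p^q_{-1}=p^m_{-1}=0$), let $\mathcal R^m=t\mathcal R^q+z\,\mathrm{id}$, which is also invertible, and let $\mathcal R_i^j=(\mathcal R^q)^{-i}\circ(\mathcal R^m)^j$ for $i,j\in\mathbb Z$. These are the elements of the group $\langle\mathcal R^q,\mathcal R^m\rangle$. **Seed generators.** Let $$\Omega=[tu_t-xu_x+2u,\dots,tq_{\alpha,t}-xq_{\alpha,x}-\alpha q_\alpha,\ tm_{\alpha,t}-xm_{\alpha,x},\ tr_{\alpha+1,t}-xr_{\alpha+1,x}+(\alpha+3)r_{\alpha+1},\dots],$$ $$\Psi=[u_z,\dots,q_{\alpha,z},\ m_{\alpha,z}-(\alpha+1)m_{\alpha+1},\ r_{\alpha+1,z},\dots]\qquad(\alpha\ge0),$$ $$\Xi(A)=[0,A,0,0,\tfrac1{1!}\mathfrak X(A),0,0,\tfrac1{2!}\mathfrak X^2(A),\dots],\qquad \mathfrak X=t\partial_z+\sum_{i\ge0}(i+1)q_{i+1}\partial_{q_i},$$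 $$\Upsilon(B)=[B,0,0,\tfrac1{1!}\mathfrak V(B),0,0,-\tfrac1{2!}\mathfrak V^2(B),0,0,\tfrac1{3!}\mathfrak V^3(B),\dots],$$ $$\mathfrak V=z\partial_t+x\partial_y-2u\partial_x+3r_1\partial_u-\sum_{i\ge1}(i+3)r_{i+1}\partial_{r_i},$$ $$\Theta(C)=[0,0,C,0,0,\tfrac1{1!}\mathfrak T(C),0,0,\tfrac1{2!}\mathfrak T^2(C),\dots],\qquad \mathfrak T=\partial_z+\sum_{i\ge0}(i+1)m_{i+1}\partial_{m_i}.$$ The seed generators are $\Omega$, $\Psi$, $\Xi^{(\nu)}=\Xi(q_0^\nu)$, $\Upsilon^{(\nu)}=\Upsilon((y/t^2)^\nu)$ and $\Theta^{(\nu)}=\Theta(m_0^\nu)$, $\nu\in\mathbb Z$. Write $P_i^j=\mathcal R_i^j(P)$. Let $V_0$ be the real span of all $P_0^j$, and $V$ the real span of all $P_i^j$, with $P$ a seed generator and $i,j\in\mathbb Z$. **Proposition.** 1. $V$ is an infinite-dimensional Lie subalgebra of the Lie algebra $\mathrm{sym}^{\tau^W}_{\mathcal L}(\mathcal E)$, and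 $V=\bigoplus_{k\in\mathbb Z}\mathcal R_k^0(V_0)$. 2. For all $i,j,k,l,\mu,\nu\in\mathbb Z$ the generators of $V$ satisfy $$\{\Psi_i^k,\Psi_j^l\}=(k-l)\Psi_{i+j}^{k+l-1},\quad \{\Psi_i^k,\Omega_j^l\}=i\Psi_{i+j}^{k+l}-l\,\Omega_{i+j}^{k+l-1},\quad \{\Omega_i^k,\Omega_j^l\}=(i-j)\Omega_{i+j}^{k+l},$$ $$\{\Psi_i^k,(\Xi^{(\nu)})_j^l\}=-l\,(\Xi^{(\nu)})_{i+j}^{k+l-1},\quad \{\Psi_i^k,(\Upsilon^{(\nu)})_j^l\}=-(l-2\nu)(\Upsilon^{(\nu)})_{i+j}^{k+l-1},\quad \{\Psi_i^k,(\Theta^{(\nu)})_j^l\}=-l\,(\Theta^{(\nu)})_{i+j}^{k+l-1},$$ $$\{\Omega_i^k,(\Xi^{(\nu)})_j^l\}=-j\,(\Xi^{(\nu)})_{i+j}^{k+l},\quad \{\Omega_i^k,(\Upsilon^{(\nu)})_j^l\}=-(j+2-2\nu)(\Upsilon^{(\nu)})_{i+j}^{k+l},\quad \{\Omega_i^k,(\Theta^{(\nu)})_j^l\}=-j\,(\Theta^{(\nu)})_{i+j}^{k+l},$$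 $$\{(\Xi^{(\mu)})_i^k,(\Xi^{(\nu)})_j^l\}=(\nu-\mu)(\Xi^{(\mu+\nu-1)})_{i+j}^{k+l},\quad \{(\Upsilon^{(\mu)})_i^k,(\Upsilon^{(\nu)})_j^l\}=(\mu-\nu)(\Upsilon^{(\mu+\nu-1)})_{i+j}^{k+l-2},$$ $$\{(\Theta^{(\mu)})_i^k,(\Theta^{(\nu)})_j^l\}=(\nu-\mu)(\Theta^{(\mu+\nu-1)})_{i+j}^{k+l},$$ and the brackets of any $(\Xi^{(\mu)})_i^k$ with any $(\Upsilon^{(\nu)})_j^l$, of any $(\Xi^{(\mu)})_i^k$ with any $(\Theta^{(\nu)})_j^l$, and of any $(\Upsilon^{(\mu)})_i^k$ with any $(\Theta^{(\nu)})_j^l$ vanish. 3. For each fixed $k\in\mathbb Z$, the elements $\Omega_j^k$, $\Psi_j^k$, $(\Xi^{(\nu)})_j^k$, $(\Upsilon^{(\nu)})_j^k$, $(\Theta^{(\nu)})_j^k$, $j,\nu\in\mathbb Z$, are linearly independent over $\mathbb R$. -/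

import Mathlib

noncomputable section

namespace RYME

/-! ### Internal coordinates and Laurent polynomials on the covering equation -/

/-- The internal coordinates on the covering equation:
* `x`, `y`, `z`, `t`: the independent variables;
* `u i j` is `u_{x^i t^j}`;
* `uy i k j` is `u_{x^i y^(k+1) t^j}`;
* `uz i l j` is `u_{x^i z^(l+1) t^j}`;
* `q α i j` is `q_{α, x^i z^j}` and `m α i j` is `m_{α, x^i z^j}`, for `α ≥ 0`;
* `r n i j` is `r_{n+1, y^i t^j}`, so that `r_1, r_2, …` have the indices `0, 1, …`. -/
inductive Coord : Type
  | x | y | z | t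
  | u (i j : ℕ)
  | uy (i k j : ℕ)
  | uz (i l j : ℕ)
  | q (α i j : ℕ)
  | m (α i j : ℕ)
  | r (n i j : ℕ)

/-- The ring of Laurent polynomials with real coefficients in the internal coordinates (each
involving finitely many of them): the group algebra of the group of exponent vectors. -/
abbrev Laurent : Type := AddMonoidAlgebra ℝ (Coord →₀ ℤ)

/-- The Laurent monomial with a given exponent vector. -/
def mono (e : Coord →₀ ℤ) : Laurent := AddMonoidAlgebra.single e 1

/-- The integer power `a ^ n` of a coordinate. -/
def pow (a : Coord) (n : ℤ) : Laurent := mono (Finsupp.single a n)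

/-- A coordinate as a Laurent polynomial. -/
def X (a : Coord) : Laurent := pow a 1

/-- The vector field `∑_a c_a ∂/∂a`, as an operator on Laurent polynomials: the monomial with
exponents `e` goes to `∑_a e_a a⁻¹ (monomial) c_a`. -/
def vf (c : Coord → Laurent) : Module.End ℝ Laurent :=
  (Finsupp.linearCombination ℝ fun e : Coord →₀ ℤ =>
      e.sum fun a n => (n : ℝ) • (mono (e - Finsupp.single a 1) * c a)) ∘ₗ
    (AddMonoidAlgebra.coeffLinearEquiv ℝ).toLinearMap

/-- `prev f α` is `f (α - 1)`, with the convention `f (-1) = 0`. -/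
def prev (f : ℕ → Laurent) : ℕ → Laurent
  | 0 => 0
  | α + 1 => f α

/-- `u_x`. -/
def ux : Laurent := X (.u 1 0)
/-- `u_z`. -/
def uz : Laurent := X (.uz 0 0 0)
/-- `u_{xx}`. -/
def uxx : Laurent := X (.u 2 0)
/-- `u_{xz}`. -/
def uxz : Laurent := X (.uz 1 0 0)
/-- `q_{α,x}`. -/
def qx (α : ℕ) : Laurent := X (.q α 1 0)
/-- `q_{α,z}`. -/
def qz (α : ℕ) : Laurent := X (.q α 0 1)
/-- `m_{α,x}`. -/
def mx (α : ℕ) : Laurent := X (.m α 1 0)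
/-- `m_{α,z}`. -/
def mz (α : ℕ) : Laurent := X (.m α 0 1)
/-- The independent variable `z`. -/
def vz : Laurent := X .z
/-- The independent variable `t`. -/
def vt : Laurent := X .t
/-- `1 / z`. -/
def zi : Laurent := pow .z (-1)
/-- `1 / t`. -/
def ti : Laurent := pow .t (-1)

/-- The right-hand side of the equation `u_{yz} = u_{tx} - u_z u_{xx} + u_x u_{xz}`. -/
def rhsU : Laurent := X (.u 1 1) - uz * uxx + ux * uxz

/-- `q_{α,t} = u_z q_{α,x} + q_{α-1,z}`. -/
def rhsQt (α : ℕ) : Laurent := uz * qx α + prev qz α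

/-- `q_{α,y} = u_x q_{α,x} + q_{α-1,x}`. -/
def rhsQy (α : ℕ) : Laurent := ux * qx α + prev qx α

/-- `m_{α,t} = u_z m_{α,x} - (z/t) m_{α,z} - (1/t) m_{α-1,z}`. -/
def rhsMt (α : ℕ) : Laurent := uz * mx α - vz * ti * mz α - ti * prev mz α

/-- `m_{α,y} = u_x m_{α,x} - (z/t) m_{α,x} - (1/t) m_{α-1,x}`. -/
def rhsMy (α : ℕ) : Laurent := ux * mx α - vz * ti * mx α - ti * prev mx α

/-- `r_{β,y}` for `β ≥ 0`, where `r_0 = -u`. -/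
def ry : ℕ → Laurent
  | 0 => -X (.uy 0 0 0)
  | n + 1 => X (.r n 1 0)

/-- `r_{β,t}` for `β ≥ 0`, where `r_0 = -u`. -/
def rt : ℕ → Laurent
  | 0 => -X (.u 0 1)
  | n + 1 => X (.r n 0 1)

/-- `r_{β,x}` for `β ≥ 0` in internal coordinates: `r_0 = -u` and
`r_{β,x} = u_x r_{β-1,x} - r_{β-1,y}`. -/
def rx : ℕ → Laurent
  | 0 => -ux
  | β + 1 => ux * rx β - ry β

/-- `r_{β,z}` for `β ≥ 0` in internal coordinates: `r_0 = -u` and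
`r_{β,z} = u_z r_{β-1,x} - r_{β-1,t}`. -/
def rz : ℕ → Laurent
  | 0 => -uz
  | β + 1 => uz * rx β - rt β

/-! ### Total derivatives on the covering equation

A total derivative sends a coordinate `a_σ` to `a_{σ i}`. When `a_{σ i}` is not an internal
coordinate, it is replaced by the total derivative of the right-hand side of the equation that
expresses it. This is done in stages, such that each stage only differentiates expressions on which
the operators that it uses have their final values. -/

/-- Auxiliary: the total `x`-derivative on functions that do not involve the `r`-coordinates. -/
def dX0 : Module.End ℝ Laurent := vf fun
  | .x => 1
  | .u i j => X (.u (i + 1) j)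
  | .uy i k j => X (.uy (i + 1) k j)
  | .uz i l j => X (.uz (i + 1) l j)
  | .q α i j => X (.q α (i + 1) j)
  | .m α i j => X (.m α (i + 1) j)
  | _ => 0

/-- Auxiliary: the total `z`-derivative on functions that involve neither the `r`-coordinates nor
the coordinates `u_{x^i y^k t^j}` with `k > 0`. -/
def dZ0 : Module.End ℝ Laurent := vf fun
  | .z => 1
  | .u i j => X (.uz i 0 j)
  | .uz i l j => X (.uz i (l + 1) j)
  | .q α i j => X (.q α i (j + 1))
  | .m α i j => X (.m α i (j + 1))
  | _ => 0

/-- The total derivative with respect to `t`. -/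
def dT : Module.End ℝ Laurent := vf fun
  | .t => 1
  | .u i j => X (.u i (j + 1))
  | .uy i k j => X (.uy i k (j + 1))
  | .uz i l j => X (.uz i l (j + 1))
  | .q α i j => (dX0 ^ i) ((dZ0 ^ j) (rhsQt α))
  | .m α i j => (dX0 ^ i) ((dZ0 ^ j) (rhsMt α))
  | .r n i j => X (.r n i (j + 1))
  | _ => 0

/-- The total derivative with respect to `y`. -/
def dY : Module.End ℝ Laurent := vf fun
  | .y => 1
  | .u i j => X (.uy i 0 j)
  | .uy i k j => X (.uy i (k + 1) j)
  | .uz i l j => (dX0 ^ i) ((dZ0 ^ l) ((dT ^ j) rhsU))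
  | .q α i j => (dX0 ^ i) ((dZ0 ^ j) (rhsQy α))
  | .m α i j => (dX0 ^ i) ((dZ0 ^ j) (rhsMy α))
  | .r n i j => X (.r n (i + 1) j)
  | _ => 0

/-- The total derivative with respect to `x`. -/
def dX : Module.End ℝ Laurent := vf fun
  | .x => 1
  | .u i j => X (.u (i + 1) j)
  | .uy i k j => X (.uy (i + 1) k j)
  | .uz i l j => X (.uz (i + 1) l j)
  | .q α i j => X (.q α (i + 1) j)
  | .m α i j => X (.m α (i + 1) j)
  | .r n i j => (dY ^ i) ((dT ^ j) (rx (n + 1)))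
  | _ => 0

/-- The total derivative with respect to `z`. -/
def dZ : Module.End ℝ Laurent := vf fun
  | .z => 1
  | .u i j => X (.uz i 0 j)
  | .uy i k j => (dX0 ^ i) ((dY ^ k) ((dT ^ j) rhsU))
  | .uz i l j => X (.uz i (l + 1) j)
  | .q α i j => X (.q α i (j + 1))
  | .m α i j => X (.m α i (j + 1))
  | .r n i j => (dY ^ i) ((dT ^ j) (rz (n + 1)))
  | _ => 0

/-! ### Generating functions, symmetries, Jacobi bracket -/

/-- The dependent variables `u`, `q_α`, `m_α` (`α ≥ 0`) and `r_{n+1}` (`n ≥ 0`). -/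
inductive Dep : Type
  | u
  | q (α : ℕ)
  | m (α : ℕ)
  | r (n : ℕ)

/-- Sequences `[p_0, p_0^q, p_0^m, p_1^r, p_1^q, p_1^m, p_2^r, …]` of Laurent polynomials, with one
component for each dependent variable: `P .u = p_0`, `P (.q α) = p_α^q`, `P (.m α) = p_α^m` and
`P (.r n) = p_{n+1}^r`. -/
abbrev Gen : Type := Dep → Laurent

/-- A dependent variable as a Laurent polynomial. -/
def depX : Dep → Laurent
  | .u => X (.u 0 0)
  | .q α => X (.q α 0 0)
  | .m α => X (.m α 0 0)
  | .r n => X (.r n 0 0)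

/-- The conditions on `P` to be the generating function of a (full-fledged nonlocal) symmetry:
the linearization of the covering system vanishes on `P`. -/
structure IsSymmetry (P : Gen) : Prop where
  ns1 : dY (dZ (P .u)) - dT (dX (P .u)) + uz * dX (dX (P .u)) - ux * dX (dZ (P .u))
    + uxx * dZ (P .u) - uxz * dX (P .u) = 0
  ns2 : ∀ α, dT (P (.q α)) - uz * dX (P (.q α)) - qx α * dZ (P .u)
    - dZ (prev (fun β => P (.q β)) α) = 0
  ns3 : ∀ α, dY (P (.q α)) - ux * dX (P (.q α)) - qx α * dX (P .u)
    - dX (prev (fun β => P (.q β)) α) = 0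
  ns4 : ∀ α, dT (P (.m α)) - uz * dX (P (.m α)) - mx α * dZ (P .u)
    + vz * ti * dZ (P (.m α)) + ti * dZ (prev (fun β => P (.m β)) α) = 0
  ns5 : ∀ α, dY (P (.m α)) - ux * dX (P (.m α)) - mx α * dX (P .u)
    + vz * ti * dX (P (.m α)) + ti * dX (prev (fun β => P (.m β)) α) = 0
  ns6 : dX (P (.r 0)) - dY (P .u) + 2 * ux * dX (P .u) = 0
  ns7 : dZ (P (.r 0)) - dT (P .u) + ux * dZ (P .u) + uz * dX (P .u) = 0
  ns8 : ∀ n, dX (P (.r (n + 1))) - ux * dX (P (.r n)) - rx (n + 1) * dX (P .u)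
    + dY (P (.r n)) = 0
  ns9 : ∀ n, dZ (P (.r (n + 1))) - uz * dX (P (.r n)) - rx (n + 1) * dZ (P .u)
    + dT (P (.r n)) = 0

theorem prev_add (f g : ℕ → Laurent) (α : ℕ) :
    prev (fun β => f β + g β) α = prev f α + prev g α := by
  cases α <;> simp [prev]

theorem prev_smul (c : ℝ) (f : ℕ → Laurent) (α : ℕ) :
    prev (fun β => c • f β) α = c • prev f α := by
  cases α <;> simp [prev]

theorem prev_zero (α : ℕ) : prev (fun _ => 0) α = 0 := by
  cases α <;> rfl

/-- The real vector space of all symmetries with Laurent polynomial generating functions. -/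
def sym : Submodule ℝ Gen where
  carrier := {P | IsSymmetry P}
  zero_mem' := by
    constructor <;> intros <;> simp [prev_zero]
  add_mem' := by
    intro P Q hP hQ
    constructor
    · simp only [Pi.add_apply, map_add]; linear_combination hP.ns1 + hQ.ns1
    · intro α; simp only [Pi.add_apply, map_add, prev_add]
      linear_combination hP.ns2 α + hQ.ns2 α
    · intro α; simp only [Pi.add_apply, map_add, prev_add]
      linear_combination hP.ns3 α + hQ.ns3 α
    · intro α; simp only [Pi.add_apply, map_add, prev_add]
      linear_combination hP.ns4 α + hQ.ns4 α
    · intro α; simp only [Pi.add_apply, map_add, prev_add]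
      linear_combination hP.ns5 α + hQ.ns5 α
    · simp only [Pi.add_apply, map_add]; linear_combination hP.ns6 + hQ.ns6
    · simp only [Pi.add_apply, map_add]; linear_combination hP.ns7 + hQ.ns7
    · intro n; simp only [Pi.add_apply, map_add]; linear_combination hP.ns8 n + hQ.ns8 n
    · intro n; simp only [Pi.add_apply, map_add]; linear_combination hP.ns9 n + hQ.ns9 n
  smul_mem' := by
    intro c P hP
    constructor
    · simp only [Pi.smul_apply, map_smul]; simp only [Algebra.smul_def]
      linear_combination algebraMap ℝ Laurent c * hP.ns1
    · intro α; simp only [Pi.smul_apply, prev_smul, map_smul]; simp only [Algebra.smul_def]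
      linear_combination algebraMap ℝ Laurent c * hP.ns2 α
    · intro α; simp only [Pi.smul_apply, prev_smul, map_smul]; simp only [Algebra.smul_def]
      linear_combination algebraMap ℝ Laurent c * hP.ns3 α
    · intro α; simp only [Pi.smul_apply, prev_smul, map_smul]; simp only [Algebra.smul_def]
      linear_combination algebraMap ℝ Laurent c * hP.ns4 α
    · intro α; simp only [Pi.smul_apply, prev_smul, map_smul]; simp only [Algebra.smul_def]
      linear_combination algebraMap ℝ Laurent c * hP.ns5 α
    · simp only [Pi.smul_apply, map_smul]; simp only [Algebra.smul_def]
      linear_combination algebraMap ℝ Laurent c * hP.ns6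
    · simp only [Pi.smul_apply, map_smul]; simp only [Algebra.smul_def]
      linear_combination algebraMap ℝ Laurent c * hP.ns7
    · intro n; simp only [Pi.smul_apply, map_smul]; simp only [Algebra.smul_def]
      linear_combination algebraMap ℝ Laurent c * hP.ns8 n
    · intro n; simp only [Pi.smul_apply, map_smul]; simp only [Algebra.smul_def]
      linear_combination algebraMap ℝ Laurent c * hP.ns9 n

/-- The coefficients of the evolutionary vector field `E_P` in the internal coordinates. -/
def evoCoeff (P : Gen) : Coord → Laurent
  | .u i j => (dX ^ i) ((dT ^ j) (P .u))
  | .uy i k j => (dX ^ i) ((dY ^ (k + 1)) ((dT ^ j) (P .u)))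
  | .uz i l j => (dX ^ i) ((dZ ^ (l + 1)) ((dT ^ j) (P .u)))
  | .q α i j => (dX ^ i) ((dZ ^ j) (P (.q α)))
  | .m α i j => (dX ^ i) ((dZ ^ j) (P (.m α)))
  | .r n i j => (dY ^ i) ((dT ^ j) (P (.r n)))
  | _ => 0

/-- The evolutionary vector field `E_P` with the generating function `P`. -/
def evo (P : Gen) : Module.End ℝ Laurent := vf (evoCoeff P)

/-- The Jacobi bracket `{P, Q} = E_P(Q) - E_Q(P)`. -/
def jacobi (P Q : Gen) : Gen := fun d => evo P (Q d) - evo Q (P d)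

theorem vf_apply (c : Coord → Laurent) (f : Laurent) :
    vf c f = f.coeff.sum fun e s => s • e.sum fun a n =>
      (n : ℝ) • (mono (e - Finsupp.single a 1) * c a) := rfl

theorem vf_add (c d : Coord → Laurent) : vf (c + d) = vf c + vf d := by
  refine LinearMap.ext fun f => ?_
  simp only [vf_apply, LinearMap.add_apply, Pi.add_apply, mul_add, smul_add, Finsupp.sum_add]

theorem vf_smul (s : ℝ) (c : Coord → Laurent) : vf (s • c) = s • vf c := by
  refine LinearMap.ext fun f => ?_
  simp only [vf_apply, LinearMap.smul_apply, Pi.smul_apply, mul_smul_comm, Finsupp.smul_sum]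
  refine Finset.sum_congr rfl fun e _ => Finset.sum_congr rfl fun a _ => ?_
  simp only [smul_smul]
  congr 1
  ring

theorem evo_add (P Q : Gen) : evo (P + Q) = evo P + evo Q := by
  rw [evo, evo, evo, ← vf_add]
  congr 1
  funext a
  cases a <;> simp [evoCoeff]

theorem evo_smul (s : ℝ) (P : Gen) : evo (s • P) = s • evo P := by
  rw [evo, evo, ← vf_smul]
  congr 1
  funext a
  cases a <;> simp [evoCoeff]

/-- The symmetries form a Lie algebra under the Jacobi bracket: they are closed under it, and it
satisfies the Jacobi identity on them. (It is bilinear and alternating by its definition.) -/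
structure SymIsLie : Prop where
  closed : ∀ P ∈ sym, ∀ Q ∈ sym, jacobi P Q ∈ sym
  leibniz : ∀ P ∈ sym, ∀ Q ∈ sym, ∀ S ∈ sym,
    jacobi P (jacobi Q S) = jacobi (jacobi P Q) S + jacobi Q (jacobi P S)

/-- The Lie ring of symmetries, with the Jacobi bracket. -/
@[reducible] def symLieRing (h : SymIsLie) : LieRing sym where
  bracket P Q := ⟨jacobi P Q, h.closed P P.2 Q Q.2⟩
  add_lie P Q S := by
    ext1; funext d
    simp [jacobi, evo_add]; ring
  lie_add P Q S := by
    ext1; funext d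
    simp [jacobi, evo_add]; ring
  lie_self P := by
    ext1; funext d
    simp [jacobi]
  leibniz_lie P Q S := by
    ext1
    exact h.leibniz P P.2 Q Q.2 S S.2

/-- The real Lie algebra of symmetries, with the Jacobi bracket. -/
@[reducible] def symLieAlgebra (h : SymIsLie) : @LieAlgebra ℝ sym _ (symLieRing h) :=
  letI := symLieRing h
  { (inferInstance : Module ℝ sym) with
    lie_smul := by
      intro s P Q
      ext1; funext d
      change evo P (s • (Q : Gen) d) - evo (s • (Q : Gen)) ((P : Gen) d) =
        s • (evo P ((Q : Gen) d) - evo Q ((P : Gen) d))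
      simp [evo_smul, smul_sub] }

/-! ### The recursion operators -/

theorem pow_mul_pow (a : Coord) (m n : ℤ) : pow a m * pow a n = pow a (m + n) := by
  simp [pow, mono, AddMonoidAlgebra.single_mul_single, ← Finsupp.single_add]

theorem pow_zero (a : Coord) : pow a 0 = 1 := by
  simp [pow, mono, AddMonoidAlgebra.one_def]

/-- `1 / q_{0,x}`. -/
def q0xi : Laurent := pow (.q 0 1 0) (-1)
/-- `1 / m_{0,x}`. -/
def m0xi : Laurent := pow (.m 0 1 0) (-1)

theorem vz_mul_zi : vz * zi = 1 := by
  rw [vz, zi, X, pow_mul_pow]; simp [pow_zero]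
theorem vt_mul_ti : vt * ti = 1 := by
  rw [vt, ti, X, pow_mul_pow]; simp [pow_zero]
theorem qx_mul_q0xi : qx 0 * q0xi = 1 := by
  rw [qx, q0xi, X, pow_mul_pow]; simp [pow_zero]
theorem mx_mul_m0xi : mx 0 * m0xi = 1 := by
  rw [mx, m0xi, X, pow_mul_pow]; simp [pow_zero]

/-- The recursion operator `R^q` as a function. -/
def RqFun (P : Gen) : Gen
  | .u => ux * P .u + P (.r 0)
  | .q α => qx α * P .u + prev (fun β => P (.q β)) α
  | .m α => mx α * P .u - ti * prev (fun β => P (.m β)) α - vz * ti * P (.m α)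
  | .r n => rx (n + 1) * P .u - P (.r (n + 1))

/-- The `m`-components of the inverse of `R^q`, by recursion. -/
def RqInvM (p0 : Laurent) (P : Gen) : ℕ → Laurent
  | 0 => vt * zi * (mx 0 * p0 - P (.m 0))
  | α + 1 => vt * zi * (mx (α + 1) * p0 - P (.m (α + 1))) - zi * RqInvM p0 P α

/-- The inverse of `R^q` as a function. -/
def RqInvFun (P : Gen) : Gen
  | .u => q0xi * P (.q 0)
  | .q α => P (.q (α + 1)) - qx (α + 1) * (q0xi * P (.q 0))
  | .m α => RqInvM (q0xi * P (.q 0)) P α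
  | .r 0 => P .u - ux * (q0xi * P (.q 0))
  | .r (n + 1) => rx (n + 1) * (q0xi * P (.q 0)) - P (.r n)

/-- The recursion operator `R^q`, as an automorphism of the vector space of sequences. -/
def Rq : Gen ≃ₗ[ℝ] Gen where
  toFun := RqFun
  map_add' P Q := by
    funext d
    cases d <;> simp only [RqFun, Pi.add_apply, prev_add] <;> ring
  map_smul' c P := by
    funext d
    cases d <;> simp only [RqFun, Pi.smul_apply, prev_smul, RingHom.id_apply] <;>
      simp only [Algebra.smul_def] <;> ring
  invFun := RqInvFun
  left_inv P := by
    have h0 : q0xi * (qx 0 * P .u + 0) = P .u := by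
      linear_combination P .u * qx_mul_q0xi
    funext d
    rcases d with _ | α | α | n
    · simp only [RqInvFun, RqFun, prev, h0]
    · simp only [RqInvFun, RqFun, prev, h0]; ring
    · simp only [RqInvFun, RqFun, prev, h0]
      induction α with
      | zero =>
        simp only [RqInvM, RqFun, prev]
        linear_combination P (.m 0) * vz * zi * vt_mul_ti + P (.m 0) * vz_mul_zi
      | succ α ih =>
        simp only [RqInvM, RqFun, prev, ih]
        linear_combination (P (.m (α + 1)) * vz * zi + zi * P (.m α)) * vt_mul_ti
          + P (.m (α + 1)) * vz_mul_zi
    · cases n <;> simp only [RqInvFun, RqFun, prev, h0] <;> ring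
  right_inv P := by
    funext d
    rcases d with _ | α | α | n
    · simp only [RqInvFun, RqFun]; ring
    · cases α with
      | zero =>
        simp only [RqInvFun, RqFun, prev]; linear_combination P (.q 0) * qx_mul_q0xi
      | succ α => simp only [RqInvFun, RqFun, prev]; ring
    · cases α with
      | zero =>
        simp only [RqInvFun, RqFun, prev, RqInvM]
        linear_combination (P (.m 0) - mx 0 * (q0xi * P (.q 0))) * (vz * zi * vt_mul_ti + vz_mul_zi)
      | succ α =>
        simp only [RqInvFun, RqFun, prev, RqInvM]
        linear_combination (P (.m (α + 1)) - mx (α + 1) * (q0xi * P (.q 0))) *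
          (vz * zi * vt_mul_ti + vz_mul_zi) + ti * RqInvM (q0xi * P (.q 0)) P α * vz_mul_zi
    · simp only [RqInvFun, RqFun]; ring

/-- The recursion operator `R^m = t R^q + z id` as a function. -/
def RmFun (P : Gen) : Gen := fun d => vt * RqFun P d + vz * P d

/-- The `q`-components of the inverse of `R^m`, by recursion. -/
def RmInvQ (p0 : Laurent) (P : Gen) : ℕ → Laurent
  | 0 => zi * (P (.q 0) - vt * qx 0 * p0)
  | α + 1 => zi * (P (.q (α + 1)) - vt * qx (α + 1) * p0 - vt * RmInvQ p0 P α)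

/-- The `r`-components of the inverse of `R^m`, by recursion. -/
def RmInvR (p0 : Laurent) (P : Gen) : ℕ → Laurent
  | 0 => ti * (P .u - vz * p0) - ux * p0
  | n + 1 => rx (n + 1) * p0 + ti * (vz * RmInvR p0 P n - P (.r n))

/-- The inverse of `R^m` as a function. -/
def RmInvFun (P : Gen) : Gen
  | .u => ti * m0xi * P (.m 0)
  | .q α => RmInvQ (ti * m0xi * P (.m 0)) P α
  | .m α => vt * mx (α + 1) * (ti * m0xi * P (.m 0)) - P (.m (α + 1))
  | .r n => RmInvR (ti * m0xi * P (.m 0)) P n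

/-- The recursion operator `R^m = t R^q + z id`, as an automorphism of the vector space of
sequences. -/
def Rm : Gen ≃ₗ[ℝ] Gen where
  toFun := RmFun
  map_add' P Q := by
    funext d
    have h := congrFun (Rq.map_add P Q) d
    change RqFun (P + Q) d = RqFun P d + RqFun Q d at h
    simp only [RmFun, h, Pi.add_apply]; ring
  map_smul' c P := by
    funext d
    have h := congrFun (Rq.map_smul c P) d
    change RqFun (c • P) d = c • RqFun P d at h
    simp only [RmFun, h, Pi.smul_apply, RingHom.id_apply]
    simp only [Algebra.smul_def]; ring
  invFun := RmInvFun
  left_inv P := by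
    have h0 : ti * m0xi * (vt * (mx 0 * P .u - ti * 0 - vz * ti * P (.m 0)) + vz * P (.m 0))
        = P .u := by
      linear_combination (mx 0 * m0xi * P .u - ti * m0xi * vz * P (.m 0)) * vt_mul_ti
        + P .u * mx_mul_m0xi
    funext d
    rcases d with _ | α | α | n
    · simp only [RmInvFun, RmFun, RqFun, prev, h0]
    · simp only [RmInvFun, RmFun, RqFun, prev, h0]
      induction α with
      | zero =>
        simp only [RmInvQ, RmFun, RqFun, prev]
        linear_combination P (.q 0) * vz_mul_zi
      | succ α ih =>
        simp only [RmInvQ, RmFun, RqFun, prev, ih]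
        linear_combination P (.q (α + 1)) * vz_mul_zi
    · simp only [RmInvFun, RmFun, RqFun, prev, h0]
      linear_combination (P (.m α) + vz * P (.m (α + 1))) * vt_mul_ti
    · simp only [RmInvFun, RmFun, RqFun, prev, h0]
      induction n with
      | zero =>
        simp only [RmInvR, RmFun, RqFun]
        linear_combination (ux * P .u + P (.r 0)) * vt_mul_ti
      | succ n ih =>
        simp only [RmInvR, RmFun, RqFun, ih]
        linear_combination (P (.r (n + 1)) - rx (n + 1) * P .u) * vt_mul_ti
  right_inv P := by
    funext d
    rcases d with _ | α | α | n
    · simp only [RmInvFun, RmFun, RqFun, RmInvR]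
      linear_combination (P .u - vz * (ti * m0xi * P (.m 0))) * vt_mul_ti
    · cases α with
      | zero =>
        simp only [RmInvFun, RmFun, RqFun, prev, RmInvQ]
        linear_combination (P (.q 0) - vt * qx 0 * (ti * m0xi * P (.m 0))) * vz_mul_zi
      | succ α =>
        simp only [RmInvFun, RmFun, RqFun, prev, RmInvQ]
        linear_combination (P (.q (α + 1)) - vt * qx (α + 1) * (ti * m0xi * P (.m 0))
          - vt * RmInvQ (ti * m0xi * P (.m 0)) P α) * vz_mul_zi
    · cases α with
      | zero =>
        simp only [RmInvFun, RmFun, RqFun, prev]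
        linear_combination (mx 0 * m0xi * P (.m 0)
          - vz * (vt * mx 1 * (ti * m0xi * P (.m 0)) - P (.m 1))) * vt_mul_ti
          + P (.m 0) * mx_mul_m0xi
      | succ α =>
        simp only [RmInvFun, RmFun, RqFun, prev]
        linear_combination (P (.m (α + 1)) - vt * mx (α + 1) * (ti * m0xi * P (.m 0))
          - vz * (vt * mx (α + 2) * (ti * m0xi * P (.m 0)) - P (.m (α + 2)))) * vt_mul_ti
    · simp only [RmInvFun, RmFun, RqFun, RmInvR]
      linear_combination (P (.r n) - vz * RmInvR (ti * m0xi * P (.m 0)) P n) * vt_mul_ti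

/-- `R_i^j = ((R^q)⁻¹)^i ∘ (R^m)^j`, for integers `i` and `j`. These are the elements of the group
generated by `R^q` and `R^m`. -/
def R (i j : ℤ) : Gen ≃ₗ[ℝ] Gen := Rq⁻¹ ^ i * Rm ^ j

/-! ### The seed generators -/

/-- `Ω = [t u_t - x u_x + 2 u, …, t q_{α,t} - x q_{α,x} - α q_α, t m_{α,t} - x m_{α,x},
t r_{α+1,t} - x r_{α+1,x} + (α+3) r_{α+1}, …]`. -/
def Omega : Gen := fun d =>
  vt * dT (depX d) - X .x * dX (depX d) +
    match d with
    | .u => 2 * depX .u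
    | .q α => -((α : Laurent) * depX (.q α))
    | .m _ => 0
    | .r n => ((n : Laurent) + 3) * depX (.r n)

/-- `Ψ = [u_z, …, q_{α,z}, m_{α,z} - (α+1) m_{α+1}, r_{α+1,z}, …]`. -/
def Psi : Gen
  | .m α => dZ (depX (.m α)) - ((α : Laurent) + 1) * depX (.m (α + 1))
  | d => dZ (depX d)

/-- `𝔛 = t ∂/∂z + ∑_i (i+1) q_{i+1} ∂/∂q_i`. -/
def opX : Module.End ℝ Laurent := vf fun
  | .z => vt
  | .q i 0 0 => ((i : Laurent) + 1) * depX (.q (i + 1))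
  | _ => 0

/-- `𝔙 = z ∂/∂t + x ∂/∂y - 2u ∂/∂x + 3 r_1 ∂/∂u - ∑_{i ≥ 1} (i+3) r_{i+1} ∂/∂r_i`. -/
def opV : Module.End ℝ Laurent := vf fun
  | .t => vz
  | .y => X .x
  | .x => -2 * depX .u
  | .u 0 0 => 3 * depX (.r 0)
  | .r n 0 0 => -(((n : Laurent) + 4) * depX (.r (n + 1)))
  | _ => 0

/-- `𝔗 = ∂/∂z + ∑_i (i+1) m_{i+1} ∂/∂m_i`. -/
def opT : Module.End ℝ Laurent := vf fun
  | .z => 1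
  | .m i 0 0 => ((i : Laurent) + 1) * depX (.m (i + 1))
  | _ => 0

/-- `Ξ(A) = [0, A, 0, 0, 𝔛(A)/1!, 0, 0, 𝔛²(A)/2!, …]`. -/
def Xi (A : Laurent) : Gen
  | .q α => (1 / (α.factorial : ℝ)) • (opX ^ α) A
  | _ => 0

/-- `Υ(B) = [B, 0, 0, 𝔙(B)/1!, 0, 0, -𝔙²(B)/2!, 0, 0, 𝔙³(B)/3!, …]`. -/
def Upsilon (B : Laurent) : Gen
  | .u => B
  | .r n => ((-1) ^ n / ((n + 1).factorial : ℝ)) • (opV ^ (n + 1)) B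
  | _ => 0

/-- `Θ(C) = [0, 0, C, 0, 0, 𝔗(C)/1!, 0, 0, 𝔗²(C)/2!, …]`. -/
def Theta (C : Laurent) : Gen
  | .m α => (1 / (α.factorial : ℝ)) • (opT ^ α) C
  | _ => 0

/-- The index set of the seed generators. -/
inductive Seed : Type
  | Ω
  | Ψ
  | Ξ (ν : ℤ)
  | Υ (ν : ℤ)
  | Θ (ν : ℤ)

/-- The seed generators `Ω`, `Ψ`, `Ξ(q_0^ν)`, `Υ((y/t²)^ν)` and `Θ(m_0^ν)`. -/
def seed : Seed → Gen
  | .Ω => Omega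
  | .Ψ => Psi
  | .Ξ ν => Xi (pow (.q 0 0 0) ν)
  | .Υ ν => Upsilon (pow .y ν * pow .t (-2 * ν))
  | .Θ ν => Theta (pow (.m 0 0 0) ν)

/-- The element `R_i^j(P)` of the hierarchy of the seed generator `P`. -/
def hier (s : Seed) (i j : ℤ) : Gen := R i j (seed s)

/-- The span of the orbits of the seed generators under the group generated by `R^m`. -/
def V0 : Submodule ℝ Gen :=
  Submodule.span ℝ {P | ∃ (s : Seed) (j : ℤ), P = hier s 0 j}

/-- The span of the orbits of the seed generators under the group generated by `R^q` and `R^m`. -/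
def V : Submodule ℝ Gen :=
  Submodule.span ℝ {P | ∃ (s : Seed) (i j : ℤ), P = hier s i j}

end RYME

end

set_option linter.unusedSimpArgs false

noncomputable section

namespace RYME

/-! ### Derivations of the ring of Laurent polynomials -/

/-! Symmetries are identified with derivations. Every internal coordinate other than `x`, `y`, `z`,
`t` is an iterated total derivative of a dependent variable, so a derivation that kills `x`, `y`,
`z`, `t` and commutes with the four total derivatives is the evolutionary field of its values on the
dependent variables. Applying it to the equations shows that these values form a symmetry.
Conversely, the evolutionary field of a symmetry has these properties. The Jacobi bracket is then a
commutator of derivations, which gives the Lie algebra of symmetries (`IsInv.eq_evo`,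
`IsInv.isSymmetry`, `symIsLie`). Everything here rests on the commutation of the total derivatives,
where the compatibility of the system enters (`dT_rhsQy`, `dT_rhsMy`, `dX_rz`).

The seeds `Ξ`, `Θ`, `Υ` are handled by generating series. The exponential of the derivation 𝔛, 𝔗 or
𝔙 is a ring homomorphism into power series in ε. It sends q_0 to Q = Σ q_α ε^α, m_0 to M = Σ m_α
ε^α, y to Y = y + xε - uε² - r_1 ε³ + r_2 ε⁴ - …, and t to T = t + zε. Each covering equation, each
Lie derivative of a recursion operator and each bracket with another seed says how a certain
derivation of power series acts on Q, M, or Y and T. The Leibniz rule carries this to Q^ν, M^ν and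
Y^m T^n, negative exponents included.

The bracket table follows from three facts about the Lie derivative of an operator A along P, `lieD
P A Q` = {P, A Q} - A {P, Q}. It obeys the product rule in A. For A and B in the group generated by
R^q and R^m, the Lie derivative of B along A P is A applied to the Lie derivative of B along P, on
symmetries (vanishing Nijenhuis concomitants, `lieD_R_R`). Along the seeds it is explicit: Ω scales
R^q and fixes R^m, Ψ fixes R^q and sends R^m to -id, and the others fix both. Hence every bracket in
the hierarchy reduces to a bracket of seeds (`jacobi_R_R`).

The table then yields linear independence of all R_i^j(P), for all i and j at once. Brackets with Ω,
R_0^1(Ψ), Ξ(q_0), Θ(m_0) and R_0^2(Υ(y/t²)) are diagonal on the family, with integer weights that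
separate its elements up to sets of five. Such a set is resolved by further brackets with Ξ(q_0²),
Θ(m_0²) and Υ((y/t²)²). Directness of the sum, infinite dimension and the last claim are special
cases. -/

theorem mono_mul_mono (e e' : Coord →₀ ℤ) : mono e * mono e' = mono (e + e') := by
  simp [mono, AddMonoidAlgebra.single_mul_single]

theorem laurent_induction {p : Laurent → Prop} (f : Laurent) (hm : ∀ e, p (mono e))
    (ha : ∀ f g, p f → p g → p (f + g)) (hs : ∀ (s : ℝ) f, p f → p (s • f)) : p f := by
  induction f using AddMonoidAlgebra.induction_linear with
  | zero => simpa using hs 0 _ (hm 0)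
  | add f g hf hg => exact ha f g hf hg
  | single e s =>
    have h := hs s _ (hm e)
    rwa [mono, AddMonoidAlgebra.smul_single, smul_eq_mul, mul_one] at h

/-- Logarithmic form of the derivative: the factor next to the monomial is additive in the exponent
vector, which is why the Leibniz rule holds on monomials. -/
theorem vf_mono (c : Coord → Laurent) (e : Coord →₀ ℤ) :
    vf c (mono e) = mono e * e.sum fun a n => (n : ℝ) • (pow a (-1) * c a) := by
  rw [vf_apply, mono, AddMonoidAlgebra.coeff_single, Finsupp.sum_single_index (by simp), one_smul,
    Finsupp.mul_sum]
  refine Finset.sum_congr rfl fun a _ => ?_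
  change _ • (mono _ * _) = mono e * _
  rw [mul_smul_comm, ← mul_assoc, pow, mono_mul_mono, sub_eq_add_neg, Finsupp.single_neg]

/-- An endomorphism satisfying the Leibniz rule. -/
def IsDer (D : Module.End ℝ Laurent) : Prop := ∀ f g, D (f * g) = f * D g + g * D f

theorem isDer_vf (c : Coord → Laurent) : IsDer (vf c) := by
  intro f g
  induction f using laurent_induction with
  | hm e =>
    induction g using laurent_induction with
    | hm e' =>
      rw [mono_mul_mono, vf_mono, vf_mono, vf_mono, Finsupp.sum_add_index', ← mono_mul_mono]
      · ring
      · simp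
      · intro a m n; push_cast; rw [add_smul]
    | ha f g hf hg => simp only [mul_add, map_add, hf, hg]; ring
    | hs s f hf => simp only [map_smul, mul_smul_comm, smul_mul_assoc, hf, smul_add]
  | ha f g hf hg => simp only [mul_add, add_mul, map_add, hf, hg]; ring
  | hs s f hf => simp only [map_smul, mul_smul_comm, smul_mul_assoc, hf, smul_add]

namespace IsDer

variable {D D' : Module.End ℝ Laurent}

/-- The derivation given by an endomorphism satisfying the Leibniz rule. -/
def toDerivation (h : IsDer D) : Derivation ℝ Laurent Laurent :=
  Derivation.mk' D fun f g => h f g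

@[simp] theorem toDerivation_apply (h : IsDer D) (f : Laurent) : h.toDerivation f = D f := rfl

theorem one (h : IsDer D) : D 1 = 0 := h.toDerivation.map_one_eq_zero

theorem natCast (h : IsDer D) (n : ℕ) : D (n : Laurent) = 0 := h.toDerivation.map_natCast n

theorem ofNat (h : IsDer D) (n : ℕ) [n.AtLeastTwo] : D (OfNat.ofNat n : Laurent) = 0 :=
  h.natCast n

theorem comm (h : IsDer D) (h' : IsDer D') : IsDer (D * D' - D' * D) := by
  intro f g
  simp only [LinearMap.sub_apply, Module.End.mul_apply, h f, h' f, map_add, h _ _, h' _ _]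
  ring

end IsDer

theorem vf_X (c : Coord → Laurent) (a : Coord) : vf c (X a) = c a := by
  rw [X, pow, vf_mono, Finsupp.sum_single_index (by simp)]
  simp only [Int.cast_one, one_smul]
  rw [← mul_assoc]
  change pow a 1 * pow a (-1) * c a = c a
  rw [pow_mul_pow]; simp [pow_zero]

/-- A coordinate as a unit. -/
def unitX (a : Coord) : Laurentˣ where
  val := X a
  inv := pow a (-1)
  val_inv := by rw [X, pow_mul_pow]; simp [pow_zero]
  inv_val := by rw [X, pow_mul_pow]; simp [pow_zero]

theorem pow_eq_zpow (a : Coord) (n : ℤ) : pow a n = ((unitX a ^ n : Laurentˣ) : Laurent) := by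
  induction n using Int.induction_on with
  | zero => simp [pow_zero]
  | succ n ih => rw [← pow_mul_pow, ih, zpow_add_one]; rfl
  | pred n ih => rw [sub_eq_add_neg, ← pow_mul_pow, ih, zpow_add, zpow_neg_one]; rfl

/-- Stated for a general algebra because it serves both for Laurent polynomials and for power series
over them. -/
theorem derivation_zpow {A : Type*} [CommRing A] [Algebra ℝ A] (D : Derivation ℝ A A) (u : Aˣ)
    (n : ℤ) : D ((u ^ n : Aˣ) : A) = (n : A) * ((u ^ (n - 1) : Aˣ) : A) * D (u : A) := by
  have hinv : D ((u⁻¹ : Aˣ) : A) = -((u ^ (-2 : ℤ) : Aˣ) : A) * D (u : A) := by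
    rw [D.leibniz_of_mul_eq_one (a := ((u⁻¹ : Aˣ) : A)) (b := (u : A)) (by simp)]
    simp [zpow_neg, zpow_ofNat, ← inv_pow]
  induction n using Int.induction_on with
  | zero => simp
  | succ n ih =>
    rw [zpow_add_one, Units.val_mul, D.leibniz, ih, add_sub_cancel_right, smul_eq_mul, smul_eq_mul]
    have : ((u ^ (n : ℤ) : Aˣ) : A) = u * ((u ^ ((n : ℤ) - 1) : Aˣ) : A) := by
      rw [← Units.val_mul, ← zpow_one_add]; congr 2; ring
    push_cast [this]; ring
  | pred n ih =>
    rw [zpow_sub_one, Units.val_mul, D.leibniz, ih, hinv, smul_eq_mul, smul_eq_mul]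
    have h1 : ((u ^ (-(n : ℤ) - 1 - 1) : Aˣ) : A) =
        ((u ^ (-(n : ℤ)) : Aˣ) : A) * ((u ^ (-2 : ℤ) : Aˣ) : A) := by
      rw [← Units.val_mul, ← zpow_add]; congr 2; ring
    have h2 : ((u⁻¹ : Aˣ) : A) * ((u ^ (-(n : ℤ) - 1) : Aˣ) : A) =
        ((u ^ (-(n : ℤ)) : Aˣ) : A) * ((u ^ (-2 : ℤ) : Aˣ) : A) := by
      rw [← Units.val_mul, ← Units.val_mul, ← zpow_add, ← zpow_neg_one, ← zpow_add]; congr 2; ring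
    rw [h1]; push_cast
    linear_combination (-(n : A) * D u) * h2

theorem IsDer.apply_pow {D : Module.End ℝ Laurent} (h : IsDer D) (a : Coord) (n : ℤ) :
    D (pow a n) = (n : Laurent) * pow a (n - 1) * D (X a) := by
  rw [pow_eq_zpow, pow_eq_zpow]; exact derivation_zpow h.toDerivation (unitX a) n

/-! ### Subalgebras generated by sets of coordinates -/

/-- The subalgebra of Laurent polynomials in the coordinates from `S`. -/
def Supp (S : Set Coord) : Subalgebra ℝ Laurent :=
  Algebra.adjoin ℝ {f | ∃ a ∈ S, ∃ n, f = pow a n}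

theorem pow_mem_Supp {S : Set Coord} {a : Coord} (h : a ∈ S) (n : ℤ) : pow a n ∈ Supp S :=
  Algebra.subset_adjoin ⟨a, h, n, rfl⟩

theorem X_mem_Supp {S : Set Coord} {a : Coord} (h : a ∈ S) : X a ∈ Supp S := pow_mem_Supp h 1

theorem mem_Supp_univ (f : Laurent) : f ∈ Supp Set.univ := by
  induction f using laurent_induction with
  | hm e =>
    induction e using Finsupp.induction_linear with
    | zero => exact (Supp _).one_mem
    | add e e' he he' => rw [← mono_mul_mono]; exact (Supp _).mul_mem he he'
    | single a n => exact pow_mem_Supp (Set.mem_univ a) n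
  | ha f g hf hg => exact (Supp _).add_mem hf hg
  | hs s f hf => exact (Supp _).smul_mem hf s

/-- By the power rule, the value on a coordinate fixes the values on its negative powers too. -/
theorem IsDer.eqOn {D D' : Module.End ℝ Laurent} (h : IsDer D) (h' : IsDer D') {S : Set Coord}
    (H : ∀ a ∈ S, D (X a) = D' (X a)) {f : Laurent} (hf : f ∈ Supp S) : D f = D' f := by
  refine Derivation.eqOn_adjoin (D1 := h.toDerivation) (D2 := h'.toDerivation) ?_ hf
  rintro _ ⟨a, ha, n, rfl⟩
  simp only [toDerivation_apply, h.apply_pow, h'.apply_pow, H a ha]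

theorem IsDer.ext {D D' : Module.End ℝ Laurent} (h : IsDer D) (h' : IsDer D')
    (H : ∀ a, D (X a) = D' (X a)) : D = D' :=
  LinearMap.ext fun f => h.eqOn h' (fun a _ => H a) (mem_Supp_univ f)

theorem isDer_zero : IsDer 0 := fun f g => by simp

/-- The commutator is itself a derivation, so it vanishes on the subalgebra once it vanishes on the
coordinates. The subalgebra need not be stable under either derivation. -/
theorem IsDer.commOn {D D' : Module.End ℝ Laurent} (h : IsDer D) (h' : IsDer D') {S : Set Coord}
    (H : ∀ a ∈ S, D (D' (X a)) = D' (D (X a))) {f : Laurent} (hf : f ∈ Supp S) :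
    D (D' f) = D' (D f) := by
  have := (h.comm h').eqOn isDer_zero (S := S) (fun a ha => by simp [H a ha]) hf
  simpa [sub_eq_zero] using this

theorem IsDer.commute {D D' : Module.End ℝ Laurent} (h : IsDer D) (h' : IsDer D')
    (H : ∀ a, D (D' (X a)) = D' (D (X a))) : Commute D D' :=
  LinearMap.ext fun f => h.commOn h' (fun a _ => H a) (mem_Supp_univ f)

theorem IsDer.mapsTo {D : Module.End ℝ Laurent} (h : IsDer D) {S T : Set Coord}
    (hST : S ⊆ T) (H : ∀ a ∈ S, D (X a) ∈ Supp T) {f : Laurent} (hf : f ∈ Supp S) :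
    D f ∈ Supp T := by
  have hle : Supp S ≤ Supp T :=
    Algebra.adjoin_mono fun _ ⟨a, ha, n, e⟩ => ⟨a, hST ha, n, e⟩
  induction hf using Algebra.adjoin_induction with
  | mem f hf =>
    obtain ⟨a, ha, n, rfl⟩ := hf
    rw [h.apply_pow]
    exact (Supp T).mul_mem ((Supp T).mul_mem ((Supp T).intCast_mem n) (pow_mem_Supp (hST ha) _))
      (H a ha)
  | algebraMap r =>
    have h0 : D (algebraMap ℝ _ r) = 0 := h.toDerivation.map_algebraMap r
    rw [h0]; exact (Supp T).zero_mem
  | add f g _ _ hf hg => rw [map_add]; exact (Supp T).add_mem hf hg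
  | mul f g hf' hg' hf hg =>
    rw [h]; exact (Supp T).add_mem ((Supp T).mul_mem (hle hf') hg) ((Supp T).mul_mem (hle hg') hf)

theorem end_pow_mem {D : Module.End ℝ Laurent} {S : Subalgebra ℝ Laurent}
    (h : ∀ f ∈ S, D f ∈ S) (n : ℕ) {f : Laurent} (hf : f ∈ S) : (D ^ n) f ∈ S := by
  induction n with
  | zero => exact hf
  | succ n ih => rw [pow_succ', Module.End.mul_apply]; exact h _ ih

theorem end_pow_commOn {D E : Module.End ℝ Laurent} {S : Subalgebra ℝ Laurent}
    (h : ∀ f ∈ S, D f ∈ S) (hc : ∀ f ∈ S, E (D f) = D (E f)) (n : ℕ) {f : Laurent} (hf : f ∈ S) :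
    E ((D ^ n) f) = (D ^ n) (E f) := by
  induction n with
  | zero => rfl
  | succ n ih =>
    rw [pow_succ', Module.End.mul_apply, Module.End.mul_apply, hc _ (end_pow_mem h n hf), ih]

theorem end_pow_eqOn {D E : Module.End ℝ Laurent} {S : Subalgebra ℝ Laurent}
    (h : ∀ f ∈ S, D f ∈ S) (hc : ∀ f ∈ S, D f = E f) (n : ℕ) {f : Laurent} (hf : f ∈ S) :
    (D ^ n) f = (E ^ n) f := by
  induction n with
  | zero => rfl
  | succ n ih =>
    rw [pow_succ', pow_succ', Module.End.mul_apply, Module.End.mul_apply,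
      hc _ (end_pow_mem h n hf), ih]

/-! ### The total derivatives of the coordinates -/

theorem isDer_dX0 : IsDer dX0 := isDer_vf _

@[simp] theorem dX0_x : dX0 (X .x) = 1 := vf_X _ _
@[simp] theorem dX0_y : dX0 (X .y) = 0 := vf_X _ _
@[simp] theorem dX0_z : dX0 (X .z) = 0 := vf_X _ _
@[simp] theorem dX0_t : dX0 (X .t) = 0 := vf_X _ _
@[simp] theorem dX0_u (i j : ℕ) : dX0 (X (.u i j)) = X (.u (i + 1) j) := vf_X _ _
@[simp] theorem dX0_uy (i k j : ℕ) : dX0 (X (.uy i k j)) = X (.uy (i + 1) k j) := vf_X _ _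
@[simp] theorem dX0_uz (i l j : ℕ) : dX0 (X (.uz i l j)) = X (.uz (i + 1) l j) := vf_X _ _
@[simp] theorem dX0_q (α i j : ℕ) : dX0 (X (.q α i j)) = X (.q α (i + 1) j) := vf_X _ _
@[simp] theorem dX0_m (α i j : ℕ) : dX0 (X (.m α i j)) = X (.m α (i + 1) j) := vf_X _ _
@[simp] theorem dX0_r (n i j : ℕ) : dX0 (X (.r n i j)) = 0 := vf_X _ _

theorem isDer_dZ0 : IsDer dZ0 := isDer_vf _

@[simp] theorem dZ0_x : dZ0 (X .x) = 0 := vf_X _ _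
@[simp] theorem dZ0_y : dZ0 (X .y) = 0 := vf_X _ _
@[simp] theorem dZ0_z : dZ0 (X .z) = 1 := vf_X _ _
@[simp] theorem dZ0_t : dZ0 (X .t) = 0 := vf_X _ _
@[simp] theorem dZ0_u (i j : ℕ) : dZ0 (X (.u i j)) = X (.uz i 0 j) := vf_X _ _
@[simp] theorem dZ0_uy (i k j : ℕ) : dZ0 (X (.uy i k j)) = 0 := vf_X _ _
@[simp] theorem dZ0_uz (i l j : ℕ) : dZ0 (X (.uz i l j)) = X (.uz i (l + 1) j) := vf_X _ _
@[simp] theorem dZ0_q (α i j : ℕ) : dZ0 (X (.q α i j)) = X (.q α i (j + 1)) := vf_X _ _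
@[simp] theorem dZ0_m (α i j : ℕ) : dZ0 (X (.m α i j)) = X (.m α i (j + 1)) := vf_X _ _
@[simp] theorem dZ0_r (n i j : ℕ) : dZ0 (X (.r n i j)) = 0 := vf_X _ _

theorem isDer_dT : IsDer dT := isDer_vf _

@[simp] theorem dT_x : dT (X .x) = 0 := vf_X _ _
@[simp] theorem dT_y : dT (X .y) = 0 := vf_X _ _
@[simp] theorem dT_z : dT (X .z) = 0 := vf_X _ _
@[simp] theorem dT_t : dT (X .t) = 1 := vf_X _ _
@[simp] theorem dT_u (i j : ℕ) : dT (X (.u i j)) = X (.u i (j + 1)) := vf_X _ _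
@[simp] theorem dT_uy (i k j : ℕ) : dT (X (.uy i k j)) = X (.uy i k (j + 1)) := vf_X _ _
@[simp] theorem dT_uz (i l j : ℕ) : dT (X (.uz i l j)) = X (.uz i l (j + 1)) := vf_X _ _
@[simp] theorem dT_q (α i j : ℕ) : dT (X (.q α i j)) = (dX0 ^ i) ((dZ0 ^ j) (rhsQt α)) := vf_X _ _
@[simp] theorem dT_m (α i j : ℕ) : dT (X (.m α i j)) = (dX0 ^ i) ((dZ0 ^ j) (rhsMt α)) := vf_X _ _
@[simp] theorem dT_r (n i j : ℕ) : dT (X (.r n i j)) = X (.r n i (j + 1)) := vf_X _ _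

theorem isDer_dY : IsDer dY := isDer_vf _

@[simp] theorem dY_x : dY (X .x) = 0 := vf_X _ _
@[simp] theorem dY_y : dY (X .y) = 1 := vf_X _ _
@[simp] theorem dY_z : dY (X .z) = 0 := vf_X _ _
@[simp] theorem dY_t : dY (X .t) = 0 := vf_X _ _
@[simp] theorem dY_u (i j : ℕ) : dY (X (.u i j)) = X (.uy i 0 j) := vf_X _ _
@[simp] theorem dY_uy (i k j : ℕ) : dY (X (.uy i k j)) = X (.uy i (k + 1) j) := vf_X _ _
@[simp] theorem dY_uz (i l j : ℕ) : dY (X (.uz i l j)) = (dX0 ^ i) ((dZ0 ^ l) ((dT ^ j) rhsU)) := vf_X _ _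
@[simp] theorem dY_q (α i j : ℕ) : dY (X (.q α i j)) = (dX0 ^ i) ((dZ0 ^ j) (rhsQy α)) := vf_X _ _
@[simp] theorem dY_m (α i j : ℕ) : dY (X (.m α i j)) = (dX0 ^ i) ((dZ0 ^ j) (rhsMy α)) := vf_X _ _
@[simp] theorem dY_r (n i j : ℕ) : dY (X (.r n i j)) = X (.r n (i + 1) j) := vf_X _ _

theorem isDer_dX : IsDer dX := isDer_vf _

@[simp] theorem dX_x : dX (X .x) = 1 := vf_X _ _
@[simp] theorem dX_y : dX (X .y) = 0 := vf_X _ _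
@[simp] theorem dX_z : dX (X .z) = 0 := vf_X _ _
@[simp] theorem dX_t : dX (X .t) = 0 := vf_X _ _
@[simp] theorem dX_u (i j : ℕ) : dX (X (.u i j)) = X (.u (i + 1) j) := vf_X _ _
@[simp] theorem dX_uy (i k j : ℕ) : dX (X (.uy i k j)) = X (.uy (i + 1) k j) := vf_X _ _
@[simp] theorem dX_uz (i l j : ℕ) : dX (X (.uz i l j)) = X (.uz (i + 1) l j) := vf_X _ _
@[simp] theorem dX_q (α i j : ℕ) : dX (X (.q α i j)) = X (.q α (i + 1) j) := vf_X _ _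
@[simp] theorem dX_m (α i j : ℕ) : dX (X (.m α i j)) = X (.m α (i + 1) j) := vf_X _ _
@[simp] theorem dX_r (n i j : ℕ) : dX (X (.r n i j)) = (dY ^ i) ((dT ^ j) (rx (n + 1))) := vf_X _ _

theorem isDer_dZ : IsDer dZ := isDer_vf _

@[simp] theorem dZ_x : dZ (X .x) = 0 := vf_X _ _
@[simp] theorem dZ_y : dZ (X .y) = 0 := vf_X _ _
@[simp] theorem dZ_z : dZ (X .z) = 1 := vf_X _ _
@[simp] theorem dZ_t : dZ (X .t) = 0 := vf_X _ _
@[simp] theorem dZ_u (i j : ℕ) : dZ (X (.u i j)) = X (.uz i 0 j) := vf_X _ _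
@[simp] theorem dZ_uy (i k j : ℕ) : dZ (X (.uy i k j)) = (dX0 ^ i) ((dY ^ k) ((dT ^ j) rhsU)) := vf_X _ _
@[simp] theorem dZ_uz (i l j : ℕ) : dZ (X (.uz i l j)) = X (.uz i (l + 1) j) := vf_X _ _
@[simp] theorem dZ_q (α i j : ℕ) : dZ (X (.q α i j)) = X (.q α i (j + 1)) := vf_X _ _
@[simp] theorem dZ_m (α i j : ℕ) : dZ (X (.m α i j)) = X (.m α i (j + 1)) := vf_X _ _
@[simp] theorem dZ_r (n i j : ℕ) : dZ (X (.r n i j)) = (dY ^ i) ((dT ^ j) (rz (n + 1))) := vf_X _ _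

/-! ### The total derivatives commute -/

/-- The coordinates other than the derivatives of the `r_β`. -/
def noR : Set Coord := fun
  | .r _ _ _ => False
  | _ => True

/-- The coordinates of `noR` without `u_{x^i y^k t^j}`, `k > 0`. -/
def noUY : Set Coord := fun
  | .r _ _ _ => False
  | .uy _ _ _ => False
  | _ => True

/-- The coordinates of `noUY` without `u_{x^i t^j}`. -/
def noU : Set Coord := fun
  | .r _ _ _ => False
  | .uy _ _ _ => False
  | .u _ _ => False
  | _ => True

theorem Supp_mono {S T : Set Coord} (h : S ⊆ T) : Supp S ≤ Supp T :=
  Algebra.adjoin_mono fun _ ⟨a, ha, n, e⟩ => ⟨a, h ha, n, e⟩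

theorem noUY_subset_noR : noUY ⊆ noR := by
  intro a h; cases a <;> first | exact trivial | exact False.elim h
theorem noU_subset_noUY : noU ⊆ noUY := by
  intro a h; cases a <;> first | exact trivial | exact False.elim h

theorem dX0_comm_dZ0 : Commute dX0 dZ0 :=
  isDer_dX0.commute isDer_dZ0 fun a => by cases a <;> simp [isDer_dX0.one, isDer_dZ0.one]

theorem End.comm_apply {A B : Module.End ℝ Laurent} (h : Commute A B) (f : Laurent) :
    A (B f) = B (A f) := LinearMap.congr_fun h.eq f

theorem pow_succ_apply (A : Module.End ℝ Laurent) (n : ℕ) (f : Laurent) :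
    (A ^ (n + 1)) f = A ((A ^ n) f) := by rw [pow_succ', Module.End.mul_apply]

theorem dX0_comm_dT : Commute dX0 dT :=
  isDer_dX0.commute isDer_dT fun a => by
    cases a <;> simp [isDer_dX0.one, isDer_dT.one, pow_succ_apply]

theorem dZ0_comm_dT : Commute dZ0 dT :=
  isDer_dZ0.commute isDer_dT fun a => by
    cases a <;> simp [isDer_dZ0.one, isDer_dT.one, pow_succ_apply,
      End.comm_apply (dX0_comm_dZ0.symm.pow_right _)]

theorem dX0_comm_dY : Commute dX0 dY :=
  isDer_dX0.commute isDer_dY fun a => by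
    cases a <;> simp [isDer_dX0.one, isDer_dY.one, pow_succ_apply]

/-- The restriction is needed: `dY` turns u_{x^i t^j} into a coordinate u_{x^i y t^j}, on which
`dZ0` is zero instead of the true z-derivative. -/
theorem dZ0_dY {f : Laurent} (hf : f ∈ Supp noU) : dZ0 (dY f) = dY (dZ0 f) :=
  isDer_dZ0.commOn isDer_dY (fun a ha => by
    cases a <;> simp [isDer_dZ0.one, isDer_dY.one, pow_succ_apply,
      End.comm_apply (dX0_comm_dZ0.symm.pow_right _)]
    exact ha.elim) hf

/-! Membership of the right-hand sides. -/

theorem X_uz_mem (i l j : ℕ) : X (.uz i l j) ∈ Supp noU := X_mem_Supp trivial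
theorem X_q_mem (α i j : ℕ) : X (.q α i j) ∈ Supp noU := X_mem_Supp trivial
theorem X_m_mem (α i j : ℕ) : X (.m α i j) ∈ Supp noU := X_mem_Supp trivial
theorem vz_mem : vz ∈ Supp noU := X_mem_Supp trivial
theorem ti_mem : ti ∈ Supp noU := pow_mem_Supp (show Coord.t ∈ noU from trivial) _

theorem prev_mem {S : Subalgebra ℝ Laurent} {f : ℕ → Laurent} (h : ∀ α, f α ∈ S) (α : ℕ) :
    prev f α ∈ S := by
  cases α
  · exact S.zero_mem
  · exact h _

theorem rhsQt_mem (α : ℕ) : rhsQt α ∈ Supp noU :=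
  add_mem (mul_mem (X_uz_mem _ _ _) (X_q_mem _ _ _)) (prev_mem (fun _ => X_q_mem _ _ _) α)

theorem rhsMt_mem (α : ℕ) : rhsMt α ∈ Supp noU :=
  sub_mem (sub_mem (mul_mem (X_uz_mem _ _ _) (X_m_mem _ _ _))
    (mul_mem (mul_mem vz_mem ti_mem) (X_m_mem _ _ _)))
    (mul_mem ti_mem (prev_mem (fun _ => X_m_mem _ _ _) α))

theorem ux_mem : ux ∈ Supp noUY := X_mem_Supp trivial

theorem rhsU_mem : rhsU ∈ Supp noUY :=
  add_mem (sub_mem (X_mem_Supp trivial) (mul_mem (X_mem_Supp trivial) (X_mem_Supp trivial)))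
    (mul_mem (X_mem_Supp trivial) (X_mem_Supp trivial))

theorem rhsQy_mem (α : ℕ) : rhsQy α ∈ Supp noUY :=
  have hS := Supp_mono noU_subset_noUY
  add_mem (mul_mem ux_mem (hS (X_q_mem _ _ _))) (prev_mem (fun _ => hS (X_q_mem _ _ _)) α)

theorem rhsMy_mem (α : ℕ) : rhsMy α ∈ Supp noUY :=
  have hS := Supp_mono noU_subset_noUY
  sub_mem (sub_mem (mul_mem ux_mem (hS (X_m_mem _ _ _)))
    (hS (mul_mem (mul_mem vz_mem ti_mem) (X_m_mem _ _ _))))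
    (mul_mem (hS ti_mem) (prev_mem (fun _ => hS (X_m_mem _ _ _)) α))

theorem dX0_mul (f g : Laurent) : dX0 (f * g) = f * dX0 g + g * dX0 f := isDer_dX0 f g
theorem dX0_ti : dX0 ti = 0 := by
  rw [ti, isDer_dX0.apply_pow]; simp
theorem dX0_vz : dX0 vz = 0 := dX0_z
theorem dZ0_mul (f g : Laurent) : dZ0 (f * g) = f * dZ0 g + g * dZ0 f := isDer_dZ0 f g
theorem dZ0_ti : dZ0 ti = 0 := by
  rw [ti, isDer_dZ0.apply_pow]; simp
theorem dZ0_vz : dZ0 vz = 1 := dZ0_z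
theorem dT_mul (f g : Laurent) : dT (f * g) = f * dT g + g * dT f := isDer_dT f g
theorem dT_ti : dT ti = -(ti * ti) := by
  rw [ti, isDer_dT.apply_pow]; simp [pow_mul_pow]
theorem dT_vt : dT vt = 1 := dT_t
theorem dT_vz : dT vz = 0 := dT_z
theorem dY_mul (f g : Laurent) : dY (f * g) = f * dY g + g * dY f := isDer_dY f g
theorem dY_ti : dY ti = 0 := by
  rw [ti, isDer_dY.apply_pow]; simp
theorem dY_vt : dY vt = 0 := dY_t
theorem dY_vz : dY vz = 0 := dY_z
theorem dX_mul (f g : Laurent) : dX (f * g) = f * dX g + g * dX f := isDer_dX f g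
theorem dX_ti : dX ti = 0 := by
  rw [ti, isDer_dX.apply_pow]; simp
theorem dX_vt : dX vt = 0 := dX_t
theorem dX_vz : dX vz = 0 := dX_z
theorem dZ_mul (f g : Laurent) : dZ (f * g) = f * dZ g + g * dZ f := isDer_dZ f g
theorem dZ_ti : dZ ti = 0 := by
  rw [ti, isDer_dZ.apply_pow]; simp
theorem dZ_vt : dZ vt = 0 := dZ_t
theorem dZ_vz : dZ vz = 1 := dZ_z

theorem Supp.dZ0_mem {f : Laurent} (hf : f ∈ Supp noU) : dZ0 f ∈ Supp noU :=
  isDer_dZ0.mapsTo subset_rfl (fun a ha => by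
    cases a <;> simp only [dZ0_x, dZ0_y, dZ0_z, dZ0_t, dZ0_u, dZ0_uz, dZ0_q, dZ0_m, dZ0_uy, dZ0_r] <;>
      first | exact zero_mem _ | exact one_mem _ | exact X_mem_Supp trivial) hf

/-- Compatibility of the two equations for q_α: the mixed derivatives q_{α,yt} and q_{α,ty} agree
because of the equation for u_{yz}, which enters as `dY` of u_z. -/
theorem dT_rhsQy (α : ℕ) : dT (rhsQy α) = dY (rhsQt α) := by
  -- Two successive differentiations lower the index by up to two, so the convention f(-1) = 0
  -- affects both α = 0 and α = 1.
  rcases α with _ | _ | α <;>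
    simp [rhsQy, rhsQt, prev, dT_mul, dY_mul, dX0_mul, dZ0_mul, ux, uz, qx, qz, rhsU, uxx, uxz] <;>
    ring

theorem dT_rhsMy (α : ℕ) : dT (rhsMy α) = dY (rhsMt α) := by
  rcases α with _ | _ | α <;>
    simp [rhsMy, rhsMt, prev, dT_mul, dY_mul, dX0_mul, dZ0_mul, ux, uz, mx, mz, rhsU, uxx, uxz,
      dT_ti, dY_ti, dX0_ti, dZ0_ti, dT_vz, dX0_vz, dY_vz, dZ0_vz] <;>
    ring

/-- `dT` commutes with the auxiliary operators everywhere, but `dY` passes `dZ0` only on `noU`. This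
suffices because the right-hand sides for q_{α,t} and m_{α,t} contain u only through u_z. -/
theorem dT_comm_dY : Commute dT dY :=
  isDer_dT.commute isDer_dY fun a => by
    have h1 (i : ℕ) := End.comm_apply (dX0_comm_dT.symm.pow_right i)
    have h2 (i : ℕ) := End.comm_apply (dZ0_comm_dT.symm.pow_right i)
    have h3 (i : ℕ) := End.comm_apply (dX0_comm_dY.symm.pow_right i)
    have h4 {f : Laurent} (i : ℕ) (hf : f ∈ Supp noU) : dY ((dZ0 ^ i) f) = (dZ0 ^ i) (dY f) :=
      end_pow_commOn (fun f hf => Supp.dZ0_mem hf) (fun f hf => (dZ0_dY hf).symm) i hf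
    cases a <;> simp [isDer_dT.one, isDer_dY.one, pow_succ_apply, h1, h2, h3, dT_rhsQy, dT_rhsMy,
      h4 _ (rhsQt_mem _), h4 _ (rhsMt_mem _)]

/-- The auxiliary operators differ from the final ones only on the r-coordinates and, for `dZ0`,
also on u_{x^i y^k t^j} with k > 0. The expressions to which the definitions of the total
derivatives apply the auxiliary operators avoid these coordinates. -/
theorem dX_eq_dX0 {f : Laurent} (hf : f ∈ Supp noR) : dX f = dX0 f :=
  isDer_dX.eqOn isDer_dX0 (fun a ha => by cases a <;> simp; exact False.elim ha) hf

theorem dZ_eq_dZ0 {f : Laurent} (hf : f ∈ Supp noUY) : dZ f = dZ0 f :=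
  isDer_dZ.eqOn isDer_dZ0 (fun a ha => by cases a <;> simp <;> exact False.elim ha) hf

theorem Supp.dX0_mem_noR {f : Laurent} (hf : f ∈ Supp noR) : dX0 f ∈ Supp noR :=
  isDer_dX0.mapsTo subset_rfl (fun a ha => by
    cases a <;> simp only [dX0_x, dX0_y, dX0_z, dX0_t, dX0_u, dX0_uz, dX0_q, dX0_m, dX0_uy, dX0_r] <;>
      first | exact zero_mem _ | exact one_mem _ | exact X_mem_Supp trivial) hf

theorem Supp.dX0_mem {f : Laurent} (hf : f ∈ Supp noUY) : dX0 f ∈ Supp noUY :=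
  isDer_dX0.mapsTo subset_rfl (fun a ha => by
    cases a <;> simp only [dX0_x, dX0_y, dX0_z, dX0_t, dX0_u, dX0_uz, dX0_q, dX0_m, dX0_uy, dX0_r] <;>
      first | exact zero_mem _ | exact one_mem _ | exact X_mem_Supp trivial | exact False.elim ha) hf

theorem Supp.dZ0_mem_noUY {f : Laurent} (hf : f ∈ Supp noUY) : dZ0 f ∈ Supp noUY :=
  isDer_dZ0.mapsTo subset_rfl (fun a ha => by
    cases a <;> simp only [dZ0_x, dZ0_y, dZ0_z, dZ0_t, dZ0_u, dZ0_uz, dZ0_q, dZ0_m, dZ0_uy, dZ0_r] <;>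
      first | exact zero_mem _ | exact one_mem _ | exact X_mem_Supp trivial) hf

theorem Supp.dXZ_mem (i j : ℕ) {f : Laurent} (hf : f ∈ Supp noUY) :
    (dX0 ^ i) ((dZ0 ^ j) f) ∈ Supp noUY :=
  end_pow_mem (fun _ hf => Supp.dX0_mem hf) _ (end_pow_mem (fun _ hf => Supp.dZ0_mem_noUY hf) _ hf)

theorem Supp.dT_mem {f : Laurent} (hf : f ∈ Supp noUY) : dT f ∈ Supp noUY :=
  have hS := Supp_mono noU_subset_noUY
  isDer_dT.mapsTo subset_rfl (fun a ha => by
    cases a with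
    | q α i j => rw [dT_q]; exact Supp.dXZ_mem _ _ (hS (rhsQt_mem _))
    | m α i j => rw [dT_m]; exact Supp.dXZ_mem _ _ (hS (rhsMt_mem _))
    | r n i j => exact False.elim ha
    | uy i k j => exact False.elim ha
    | _ => simp <;> first | exact zero_mem _ | exact one_mem _ | exact X_mem_Supp trivial) hf

theorem Supp.dT_mem_noR {f : Laurent} (hf : f ∈ Supp noR) : dT f ∈ Supp noR :=
  have hS := Supp_mono noUY_subset_noR
  isDer_dT.mapsTo subset_rfl (fun a ha => by
    cases a with
    | q α i j => exact hS (Supp.dT_mem (X_mem_Supp trivial))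
    | m α i j => exact hS (Supp.dT_mem (X_mem_Supp trivial))
    | r n i j => exact False.elim ha
    | _ => simp <;> first | exact zero_mem _ | exact one_mem _ | exact X_mem_Supp trivial) hf

theorem Supp.dY_mem_noR {f : Laurent} (hf : f ∈ Supp noR) : dY f ∈ Supp noR :=
  have hS := Supp_mono noUY_subset_noR
  isDer_dY.mapsTo subset_rfl (fun a ha => by
    cases a with
    | q α i j => rw [dY_q]; exact hS (Supp.dXZ_mem _ _ (rhsQy_mem _))
    | m α i j => rw [dY_m]; exact hS (Supp.dXZ_mem _ _ (rhsMy_mem _))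
    | uz i l j =>
      rw [dY_uz]
      exact hS (Supp.dXZ_mem _ _ (end_pow_mem (fun f hf => Supp.dT_mem hf) _ rhsU_mem))
    | r n i j => exact False.elim ha
    | _ => simp <;> first | exact zero_mem _ | exact one_mem _ | exact X_mem_Supp trivial) hf

/-- Away from the r-coordinates this is the commutation for `dX0`, since `dT` preserves `noR`. On an
r-coordinate, `dX` gives iterated y- and t-derivatives of r_{β,x}, so the commutation of `dT` with
`dY` is enough. -/
theorem dX_comm_dT : Commute dX dT :=
  isDer_dX.commute isDer_dT fun a => by
    have h (h : X a ∈ Supp noR) : dX (dT (X a)) = dT (dX (X a)) := by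
      rw [dX_eq_dX0 (Supp.dT_mem_noR h), dX_eq_dX0 h, End.comm_apply dX0_comm_dT]
    cases a with
    | r n i j => simp [pow_succ_apply, End.comm_apply (dT_comm_dY.pow_right _)]
    | _ => exact h (X_mem_Supp trivial)

theorem dX_comm_dY : Commute dX dY :=
  isDer_dX.commute isDer_dY fun a => by
    have h (h : X a ∈ Supp noR) : dX (dY (X a)) = dY (dX (X a)) := by
      rw [dX_eq_dX0 (Supp.dY_mem_noR h), dX_eq_dX0 h, End.comm_apply dX0_comm_dY]
    cases a with
    | r n i j => simp [pow_succ_apply]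
    | _ => exact h (X_mem_Supp trivial)

theorem dT_pow_mem (j : ℕ) {f : Laurent} (hf : f ∈ Supp noUY) : (dT ^ j) f ∈ Supp noUY :=
  end_pow_mem (fun _ hf => Supp.dT_mem hf) _ hf

theorem dZ_dXZ (i j : ℕ) {f : Laurent} (hf : f ∈ Supp noUY) :
    dZ ((dX0 ^ i) ((dZ0 ^ j) f)) = (dX0 ^ i) ((dZ0 ^ (j + 1)) f) := by
  rw [dZ_eq_dZ0 (Supp.dXZ_mem i j hf), End.comm_apply (dX0_comm_dZ0.symm.pow_right _),
    pow_succ_apply]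

theorem dZ_comm_dT : Commute dZ dT :=
  isDer_dZ.commute isDer_dT fun a => by
    have hS := Supp_mono noU_subset_noUY
    have h1 (i : ℕ) := End.comm_apply (dX0_comm_dT.symm.pow_right i)
    cases a <;> simp [isDer_dZ.one, isDer_dT.one, pow_succ_apply, h1,
      End.comm_apply (dT_comm_dY.pow_right _), dZ_dXZ, hS (rhsQt_mem _), hS (rhsMt_mem _)]

theorem dZ_comm_dY : Commute dZ dY :=
  isDer_dZ.commute isDer_dY fun a => by
    have h1 (i : ℕ) := End.comm_apply (dX0_comm_dY.symm.pow_right i)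
    have h2 (i j : ℕ) := dZ_dXZ i 0 (dT_pow_mem j rhsU_mem)
    cases a <;> simp [isDer_dZ.one, isDer_dY.one, pow_succ_apply, h1, dZ_dXZ, rhsQy_mem, rhsMy_mem,
      dT_pow_mem, rhsU_mem]

theorem dX_rt (β : ℕ) : dX (rt β) = dT (rx β) := by
  cases β with
  | zero => simp [rt, rx, ux]
  | succ n => simp [rt]

theorem dX_ry (β : ℕ) : dX (ry β) = dY (rx β) := by
  cases β with
  | zero => simp [ry, rx, ux]
  | succ n => simp [ry]

theorem dZ_ry (β : ℕ) : dZ (ry β) = dY (rz β) := by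
  cases β with
  | zero => simp [ry, rz, uz]
  | succ n => simp [ry]

theorem dT_ry (β : ℕ) : dT (ry β) = dY (rt β) := by
  cases β with
  | zero => simp [ry, rt]
  | succ n => simp [ry, rt]

theorem rz_succ (β : ℕ) : rz (β + 1) = uz * rx β - rt β := rfl
theorem rx_succ (β : ℕ) : rx (β + 1) = ux * rx β - ry β := rfl

/-- Compatibility of the equations for r_{β,x} and r_{β,z}. The induction on β needs, at each stage,
the identity u_z r_{β,xx} - r_{β,xt} = u_x r_{β,xz} - r_{β,zy}; for β = 0, where r_0 = -u, it is the
equation for u itself. -/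
theorem dX_rz (β : ℕ) : dX (rz β) = dZ (rx β) := by
  have e1 : dX ux = uxx := dX_u 1 0
  have e2 : dX uz = uxz := dX_uz 0 0 0
  have e3 : dZ ux = uxz := dZ_u 1 0
  have e4 : dY uz = rhsU := dY_uz 0 0 0
  have e5 : dT ux = X (.u 1 1) := dT_u 1 0
  have key (γ : ℕ) (h : dX (rz γ) = dZ (rx γ))
      (h' : uz * dX (rx γ) - dT (rx γ) = ux * dZ (rx γ) - dY (rz γ)) :
      dX (rz (γ + 1)) = dZ (rx (γ + 1)) := by
    simp only [rx_succ, rz_succ, map_sub, dX_mul, dZ_mul, dX_rt, dZ_ry, e2, e3]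
    linear_combination h'
  -- The auxiliary identity at γ is deduced from the compatibility at γ, so both advance together in
  -- the induction.
  have key' (γ : ℕ) (h : dX (rz γ) = dZ (rx γ)) :
      uz * dX (rx γ) - dT (rx γ) = ux * dZ (rx γ) - dY (rz γ) := by
    rw [← h]
    cases γ with
    | zero => simp only [rx, rz, map_neg, e1, e2, e4, e5, rhsU]; ring
    | succ γ =>
      simp only [rx_succ, rz_succ, map_sub, dX_mul, dY_mul, dT_mul, dX_rt, dX_ry, dT_ry, e1, e2, e4, e5,
        rhsU]
      ring
  induction β with
  | zero => simp only [rx, rz, map_neg, e2, e3]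
  | succ γ h => exact key γ h (key' γ h)

theorem dX_comm_dZ : Commute dX dZ :=
  isDer_dX.commute isDer_dZ fun a => by
    have hS := Supp_mono noUY_subset_noR
    have hmem (i k j : ℕ) : (dX0 ^ i) ((dY ^ k) ((dT ^ j) rhsU)) ∈ Supp noR :=
      end_pow_mem (fun _ hf => Supp.dX0_mem_noR hf) _
        (end_pow_mem (fun _ hf => Supp.dY_mem_noR hf) _ (hS (dT_pow_mem _ rhsU_mem)))
    cases a with
    | uy i k j => simp [dX_eq_dX0 (hmem _ _ _), pow_succ_apply]
    | r n i j =>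
      simp only [dX_r, dZ_r]
      rw [End.comm_apply (dX_comm_dY.pow_right _), End.comm_apply (dX_comm_dT.pow_right _),
        End.comm_apply (dZ_comm_dY.pow_right _), End.comm_apply (dZ_comm_dT.pow_right _), dX_rz]
    | _ => simp [isDer_dX.one, isDer_dZ.one]

/-! ### Evolutionary vector fields of symmetries commute with the total derivatives -/

theorem isDer_evo (P : Gen) : IsDer (evo P) := isDer_vf _
theorem evo_mul (P : Gen) (f g : Laurent) : evo P (f * g) = f * evo P g + g * evo P f :=
  isDer_evo P f g

@[simp] theorem evo_x (P : Gen) : evo P (X .x) = 0 := vf_X _ _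
@[simp] theorem evo_y (P : Gen) : evo P (X .y) = 0 := vf_X _ _
@[simp] theorem evo_z (P : Gen) : evo P (X .z) = 0 := vf_X _ _
@[simp] theorem evo_t (P : Gen) : evo P (X .t) = 0 := vf_X _ _
@[simp] theorem evo_u (P : Gen) (i j : ℕ) :
    evo P (X (.u i j)) = (dX ^ i) ((dT ^ j) (P .u)) := vf_X _ _
@[simp] theorem evo_uy (P : Gen) (i k j : ℕ) :
    evo P (X (.uy i k j)) = (dX ^ i) ((dY ^ (k + 1)) ((dT ^ j) (P .u))) := vf_X _ _
@[simp] theorem evo_uz (P : Gen) (i l j : ℕ) :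
    evo P (X (.uz i l j)) = (dX ^ i) ((dZ ^ (l + 1)) ((dT ^ j) (P .u))) := vf_X _ _
@[simp] theorem evo_q (P : Gen) (α i j : ℕ) :
    evo P (X (.q α i j)) = (dX ^ i) ((dZ ^ j) (P (.q α))) := vf_X _ _
@[simp] theorem evo_m (P : Gen) (α i j : ℕ) :
    evo P (X (.m α i j)) = (dX ^ i) ((dZ ^ j) (P (.m α))) := vf_X _ _
@[simp] theorem evo_r (P : Gen) (n i j : ℕ) :
    evo P (X (.r n i j)) = (dY ^ i) ((dT ^ j) (P (.r n))) := vf_X _ _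

@[simp] theorem evo_depX (P : Gen) (d : Dep) : evo P (depX d) = P d := by
  cases d <;> simp [depX]

theorem evo_vz (P : Gen) : evo P vz = 0 := evo_z P
theorem evo_vt (P : Gen) : evo P vt = 0 := evo_t P
theorem evo_ti (P : Gen) : evo P ti = 0 := by rw [ti, (isDer_evo P).apply_pow]; simp
theorem evo_ux' (P : Gen) : evo P ux = dX (P .u) := by simp [ux]
theorem evo_uz' (P : Gen) : evo P uz = dZ (P .u) := by simp [uz]
theorem evo_qx (P : Gen) (α : ℕ) : evo P (qx α) = dX (P (.q α)) := by simp [qx]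
theorem evo_mx (P : Gen) (α : ℕ) : evo P (mx α) = dX (P (.m α)) := by simp [mx]

theorem map_prev (D : Module.End ℝ Laurent) (f : ℕ → Laurent) (α : ℕ) :
    D (prev f α) = prev (fun β => D (f β)) α := by cases α <;> simp [prev]

theorem Supp.dX_mem {f : Laurent} (hf : f ∈ Supp noUY) : dX f ∈ Supp noUY := by
  rw [dX_eq_dX0 (Supp_mono noUY_subset_noR hf)]; exact Supp.dX0_mem hf

theorem Supp.dZ_mem {f : Laurent} (hf : f ∈ Supp noUY) : dZ f ∈ Supp noUY := by
  rw [dZ_eq_dZ0 hf]; exact Supp.dZ0_mem_noUY hf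

/-- Rewrites the staged definitions of `dT` and `dY` in terms of the final operators, with which
evolutionary fields are to commute. -/
theorem dXZ_eq (i j : ℕ) {f : Laurent} (hf : f ∈ Supp noUY) :
    (dX0 ^ i) ((dZ0 ^ j) f) = (dX ^ i) ((dZ ^ j) f) := by
  rw [← end_pow_eqOn (fun _ hf => Supp.dZ_mem hf) (fun _ hf => dZ_eq_dZ0 hf) j hf,
    ← end_pow_eqOn (fun _ hf => Supp.dX_mem hf)
      (fun _ hf => dX_eq_dX0 (Supp_mono noUY_subset_noR hf)) i
      (end_pow_mem (fun _ hf => Supp.dZ_mem hf) _ hf)]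

theorem dXY_eq (i k j : ℕ) :
    (dX0 ^ i) ((dY ^ k) ((dT ^ j) rhsU)) = (dX ^ i) ((dY ^ k) ((dT ^ j) rhsU)) :=
  end_pow_eqOn (S := Supp noR) (fun _ hf => Supp.dX0_mem_noR hf) (fun _ hf => (dX_eq_dX0 hf).symm) i
    (end_pow_mem (fun _ hf => Supp.dY_mem_noR hf) _
      (Supp_mono noUY_subset_noR (dT_pow_mem _ rhsU_mem)))

/-- No symmetry condition is needed here: on these coordinates `dX` and `dZ` merely raise an index,
and the coefficients of `evo P` are defined by the same prolongation. -/
theorem evo_dX_noUY (P : Gen) {f : Laurent} (hf : f ∈ Supp noUY) :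
    evo P (dX f) = dX (evo P f) :=
  (isDer_evo P).commOn isDer_dX (fun a ha => by
    cases a <;> simp [(isDer_evo P).one, pow_succ_apply]; exact False.elim ha) hf

theorem evo_dZ_noUY (P : Gen) {f : Laurent} (hf : f ∈ Supp noUY) :
    evo P (dZ f) = dZ (evo P f) :=
  (isDer_evo P).commOn isDer_dZ (fun a ha => by
    cases a <;> simp [(isDer_evo P).one, pow_succ_apply,
      End.comm_apply (dX_comm_dZ.symm.pow_right _)] <;> exact False.elim ha) hf

theorem evo_dXZ (P : Gen) (i j : ℕ) {f : Laurent} (hf : f ∈ Supp noUY) :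
    evo P ((dX ^ i) ((dZ ^ j) f)) = (dX ^ i) ((dZ ^ j) (evo P f)) := by
  rw [end_pow_commOn (fun _ hf => Supp.dX_mem hf) (fun _ hf => evo_dX_noUY P hf) i
      (end_pow_mem (fun _ hf => Supp.dZ_mem hf) _ hf),
    end_pow_commOn (fun _ hf => Supp.dZ_mem hf) (fun _ hf => evo_dZ_noUY P hf) j hf]

theorem comm_pow {A B : Module.End ℝ Laurent} (h : Commute A B) (n : ℕ) (f : Laurent) :
    A ((B ^ n) f) = (B ^ n) (A f) := End.comm_apply (h.pow_right n) f

namespace IsSymmetry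

/-- The linearized equation is the evolutionary field applied to the equation. This and the
analogous lemmas below are where the symmetry conditions enter. -/
theorem evo_rhsQt {P : Gen} (hP : IsSymmetry P) (α : ℕ) : evo P (rhsQt α) = dT (P (.q α)) := by
  have h := hP.ns2 α
  rw [map_prev] at h
  have e : evo P (prev qz α) = prev (fun β => dZ (P (.q β))) α := by
    rw [map_prev]; cases α <;> simp [prev, qz]
  simp only [rhsQt, map_add, evo_mul, evo_uz', evo_qx, e]
  linear_combination -h

theorem evo_rhsQy {P : Gen} (hP : IsSymmetry P) (α : ℕ) : evo P (rhsQy α) = dY (P (.q α)) := by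
  have h := hP.ns3 α
  rw [map_prev] at h
  have e : evo P (prev qx α) = prev (fun β => dX (P (.q β))) α := by
    rw [map_prev]; cases α <;> simp [prev, qx]
  simp only [rhsQy, map_add, evo_mul, evo_ux', evo_qx, e]
  linear_combination -h

theorem evo_rhsMt {P : Gen} (hP : IsSymmetry P) (α : ℕ) : evo P (rhsMt α) = dT (P (.m α)) := by
  have h := hP.ns4 α
  rw [map_prev] at h
  have e : evo P (prev mz α) = prev (fun β => dZ (P (.m β))) α := by
    rw [map_prev]; cases α <;> simp [prev, mz]
  have e' : evo P (mz α) = dZ (P (.m α)) := by simp [mz]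
  simp only [rhsMt, map_sub, evo_mul, evo_uz', evo_mx, e, e', evo_vz, evo_ti]
  linear_combination -h

theorem evo_rhsMy {P : Gen} (hP : IsSymmetry P) (α : ℕ) : evo P (rhsMy α) = dY (P (.m α)) := by
  have h := hP.ns5 α
  rw [map_prev] at h
  have e : evo P (prev mx α) = prev (fun β => dX (P (.m β))) α := by
    rw [map_prev]; cases α <;> simp [prev, mx]
  simp only [rhsMy, map_sub, evo_mul, evo_ux', evo_mx, e, evo_vz, evo_ti]
  linear_combination -h

theorem evo_rhsU {P : Gen} (hP : IsSymmetry P) : evo P rhsU = dY (dZ (P .u)) := by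
  have h := hP.ns1
  simp only [rhsU, map_sub, map_add, evo_mul, evo_ux', evo_uz', evo_u, uxx, uxz, evo_uz]
  simp only [zero_add, pow_one, _root_.pow_zero, Module.End.one_apply, pow_succ_apply, uxx, uxz,
    End.comm_apply dX_comm_dT] at h ⊢
  linear_combination -h

/-- Only the derivatives of q_α and m_α need an argument, since only there is the t-derivative not
an internal coordinate. Elsewhere the claim is the prolongation formula and commutation of total
derivatives. -/
theorem evo_dT {P : Gen} (hP : IsSymmetry P) (f : Laurent) : evo P (dT f) = dT (evo P f) := by
  have hS := Supp_mono noU_subset_noUY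
  refine (isDer_evo P).commOn isDer_dT (fun a _ => ?_) (mem_Supp_univ f)
  cases a with
  | q α i j =>
    rw [dT_q, dXZ_eq _ _ (hS (rhsQt_mem α)), evo_dXZ P _ _ (hS (rhsQt_mem α)), hP.evo_rhsQt, evo_q,
      comm_pow dX_comm_dT.symm, comm_pow dZ_comm_dT.symm]
  | m α i j =>
    rw [dT_m, dXZ_eq _ _ (hS (rhsMt_mem α)), evo_dXZ P _ _ (hS (rhsMt_mem α)), hP.evo_rhsMt, evo_m,
      comm_pow dX_comm_dT.symm, comm_pow dZ_comm_dT.symm]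
  | _ =>
    simp [(isDer_evo P).one, pow_succ_apply, comm_pow dX_comm_dT.symm, comm_pow dZ_comm_dT.symm,
      comm_pow dT_comm_dY, ← End.comm_apply dZ_comm_dT, End.comm_apply dT_comm_dY]

theorem commute_evo_dT {P : Gen} (hP : IsSymmetry P) : Commute (evo P) dT := LinearMap.ext hP.evo_dT

theorem evo_dY {P : Gen} (hP : IsSymmetry P) (f : Laurent) : evo P (dY f) = dY (evo P f) := by
  have hS := Supp_mono noU_subset_noUY
  refine (isDer_evo P).commOn isDer_dY (fun a _ => ?_) (mem_Supp_univ f)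
  cases a with
  | q α i j =>
    rw [dY_q, dXZ_eq _ _ (rhsQy_mem α), evo_dXZ P _ _ (rhsQy_mem α), hP.evo_rhsQy, evo_q,
      comm_pow dX_comm_dY.symm, comm_pow dZ_comm_dY.symm]
  | m α i j =>
    rw [dY_m, dXZ_eq _ _ (rhsMy_mem α), evo_dXZ P _ _ (rhsMy_mem α), hP.evo_rhsMy, evo_m,
      comm_pow dX_comm_dY.symm, comm_pow dZ_comm_dY.symm]
  | uz i l j =>
    have hm := dT_pow_mem j rhsU_mem
    rw [dY_uz, dXZ_eq _ _ hm, evo_dXZ P _ _ hm, comm_pow hP.commute_evo_dT, hP.evo_rhsU, evo_uz,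
      comm_pow dX_comm_dY.symm, comm_pow dZ_comm_dY.symm, comm_pow dT_comm_dY.symm, pow_succ,
      Module.End.mul_apply, ← End.comm_apply dZ_comm_dY, comm_pow dZ_comm_dT]
  | _ =>
    simp [(isDer_evo P).one, pow_succ_apply, comm_pow dX_comm_dY.symm]

theorem commute_evo_dY {P : Gen} (hP : IsSymmetry P) : Commute (evo P) dY := LinearMap.ext hP.evo_dY

/-- The recursion that eliminates r_{β,x} linearizes to the conditions `ns6` and `ns8`, hence the
induction along it. -/
theorem evo_rx {P : Gen} (hP : IsSymmetry P) (n : ℕ) : evo P (rx (n + 1)) = dX (P (.r n)) := by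
  induction n with
  | zero =>
    have h := hP.ns6
    simp only [rx, ry, map_sub, map_neg, evo_mul, evo_ux', evo_uy]
    simp only [zero_add, pow_one, _root_.pow_zero, Module.End.one_apply]
    linear_combination -h
  | succ n ih =>
    have h := hP.ns8 n
    rw [rx_succ, map_sub, evo_mul, evo_ux', ih]
    simp only [ry, evo_r, pow_one, _root_.pow_zero, Module.End.one_apply]
    linear_combination -h

theorem evo_rz {P : Gen} (hP : IsSymmetry P) (n : ℕ) : evo P (rz (n + 1)) = dZ (P (.r n)) := by
  cases n with
  | zero =>
    have h := hP.ns7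
    simp only [rz, rx, rt, map_sub, map_neg, evo_mul, evo_ux', evo_uz', evo_u]
    simp only [pow_one, _root_.pow_zero, Module.End.one_apply]
    linear_combination -h
  | succ n =>
    have h := hP.ns9 n
    rw [rz_succ, map_sub, evo_mul, evo_uz', hP.evo_rx]
    simp only [rt, evo_r, pow_one, _root_.pow_zero, Module.End.one_apply]
    linear_combination -h

theorem evo_dX {P : Gen} (hP : IsSymmetry P) (f : Laurent) : evo P (dX f) = dX (evo P f) := by
  refine (isDer_evo P).commOn isDer_dX (fun a _ => ?_) (mem_Supp_univ f)
  cases a with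
  | r n i j =>
    rw [dX_r, comm_pow hP.commute_evo_dY, comm_pow hP.commute_evo_dT, hP.evo_rx, evo_r,
      comm_pow dX_comm_dY, comm_pow dX_comm_dT]
  | _ => simp [(isDer_evo P).one, pow_succ_apply]

theorem commute_evo_dX {P : Gen} (hP : IsSymmetry P) : Commute (evo P) dX := LinearMap.ext hP.evo_dX

theorem evo_dZ {P : Gen} (hP : IsSymmetry P) (f : Laurent) : evo P (dZ f) = dZ (evo P f) := by
  refine (isDer_evo P).commOn isDer_dZ (fun a _ => ?_) (mem_Supp_univ f)
  cases a with
  | r n i j =>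
    rw [dZ_r, comm_pow hP.commute_evo_dY, comm_pow hP.commute_evo_dT, hP.evo_rz, evo_r,
      comm_pow dZ_comm_dY, comm_pow dZ_comm_dT]
  | uy i k j =>
    rw [dZ_uy, dXY_eq, comm_pow hP.commute_evo_dX, comm_pow hP.commute_evo_dY,
      comm_pow hP.commute_evo_dT, hP.evo_rhsU, evo_uy, pow_succ, Module.End.mul_apply,
      comm_pow dX_comm_dZ.symm, comm_pow dZ_comm_dY, comm_pow dT_comm_dY.symm,
      ← End.comm_apply dZ_comm_dY, comm_pow dZ_comm_dT]
  | _ =>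
    simp [(isDer_evo P).one, pow_succ_apply, comm_pow dX_comm_dZ.symm]

theorem commute_evo_dZ {P : Gen} (hP : IsSymmetry P) : Commute (evo P) dZ := LinearMap.ext hP.evo_dZ

end IsSymmetry

/-! ### Derivations that commute with the total derivatives -/


theorem iterate_eq {D : Module.End ℝ Laurent} (f : ℕ → Laurent) (h : ∀ n, D (f n) = f (n + 1))
    (n : ℕ) : (D ^ n) (f 0) = f n := by
  induction n with
  | zero => rfl
  | succ n ih => rw [pow_succ_apply, ih, h]

theorem coord_u (i j : ℕ) : (dX ^ i) ((dT ^ j) (X (.u 0 0))) = X (.u i j) := by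
  rw [iterate_eq (fun j => X (.u 0 j)) (fun j => dT_u 0 j),
    iterate_eq (fun i => X (.u i j)) (fun i => dX_u i j)]

theorem coord_uy (i k j : ℕ) :
    (dX ^ i) ((dY ^ (k + 1)) ((dT ^ j) (X (.u 0 0)))) = X (.uy i k j) := by
  rw [iterate_eq (fun j => X (.u 0 j)) (fun j => dT_u 0 j), pow_succ, Module.End.mul_apply, dY_u,
    iterate_eq (fun k => X (.uy 0 k j)) (fun k => dY_uy 0 k j),
    iterate_eq (fun i => X (.uy i k j)) (fun i => dX_uy i k j)]

theorem coord_uz (i l j : ℕ) :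
    (dX ^ i) ((dZ ^ (l + 1)) ((dT ^ j) (X (.u 0 0)))) = X (.uz i l j) := by
  rw [iterate_eq (fun j => X (.u 0 j)) (fun j => dT_u 0 j), pow_succ, Module.End.mul_apply, dZ_u,
    iterate_eq (fun l => X (.uz 0 l j)) (fun l => dZ_uz 0 l j),
    iterate_eq (fun i => X (.uz i l j)) (fun i => dX_uz i l j)]

theorem coord_q (α i j : ℕ) : (dX ^ i) ((dZ ^ j) (X (.q α 0 0))) = X (.q α i j) := by
  rw [iterate_eq (fun j => X (.q α 0 j)) (fun j => dZ_q α 0 j),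
    iterate_eq (fun i => X (.q α i j)) (fun i => dX_q α i j)]

theorem coord_m (α i j : ℕ) : (dX ^ i) ((dZ ^ j) (X (.m α 0 0))) = X (.m α i j) := by
  rw [iterate_eq (fun j => X (.m α 0 j)) (fun j => dZ_m α 0 j),
    iterate_eq (fun i => X (.m α i j)) (fun i => dX_m α i j)]

theorem coord_r (n i j : ℕ) : (dY ^ i) ((dT ^ j) (X (.r n 0 0))) = X (.r n i j) := by
  rw [iterate_eq (fun j => X (.r n 0 j)) (fun j => dT_r n 0 j),
    iterate_eq (fun i => X (.r n i j)) (fun i => dY_r n i j)]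

theorem ux_eq : ux = dX (depX .u) := (dX_u 0 0).symm
theorem uz_eq : uz = dZ (depX .u) := (dZ_u 0 0).symm
theorem uxx_eq : uxx = dX (dX (depX .u)) := by simp [depX, uxx]
theorem uxz_eq : uxz = dX (dZ (depX .u)) := by simp [depX, uxz]
theorem qx_eq (α : ℕ) : qx α = dX (depX (.q α)) := (dX_q α 0 0).symm
theorem mx_eq (α : ℕ) : mx α = dX (depX (.m α)) := (dX_m α 0 0).symm
theorem rx_eq (n : ℕ) : rx (n + 1) = dX (depX (.r n)) := by simp [depX]

/-! The covering system, written with total derivatives. -/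

theorem eqn_u : dY (dZ (depX .u)) = dT (dX (depX .u)) - dZ (depX .u) * dX (dX (depX .u))
    + dX (depX .u) * dX (dZ (depX .u)) := by
  simp [depX, rhsU, ux, uz, uxx, uxz]

theorem eqn_qt (α : ℕ) : dT (depX (.q α)) = dZ (depX .u) * dX (depX (.q α))
    + prev (fun β => dZ (depX (.q β))) α := by
  cases α <;> simp [depX, rhsQt, prev, uz, qx, qz]

theorem eqn_qy (α : ℕ) : dY (depX (.q α)) = dX (depX .u) * dX (depX (.q α))
    + prev (fun β => dX (depX (.q β))) α := by
  cases α <;> simp [depX, rhsQy, prev, ux, qx]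

theorem eqn_mt (α : ℕ) : dT (depX (.m α)) = dZ (depX .u) * dX (depX (.m α))
    - vz * ti * dZ (depX (.m α)) - ti * prev (fun β => dZ (depX (.m β))) α := by
  cases α <;> simp [depX, rhsMt, prev, uz, mx, mz]

theorem eqn_my (α : ℕ) : dY (depX (.m α)) = dX (depX .u) * dX (depX (.m α))
    - vz * ti * dX (depX (.m α)) - ti * prev (fun β => dX (depX (.m β))) α := by
  cases α <;> simp [depX, rhsMy, prev, ux, mx]

theorem eqn_rx_zero : dX (depX (.r 0)) = dY (depX .u) - dX (depX .u) * dX (depX .u) := by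
  simp [depX, rx, ry, ux]; ring

theorem eqn_rz_zero : dZ (depX (.r 0)) = dT (depX .u) - dZ (depX .u) * dX (depX .u) := by
  simp [depX, rz, rx, rt, ux, uz]; ring

theorem eqn_rx_succ (n : ℕ) : dX (depX (.r (n + 1))) =
    dX (depX .u) * dX (depX (.r n)) - dY (depX (.r n)) := by
  simp [depX, rx_succ (n + 1), ry, ux]

theorem eqn_rz_succ (n : ℕ) : dZ (depX (.r (n + 1))) =
    dZ (depX .u) * dX (depX (.r n)) - dT (depX (.r n)) := by
  simp [depX, rz_succ (n + 1), rt, uz]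

/-- A derivation that annihilates the independent variables and commutes with the total
derivatives. -/
structure IsInv (F : Module.End ℝ Laurent) : Prop where
  der : IsDer F
  x : F (X .x) = 0
  y : F (X .y) = 0
  z : F (X .z) = 0
  t : F (X .t) = 0
  commX : Commute F dX
  commY : Commute F dY
  commZ : Commute F dZ
  commT : Commute F dT

theorem IsSymmetry.isInv {P : Gen} (hP : IsSymmetry P) : IsInv (evo P) where
  der := isDer_evo P
  x := evo_x P
  y := evo_y P
  z := evo_z P
  t := evo_t P
  commX := hP.commute_evo_dX
  commY := hP.commute_evo_dY
  commZ := hP.commute_evo_dZ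
  commT := hP.commute_evo_dT

namespace IsInv

/-- Each remaining coordinate is an iterated total derivative of a dependent variable, so
commutation with the total derivatives forces the prolongation formula. -/
theorem eq_evo {F : Module.End ℝ Laurent} (hF : IsInv F) : F = evo fun d => F (depX d) :=
  hF.der.ext (isDer_evo _) fun a => by
    cases a with
    | x => rw [hF.x, evo_x]
    | y => rw [hF.y, evo_y]
    | z => rw [hF.z, evo_z]
    | t => rw [hF.t, evo_t]
    | u i j => rw [evo_u, ← coord_u, comm_pow hF.commX, comm_pow hF.commT, depX]
    | uy i k j =>
      rw [evo_uy, ← coord_uy, comm_pow hF.commX, comm_pow hF.commY, comm_pow hF.commT, depX]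
    | uz i l j =>
      rw [evo_uz, ← coord_uz, comm_pow hF.commX, comm_pow hF.commZ, comm_pow hF.commT, depX]
    | q α i j => rw [evo_q, ← coord_q, comm_pow hF.commX, comm_pow hF.commZ, depX]
    | m α i j => rw [evo_m, ← coord_m, comm_pow hF.commX, comm_pow hF.commZ, depX]
    | r n i j => rw [evo_r, ← coord_r, comm_pow hF.commY, comm_pow hF.commT, depX]

/-- Apply the derivation to each equation of the covering system and move it past the total
derivatives: the result is the linearized system. -/
theorem isSymmetry {F : Module.End ℝ Laurent} (hF : IsInv F) :
    IsSymmetry fun d => F (depX d) := by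
  have cX := End.comm_apply hF.commX
  have cY := End.comm_apply hF.commY
  have cZ := End.comm_apply hF.commZ
  have cT := End.comm_apply hF.commT
  have hz : F vz = 0 := hF.z
  have ht : F ti = 0 := by
    have h0 := hF.t
    rw [ti, hF.der.apply_pow, h0, mul_zero]
  constructor
  · have h := congrArg F eqn_u
    simp only [map_add, map_sub, hF.der _ _, cX, cY, cZ, cT] at h
    rw [ux_eq, uz_eq, uxx_eq, uxz_eq]
    linear_combination h
  · intro α
    have h := congrArg F (eqn_qt α)
    simp only [map_add, hF.der _ _, cX, cZ, cT, map_prev] at h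
    rw [uz_eq, qx_eq, map_prev]
    linear_combination h
  · intro α
    have h := congrArg F (eqn_qy α)
    simp only [map_add, hF.der _ _, cX, cY, map_prev] at h
    rw [ux_eq, qx_eq, map_prev]
    linear_combination h
  · intro α
    have h := congrArg F (eqn_mt α)
    simp only [map_sub, hF.der _ _, cX, cZ, cT, map_prev, hz, ht] at h
    rw [uz_eq, mx_eq, map_prev]
    linear_combination h
  · intro α
    have h := congrArg F (eqn_my α)
    simp only [map_sub, hF.der _ _, cX, cY, map_prev, hz, ht] at h
    rw [ux_eq, mx_eq, map_prev]
    linear_combination h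
  · have h := congrArg F eqn_rx_zero
    simp only [map_sub, hF.der _ _, cX, cY] at h
    rw [ux_eq]
    linear_combination h
  · have h := congrArg F eqn_rz_zero
    simp only [map_sub, hF.der _ _, cX, cT, cZ] at h
    rw [ux_eq, uz_eq]
    linear_combination h
  · intro n
    have h := congrArg F (eqn_rx_succ n)
    simp only [map_sub, hF.der _ _, cX, cY] at h
    rw [ux_eq, rx_eq]
    linear_combination h
  · intro n
    have h := congrArg F (eqn_rz_succ n)
    simp only [map_sub, hF.der _ _, cX, cT, cZ] at h
    rw [uz_eq, rx_eq]
    linear_combination h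

theorem lie {F G : Module.End ℝ Laurent} (hF : IsInv F) (hG : IsInv G) :
    IsInv (F * G - G * F) where
  der := hF.der.comm hG.der
  x := by simp [hF.x, hG.x]
  y := by simp [hF.y, hG.y]
  z := by simp [hF.z, hG.z]
  t := by simp [hF.t, hG.t]
  commX := (hF.commX.mul_left hG.commX).sub_left (hG.commX.mul_left hF.commX)
  commY := (hF.commY.mul_left hG.commY).sub_left (hG.commY.mul_left hF.commY)
  commZ := (hF.commZ.mul_left hG.commZ).sub_left (hG.commZ.mul_left hF.commZ)
  commT := (hF.commT.mul_left hG.commT).sub_left (hG.commT.mul_left hF.commT)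

end IsInv

/-! ### The Lie algebra of symmetries -/

theorem jacobi_eq (P Q : Gen) :
    jacobi P Q = fun d => (evo P * evo Q - evo Q * evo P) (depX d) := by
  funext d; simp [jacobi]

/-- The commutator of two fields commuting with the total derivatives again does so, hence is
evolutionary, and its generating function is the Jacobi bracket. -/
theorem evo_jacobi {P Q : Gen} (hP : IsSymmetry P) (hQ : IsSymmetry Q) :
    evo (jacobi P Q) = evo P * evo Q - evo Q * evo P := by
  rw [(hP.isInv.lie hQ.isInv).eq_evo, jacobi_eq]

theorem IsSymmetry.jacobi {P Q : Gen} (hP : IsSymmetry P) (hQ : IsSymmetry Q) :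
    IsSymmetry (jacobi P Q) := by
  rw [jacobi_eq]; exact (hP.isInv.lie hQ.isInv).isSymmetry

/-- The Jacobi identity is that of commutators of derivations, evaluated on the dependent variables.
-/
theorem symIsLie : SymIsLie where
  closed _ hP _ hQ := IsSymmetry.jacobi hP hQ
  leibniz P hP Q hQ S hS := by
    funext d
    change evo P (evo Q (S d) - evo S (Q d)) - evo (RYME.jacobi Q S) (P d) =
      evo (RYME.jacobi P Q) (S d) - evo S (evo P (Q d) - evo Q (P d)) +
        (evo Q (evo P (S d) - evo S (P d)) - evo (RYME.jacobi P S) (Q d))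
    rw [evo_jacobi hQ hS, evo_jacobi hP hQ, evo_jacobi hP hS]
    simp only [LinearMap.sub_apply, Module.End.mul_apply, map_sub]
    ring

/-! ### The recursion operators preserve symmetries -/

/-- The defect of `P` in the linearized equation for `q_{α,t}`. -/
def defQt (P : Gen) (α : ℕ) : Laurent := dT (P (.q α)) - uz * dX (P (.q α)) - qx α * dZ (P .u)
    - dZ (prev (fun β => P (.q β)) α)
/-- The defect of `P` in the linearized equation for `q_{α,y}`. -/
def defQy (P : Gen) (α : ℕ) : Laurent := dY (P (.q α)) - ux * dX (P (.q α)) - qx α * dX (P .u)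
    - dX (prev (fun β => P (.q β)) α)
/-- The defect of `P` in the linearized equation for `m_{α,t}`. -/
def defMt (P : Gen) (α : ℕ) : Laurent := dT (P (.m α)) - uz * dX (P (.m α)) - mx α * dZ (P .u)
    + vz * ti * dZ (P (.m α)) + ti * dZ (prev (fun β => P (.m β)) α)
/-- The defect of `P` in the linearized equation for `m_{α,y}`. -/
def defMy (P : Gen) (α : ℕ) : Laurent := dY (P (.m α)) - ux * dX (P (.m α)) - mx α * dX (P .u)
    + vz * ti * dX (P (.m α)) + ti * dX (prev (fun β => P (.m β)) α)
/-- The defect of `P` in the linearized equation for `r_{1,x}`. -/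
def defRx0 (P : Gen) : Laurent := dX (P (.r 0)) - dY (P .u) + 2 * ux * dX (P .u)
/-- The defect of `P` in the linearized equation for `r_{1,z}`. -/
def defRz0 (P : Gen) : Laurent := dZ (P (.r 0)) - dT (P .u) + ux * dZ (P .u) + uz * dX (P .u)
/-- The defect of `P` in the linearized equation for `r_{n+2,x}`. -/
def defRx (P : Gen) (n : ℕ) : Laurent :=
  dX (P (.r (n + 1))) - ux * dX (P (.r n)) - rx (n + 1) * dX (P .u) + dY (P (.r n))
/-- The defect of `P` in the linearized equation for `r_{n+2,z}`. -/
def defRz (P : Gen) (n : ℕ) : Laurent :=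
  dZ (P (.r (n + 1))) - uz * dX (P (.r n)) - rx (n + 1) * dZ (P .u) + dT (P (.r n))

theorem dX_ux : dX ux = uxx := dX_u 1 0
theorem dZ_ux : dZ ux = uxz := dZ_u 1 0
theorem dX_uz' : dX uz = uxz := dX_uz 0 0 0

/-- The linearized equation for `u` follows from those for `r_1`. -/
theorem isSymmetry_of_def {P : Gen} (h2 : ∀ α, defQt P α = 0) (h3 : ∀ α, defQy P α = 0)
    (h4 : ∀ α, defMt P α = 0) (h5 : ∀ α, defMy P α = 0) (h6 : defRx0 P = 0) (h7 : defRz0 P = 0)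
    (h8 : ∀ n, defRx P n = 0) (h9 : ∀ n, defRz P n = 0) : IsSymmetry P where
  ns1 := by
    have e6 := congrArg dZ h6
    have e7 := congrArg dX h7
    have o : dZ (2 : Laurent) = 0 := isDer_dZ.ofNat 2
    simp only [defRx0, defRz0, map_add, map_sub, dX_mul, dZ_mul, map_zero, dX_ux, dZ_ux, dX_uz',
      End.comm_apply dX_comm_dZ, End.comm_apply dX_comm_dT, End.comm_apply dZ_comm_dY, o] at e6 e7 ⊢
    -- The x-derivative of the linearized equation for r_{1,z} minus the z-derivative of the one for
    -- r_{1,x}: the mixed derivatives of the r_1-component cancel.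
    linear_combination e7 - e6
  ns2 := h2
  ns3 := h3
  ns4 := h4
  ns5 := h5
  ns6 := h6
  ns7 := h7
  ns8 := h8
  ns9 := h9

/-- The x-derivative of the equation for q_{α,t}. The coefficients of R^q are x-derivatives of
dependent variables, so equations of this kind are what its effect on the defects requires. -/
theorem dT_qx (α : ℕ) : dT (qx α) = uxz * qx α + uz * dX (qx α) + prev (fun β => dZ (qx β)) α := by
  rw [qx_eq, ← End.comm_apply dX_comm_dT, eqn_qt, map_add, dX_mul, ← uz_eq, dX_uz', map_prev]
  simp only [End.comm_apply dX_comm_dZ, ← qx_eq]; ring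

theorem dY_qx (α : ℕ) : dY (qx α) = uxx * qx α + ux * dX (qx α) + prev (fun β => dX (qx β)) α := by
  rw [qx_eq, ← End.comm_apply dX_comm_dY, eqn_qy, map_add, dX_mul, ← ux_eq, dX_ux, map_prev]
  simp only [← qx_eq]; ring

theorem dT_mx (α : ℕ) : dT (mx α) = uxz * mx α + uz * dX (mx α) - vz * ti * dZ (mx α)
    - ti * prev (fun β => dZ (mx β)) α := by
  rw [mx_eq, ← End.comm_apply dX_comm_dT, eqn_mt]
  simp only [map_sub, dX_mul, ← uz_eq, dX_uz', map_prev, dX_vz, dX_ti, End.comm_apply dX_comm_dZ,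
    ← mx_eq]
  ring

theorem dY_mx (α : ℕ) : dY (mx α) = uxx * mx α + ux * dX (mx α) - vz * ti * dX (mx α)
    - ti * prev (fun β => dX (mx β)) α := by
  rw [mx_eq, ← End.comm_apply dX_comm_dY, eqn_my]
  simp only [map_sub, dX_mul, ← ux_eq, dX_ux, map_prev, dX_vz, dX_ti, ← mx_eq]
  ring

theorem dX_rx_succ (β : ℕ) : dX (rx (β + 1)) = uxx * rx β + ux * dX (rx β) - dY (rx β) := by
  rw [rx_succ, map_sub, dX_mul, dX_ux, dX_ry]; ring

theorem dZ_rx_succ (β : ℕ) : dZ (rx (β + 1)) = uxz * rx β + uz * dX (rx β) - dT (rx β) := by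
  rw [← dX_rz, rz_succ, map_sub, dX_mul, dX_uz', dX_rt]; ring

/-- The defects of R^q(P) are linear combinations of those of P, for an arbitrary sequence P. The
combinations turn out to be solvable for the defects of P, so the same formulas show that R^q
preserves symmetries and that its inverse does. -/
theorem defQt_Rq (P : Gen) (α : ℕ) :
    defQt (RqFun P) α = prev (defQt P) α - qx α * defRz0 P := by
  cases α with
  | zero =>
    simp only [defQt, RqFun, prev, defRz0, map_add, dX_mul, dZ_mul, dT_mul, dT_qx, dZ_ux, map_zero]
    ring
  | succ α =>
    simp only [defQt, RqFun, prev, defRz0, map_add, dX_mul, dZ_mul, dT_mul, dT_qx, dZ_ux]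
    ring

theorem defQy_Rq (P : Gen) (α : ℕ) :
    defQy (RqFun P) α = prev (defQy P) α - qx α * defRx0 P := by
  cases α with
  | zero =>
    simp only [defQy, RqFun, prev, defRx0, map_add, dX_mul, dY_mul, dY_qx, dX_ux, map_zero]
    ring
  | succ α =>
    simp only [defQy, RqFun, prev, defRx0, map_add, dX_mul, dY_mul, dY_qx, dX_ux]
    ring

theorem defMt_Rq (P : Gen) (α : ℕ) : defMt (RqFun P) α =
    -(ti * prev (defMt P) α) - vz * ti * defMt P α - mx α * defRz0 P := by
  cases α with
  | zero =>
    simp only [defMt, RqFun, prev, defRz0, map_add, map_sub, dX_mul, dZ_mul, dT_mul, dT_mx, dZ_ux,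
      map_zero, dT_ti, dX_ti, dZ_ti, dT_vz, dX_vz, dZ_vz]
    ring
  | succ α =>
    simp only [defMt, RqFun, prev, defRz0, map_add, map_sub, dX_mul, dZ_mul, dT_mul, dT_mx, dZ_ux,
      dT_ti, dX_ti, dZ_ti, dT_vz, dX_vz, dZ_vz]
    ring

theorem defMy_Rq (P : Gen) (α : ℕ) : defMy (RqFun P) α =
    -(ti * prev (defMy P) α) - vz * ti * defMy P α - mx α * defRx0 P := by
  cases α with
  | zero =>
    simp only [defMy, RqFun, prev, defRx0, map_add, map_sub, dX_mul, dY_mul, dY_mx, dX_ux,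
      map_zero, dX_ti, dY_ti, dX_vz, dY_vz]
    ring
  | succ α =>
    simp only [defMy, RqFun, prev, defRx0, map_add, map_sub, dX_mul, dY_mul, dY_mx, dX_ux,
      dX_ti, dY_ti, dX_vz, dY_vz]
    ring

theorem dX_rx_zero : dX (rx 0) = -uxx := by simp [rx, dX_ux]
theorem dY_rx_zero : dY (rx 0) = -dY ux := by simp [rx]
theorem dT_rx_zero : dT (rx 0) = -dT ux := by simp [rx]

theorem defRx0_Rq (P : Gen) : defRx0 (RqFun P) = -defRx P 0 + ux * defRx0 P := by
  simp only [defRx0, defRx, RqFun, map_add, map_sub, dX_mul, dY_mul, dX_ux, dX_rx_succ, dX_rx_zero,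
    dY_rx_zero, zero_add]
  simp only [rx]
  ring

theorem defRz0_Rq (P : Gen) : defRz0 (RqFun P) = -defRz P 0 + ux * defRz0 P := by
  simp only [defRz0, defRz, RqFun, map_add, map_sub, dX_mul, dT_mul, dZ_mul, dX_ux, dZ_ux,
    dZ_rx_succ, dX_rx_zero, dT_rx_zero, zero_add]
  simp only [rx]
  ring

theorem defRx_Rq (P : Gen) (n : ℕ) :
    defRx (RqFun P) n = -defRx P (n + 1) - rx (n + 1) * defRx0 P := by
  simp only [defRx0, defRx, RqFun, map_add, map_sub, dX_mul, dY_mul, dX_ux, dX_rx_succ (n + 1)]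
  ring

theorem defRz_Rq (P : Gen) (n : ℕ) :
    defRz (RqFun P) n = -defRz P (n + 1) - rx (n + 1) * defRz0 P := by
  simp only [defRz0, defRz, RqFun, map_add, map_sub, dX_mul, dT_mul, dZ_mul, dZ_ux,
    dZ_rx_succ (n + 1)]
  ring

/-- Differentiating the explicit factors t and z in t R^q + z leaves the q_α-component of R^q(P)
minus its own defining expression, which is zero. In the defects that involve only x- and
y-derivatives, t and z are constants. -/
theorem defQt_Rm (P : Gen) (α : ℕ) :
    defQt (RmFun P) α = vt * defQt (RqFun P) α + vz * defQt P α := by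
  cases α <;>
  · simp only [defQt, RmFun, RqFun, prev, map_add, dX_mul, dZ_mul, dT_mul, map_zero, dT_vt, dX_vt,
      dZ_vt, dT_vz, dX_vz, dZ_vz]
    ring

theorem defQy_Rm (P : Gen) (α : ℕ) :
    defQy (RmFun P) α = vt * defQy (RqFun P) α + vz * defQy P α := by
  cases α <;>
  · simp only [defQy, RmFun, RqFun, prev, map_add, dX_mul, dY_mul, map_zero, dY_vt, dX_vt, dY_vz,
      dX_vz]
    ring

theorem defMt_Rm (P : Gen) (α : ℕ) :
    defMt (RmFun P) α = vt * defMt (RqFun P) α + vz * defMt P α := by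
  cases α <;>
  · simp only [defMt, RmFun, RqFun, prev, map_add, map_sub, dX_mul, dZ_mul, dT_mul, map_zero, dT_vt,
      dX_vt, dZ_vt, dT_vz, dX_vz, dZ_vz, dT_ti, dX_ti, dZ_ti]
    ring

theorem defMy_Rm (P : Gen) (α : ℕ) :
    defMy (RmFun P) α = vt * defMy (RqFun P) α + vz * defMy P α := by
  cases α <;>
  · simp only [defMy, RmFun, RqFun, prev, map_add, map_sub, dX_mul, dY_mul, map_zero, dY_vt, dX_vt,
      dY_vz, dX_vz, dX_ti, dY_ti]
    ring

theorem defRx0_Rm (P : Gen) :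
    defRx0 (RmFun P) = vt * defRx0 (RqFun P) + vz * defRx0 P := by
  simp only [defRx0, RmFun, map_add, dX_mul, dY_mul, dY_vt, dX_vt, dY_vz, dX_vz]
  ring

theorem defRz0_Rm (P : Gen) :
    defRz0 (RmFun P) = vt * defRz0 (RqFun P) + vz * defRz0 P := by
  simp only [defRz0, RmFun, map_add, dX_mul, dZ_mul, dT_mul, dT_vt, dX_vt, dZ_vt, dT_vz, dX_vz,
    dZ_vz, RqFun]
  ring

theorem defRx_Rm (P : Gen) (n : ℕ) :
    defRx (RmFun P) n = vt * defRx (RqFun P) n + vz * defRx P n := by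
  simp only [defRx, RmFun, map_add, dX_mul, dY_mul, dY_vt, dX_vt, dY_vz, dX_vz]
  ring

theorem defRz_Rm (P : Gen) (n : ℕ) :
    defRz (RmFun P) n = vt * defRz (RqFun P) n + vz * defRz P n := by
  simp only [defRz, RmFun, map_add, dX_mul, dZ_mul, dT_mul, dT_vt, dX_vt, dZ_vt, dT_vz, dX_vz,
    dZ_vz, RqFun]
  ring

theorem prev_eq_zero {f : ℕ → Laurent} (h : ∀ α, f α = 0) (α : ℕ) : prev f α = 0 := by
  cases α
  · rfl
  · exact h _

/-! ### Recursion operators preserve and reflect the symmetry conditions -/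

theorem isSymmetry_Rq {P : Gen} (hP : IsSymmetry P) : IsSymmetry (Rq P) := by
  have h2 : ∀ α, defQt P α = 0 := hP.ns2
  have h3 : ∀ α, defQy P α = 0 := hP.ns3
  have h4 : ∀ α, defMt P α = 0 := hP.ns4
  have h5 : ∀ α, defMy P α = 0 := hP.ns5
  have h6 : defRx0 P = 0 := hP.ns6
  have h7 : defRz0 P = 0 := hP.ns7
  have h8 : ∀ n, defRx P n = 0 := hP.ns8
  have h9 : ∀ n, defRz P n = 0 := hP.ns9
  change IsSymmetry (RqFun P)
  apply isSymmetry_of_def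
  · intro α; rw [defQt_Rq, prev_eq_zero h2, h7]; ring
  · intro α; rw [defQy_Rq, prev_eq_zero h3, h6]; ring
  · intro α; rw [defMt_Rq, prev_eq_zero h4, h4, h7]; ring
  · intro α; rw [defMy_Rq, prev_eq_zero h5, h5, h6]; ring
  · rw [defRx0_Rq, h8, h6]; ring
  · rw [defRz0_Rq, h9, h7]; ring
  · intro n; rw [defRx_Rq, h8, h6]; ring
  · intro n; rw [defRz_Rq, h9, h7]; ring

/-- At α = 0 the q-equations leave q_{0,x} times a defect of the r_1-equations, and q_{0,x} is
invertible. With these two defects gone, the others are recovered one index at a time. -/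
theorem isSymmetry_of_Rq {P : Gen} (hP : IsSymmetry (Rq P)) : IsSymmetry P := by
  change IsSymmetry (RqFun P) at hP
  have h2 (α) : prev (defQt P) α - qx α * defRz0 P = 0 := by rw [← defQt_Rq]; exact hP.ns2 α
  have h3 (α) : prev (defQy P) α - qx α * defRx0 P = 0 := by rw [← defQy_Rq]; exact hP.ns3 α
  have h4 (α) : -(ti * prev (defMt P) α) - vz * ti * defMt P α - mx α * defRz0 P = 0 := by
    rw [← defMt_Rq]; exact hP.ns4 α
  have h5 (α) : -(ti * prev (defMy P) α) - vz * ti * defMy P α - mx α * defRx0 P = 0 := by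
    rw [← defMy_Rq]; exact hP.ns5 α
  have h6 : -defRx P 0 + ux * defRx0 P = 0 := by rw [← defRx0_Rq]; exact hP.ns6
  have h7 : -defRz P 0 + ux * defRz0 P = 0 := by rw [← defRz0_Rq]; exact hP.ns7
  have h8 (n) : -defRx P (n + 1) - rx (n + 1) * defRx0 P = 0 := by
    rw [← defRx_Rq]; exact hP.ns8 n
  have h9 (n) : -defRz P (n + 1) - rx (n + 1) * defRz0 P = 0 := by
    rw [← defRz_Rq]; exact hP.ns9 n
  have e6 : defRx0 P = 0 := by
    have h := h3 0
    simp only [prev] at h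
    linear_combination -q0xi * h - defRx0 P * qx_mul_q0xi
  have e7 : defRz0 P = 0 := by
    have h := h2 0
    simp only [prev] at h
    linear_combination -q0xi * h - defRz0 P * qx_mul_q0xi
  -- Division by z/t, a unit, which carries the induction on α for the m-defects.
  have inv {f g : Laurent} (hg : g = 0) (h : -(ti * g) - vz * ti * f = 0) : f = 0 := by
    rw [hg] at h
    linear_combination -zi * vt * h - f * vz_mul_zi * vt * ti - f * vt_mul_ti
  refine isSymmetry_of_def (fun α => ?_) (fun α => ?_) (fun α => ?_) (fun α => ?_) e6 e7
    (fun n => ?_) (fun n => ?_)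
  · have h := h2 (α + 1); rw [e7] at h; simpa [prev] using h
  · have h := h3 (α + 1); rw [e6] at h; simpa [prev] using h
  · induction α with
    | zero => exact inv (g := prev (defMt P) 0) rfl (by linear_combination h4 0 + mx 0 * e7)
    | succ α ih => exact inv (g := prev (defMt P) (α + 1)) ih (by linear_combination h4 (α + 1) + mx (α + 1) * e7)
  · induction α with
    | zero => exact inv (g := prev (defMy P) 0) rfl (by linear_combination h5 0 + mx 0 * e6)
    | succ α ih => exact inv (g := prev (defMy P) (α + 1)) ih (by linear_combination h5 (α + 1) + mx (α + 1) * e6)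
  · cases n with
    | zero => linear_combination -h6 + ux * e6
    | succ n => linear_combination -h8 n - rx (n + 1) * e6
  · cases n with
    | zero => linear_combination -h7 + ux * e7
    | succ n => linear_combination -h9 n - rx (n + 1) * e7

theorem isSymmetry_Rm {P : Gen} (hP : IsSymmetry P) : IsSymmetry (Rm P) := by
  have hQ : IsSymmetry (RqFun P) := isSymmetry_Rq hP
  change IsSymmetry (RmFun P)
  apply isSymmetry_of_def
  · intro α; rw [defQt_Rm, defQt, hQ.ns2, defQt, hP.ns2]; ring
  · intro α; rw [defQy_Rm, defQy, hQ.ns3, defQy, hP.ns3]; ring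
  · intro α; rw [defMt_Rm, defMt, hQ.ns4, defMt, hP.ns4]; ring
  · intro α; rw [defMy_Rm, defMy, hQ.ns5, defMy, hP.ns5]; ring
  · rw [defRx0_Rm, defRx0, hQ.ns6, defRx0, hP.ns6]; ring
  · rw [defRz0_Rm, defRz0, hQ.ns7, defRz0, hP.ns7]; ring
  · intro n; rw [defRx_Rm, defRx, hQ.ns8, defRx, hP.ns8]; ring
  · intro n; rw [defRz_Rm, defRz, hQ.ns9, defRz, hP.ns9]; ring

/-- For R^m the roles of q and m are exchanged: in the m-equations the terms in z cancel and α = 0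
leaves t m_{0,x} times a defect of the r_1-equations. The q-defects then follow by dividing by z and
the r-defects by dividing by t. -/
theorem isSymmetry_of_Rm {P : Gen} (hP : IsSymmetry (Rm P)) : IsSymmetry P := by
  change IsSymmetry (RmFun P) at hP
  have h2 (α) : vt * (prev (defQt P) α - qx α * defRz0 P) + vz * defQt P α = 0 := by
    rw [← defQt_Rq, ← defQt_Rm]; exact hP.ns2 α
  have h3 (α) : vt * (prev (defQy P) α - qx α * defRx0 P) + vz * defQy P α = 0 := by
    rw [← defQy_Rq, ← defQy_Rm]; exact hP.ns3 α
  have h4 (α) : prev (defMt P) α + vt * mx α * defRz0 P = 0 := by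
    have h : defMt (RmFun P) α = 0 := hP.ns4 α
    rw [defMt_Rm, defMt_Rq] at h
    linear_combination -h - (prev (defMt P) α + vz * defMt P α) * vt_mul_ti
  have h5 (α) : prev (defMy P) α + vt * mx α * defRx0 P = 0 := by
    have h : defMy (RmFun P) α = 0 := hP.ns5 α
    rw [defMy_Rm, defMy_Rq] at h
    linear_combination -h - (prev (defMy P) α + vz * defMy P α) * vt_mul_ti
  have h6 : vt * (-defRx P 0 + ux * defRx0 P) + vz * defRx0 P = 0 := by
    rw [← defRx0_Rq, ← defRx0_Rm]; exact hP.ns6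
  have h7 : vt * (-defRz P 0 + ux * defRz0 P) + vz * defRz0 P = 0 := by
    rw [← defRz0_Rq, ← defRz0_Rm]; exact hP.ns7
  have h8 (n) : vt * (-defRx P (n + 1) - rx (n + 1) * defRx0 P) + vz * defRx P n = 0 := by
    rw [← defRx_Rq, ← defRx_Rm]; exact hP.ns8 n
  have h9 (n) : vt * (-defRz P (n + 1) - rx (n + 1) * defRz0 P) + vz * defRz P n = 0 := by
    rw [← defRz_Rq, ← defRz_Rm]; exact hP.ns9 n
  have e6 : defRx0 P = 0 := by
    have h := h5 0
    simp only [prev] at h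
    linear_combination ti * m0xi * h - defRx0 P * mx_mul_m0xi * vt * ti - defRx0 P * vt_mul_ti
  have e7 : defRz0 P = 0 := by
    have h := h4 0
    simp only [prev] at h
    linear_combination ti * m0xi * h - defRz0 P * mx_mul_m0xi * vt * ti - defRz0 P * vt_mul_ti
  refine isSymmetry_of_def (fun α => ?_) (fun α => ?_) (fun α => ?_) (fun α => ?_) e6 e7
    (fun n => ?_) (fun n => ?_)
  · induction α with
    | zero =>
      have h := h2 0
      simp only [prev] at h
      linear_combination zi * h - defQt P 0 * vz_mul_zi + zi * vt * qx 0 * e7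
    | succ α ih =>
      have h := h2 (α + 1)
      simp only [prev] at h
      linear_combination zi * h - defQt P (α + 1) * vz_mul_zi + zi * vt * (qx (α + 1) * e7 - ih)
  · induction α with
    | zero =>
      have h := h3 0
      simp only [prev] at h
      linear_combination zi * h - defQy P 0 * vz_mul_zi + zi * vt * qx 0 * e6
    | succ α ih =>
      have h := h3 (α + 1)
      simp only [prev] at h
      linear_combination zi * h - defQy P (α + 1) * vz_mul_zi + zi * vt * (qx (α + 1) * e6 - ih)
  · have h := h4 (α + 1); rw [e7] at h; simpa [prev] using h
  · have h := h5 (α + 1); rw [e6] at h; simpa [prev] using h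
  · induction n with
    | zero => linear_combination -ti * h6 + ti * (vt * ux + vz) * e6 - defRx P 0 * vt_mul_ti
    | succ n ih =>
      linear_combination -ti * h8 n - ti * vt * rx (n + 1) * e6 + ti * vz * ih
        - defRx P (n + 1) * vt_mul_ti
  · induction n with
    | zero => linear_combination -ti * h7 + ti * (vt * ux + vz) * e7 - defRz P 0 * vt_mul_ti
    | succ n ih =>
      linear_combination -ti * h9 n - ti * vt * rx (n + 1) * e7 + ti * vz * ih
        - defRz P (n + 1) * vt_mul_ti

/-! ### The symmetries `Ω` and `Ψ` -/

theorem Omega_u : Omega .u = vt * dT (depX .u) - X .x * dX (depX .u) + 2 * depX .u := rfl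
theorem Omega_q (α : ℕ) : Omega (.q α) =
    vt * dT (depX (.q α)) - X .x * dX (depX (.q α)) - (α : Laurent) * depX (.q α) := by
  rw [Omega, sub_eq_add_neg (_ - _)]
theorem Omega_m (α : ℕ) : Omega (.m α) =
    vt * dT (depX (.m α)) - X .x * dX (depX (.m α)) := by
  rw [Omega, add_zero]
theorem Omega_r (n : ℕ) : Omega (.r n) =
    vt * dT (depX (.r n)) - X .x * dX (depX (.r n)) + ((n : Laurent) + 3) * depX (.r n) := rfl

theorem Psi_u : Psi .u = dZ (depX .u) := rfl
theorem Psi_q (α : ℕ) : Psi (.q α) = dZ (depX (.q α)) := rfl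
theorem Psi_m (α : ℕ) : Psi (.m α) =
    dZ (depX (.m α)) - ((α : Laurent) + 1) * depX (.m (α + 1)) := rfl
theorem Psi_r (n : ℕ) : Psi (.r n) = dZ (depX (.r n)) := rfl

theorem dX_natCast (n : ℕ) : dX (n : Laurent) = 0 := isDer_dX.natCast n
theorem dY_natCast (n : ℕ) : dY (n : Laurent) = 0 := isDer_dY.natCast n
theorem dZ_natCast (n : ℕ) : dZ (n : Laurent) = 0 := isDer_dZ.natCast n
theorem dT_natCast (n : ℕ) : dT (n : Laurent) = 0 := isDer_dT.natCast n
theorem dX_one : dX 1 = 0 := isDer_dX.one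
theorem dY_one : dY 1 = 0 := isDer_dY.one
theorem dZ_one : dZ 1 = 0 := isDer_dZ.one
theorem dT_one : dT 1 = 0 := isDer_dT.one

theorem dX_two : dX 2 = 0 := isDer_dX.ofNat 2
theorem dX_three : dX 3 = 0 := isDer_dX.ofNat 3
theorem dY_two : dY 2 = 0 := isDer_dY.ofNat 2
theorem dY_three : dY 3 = 0 := isDer_dY.ofNat 3
theorem dZ_two : dZ 2 = 0 := isDer_dZ.ofNat 2
theorem dZ_three : dZ 3 = 0 := isDer_dZ.ofNat 3
theorem dT_two : dT 2 = 0 := isDer_dT.ofNat 2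
theorem dT_three : dT 3 = 0 := isDer_dT.ofNat 3

theorem cXY (f : Laurent) : dX (dY f) = dY (dX f) := End.comm_apply dX_comm_dY f
theorem cXZ (f : Laurent) : dX (dZ f) = dZ (dX f) := End.comm_apply dX_comm_dZ f
theorem cXT (f : Laurent) : dX (dT f) = dT (dX f) := End.comm_apply dX_comm_dT f
theorem cZY (f : Laurent) : dZ (dY f) = dY (dZ f) := End.comm_apply dZ_comm_dY f
theorem cZT (f : Laurent) : dZ (dT f) = dT (dZ f) := End.comm_apply dZ_comm_dT f
theorem cTY (f : Laurent) : dT (dY f) = dY (dT f) := End.comm_apply dT_comm_dY f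

/-- Infinitesimal translation in z. The system depends explicitly on z only through z/t in the
m-equations; the extra term produced there is compensated by subtracting α + 1 times the equation
for m_{α+1}, which explains the correction in the m-components of Ψ. -/
theorem isSymmetry_Psi : IsSymmetry Psi := by
  apply isSymmetry_of_def
  · intro α
    have h := congrArg dZ (eqn_qt α)
    cases α with
    | zero =>
      simp only [prev, map_add, dZ_mul, map_zero, cXZ, cZT] at h
      simp only [defQt, Psi_u, Psi_q, uz_eq, qx_eq, prev, map_zero, cXZ]
      linear_combination h
    | succ α =>
      simp only [prev, map_add, dZ_mul, map_zero, cXZ, cZT] at h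
      simp only [defQt, Psi_u, Psi_q, uz_eq, qx_eq, prev, map_zero, cXZ]
      linear_combination h
  · intro α
    have h := congrArg dZ (eqn_qy α)
    cases α with
    | zero =>
      simp only [prev, map_add, dZ_mul, map_zero, cXZ, cZY] at h
      simp only [defQy, Psi_u, Psi_q, ux_eq, qx_eq, prev, map_zero, cXZ]
      linear_combination h
    | succ α =>
      simp only [prev, map_add, dZ_mul, map_zero, cXZ, cZY] at h
      simp only [defQy, Psi_u, Psi_q, ux_eq, qx_eq, prev, map_zero, cXZ]
      linear_combination h
  · intro α
    have h := congrArg dZ (eqn_mt α)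
    have h' := eqn_mt (α + 1)
    cases α with
    | zero =>
      simp only [prev, map_sub, dZ_mul, map_zero, cXZ, cZT, dZ_vz, dZ_ti] at h h'
      simp only [defMt, Psi_u, Psi_m, uz_eq, mx_eq, prev, map_zero, map_add, map_sub, dX_mul, dZ_mul,
        dT_mul, dX_natCast, dT_natCast, dZ_natCast, dX_one, dT_one, dZ_one, cXZ]
      push_cast
      linear_combination h - h'
    | succ α =>
      simp only [prev, map_sub, dZ_mul, map_zero, cXZ, cZT, dZ_vz, dZ_ti] at h h'
      simp only [defMt, Psi_u, Psi_m, uz_eq, mx_eq, prev, map_zero, map_add, map_sub, dX_mul, dZ_mul,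
        dT_mul, dX_natCast, dT_natCast, dZ_natCast, dX_one, dT_one, dZ_one, cXZ]
      push_cast
      linear_combination h - ((α : Laurent) + 2) * h'
  · intro α
    have h := congrArg dZ (eqn_my α)
    have h' := eqn_my (α + 1)
    cases α with
    | zero =>
      simp only [prev, map_sub, dZ_mul, map_zero, cXZ, cZY, dZ_vz, dZ_ti] at h h'
      simp only [defMy, Psi_u, Psi_m, ux_eq, mx_eq, prev, map_zero, map_add, map_sub, dX_mul,
        dY_mul, dX_natCast, dY_natCast, dX_one, dY_one, cXZ]
      push_cast
      linear_combination h - h'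
    | succ α =>
      simp only [prev, map_sub, dZ_mul, map_zero, cXZ, cZY, dZ_vz, dZ_ti] at h h'
      simp only [defMy, Psi_u, Psi_m, ux_eq, mx_eq, prev, map_zero, map_add, map_sub, dX_mul,
        dY_mul, dX_natCast, dY_natCast, dX_one, dY_one, cXZ]
      push_cast
      linear_combination h - ((α : Laurent) + 2) * h'
  · have h := congrArg dZ eqn_rx_zero
    simp only [map_sub, dZ_mul, cZY, cXZ] at h
    simp only [defRx0, Psi_u, Psi_r, ux_eq, cXZ]
    linear_combination h
  · have h := congrArg dZ eqn_rz_zero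
    simp only [map_sub, dZ_mul, cZT, cXZ] at h
    simp only [defRz0, Psi_u, Psi_r, ux_eq, uz_eq, cXZ]
    linear_combination h
  · intro n
    have h := congrArg dZ (eqn_rx_succ n)
    simp only [map_sub, dZ_mul, cZY, cXZ] at h
    simp only [defRx, Psi_u, Psi_r, ux_eq, rx_eq, cXZ]
    linear_combination h
  · intro n
    have h := congrArg dZ (eqn_rz_succ n)
    simp only [map_sub, dZ_mul, cZT, cXZ] at h
    simp only [defRz, Psi_u, Psi_r, uz_eq, rx_eq, cXZ]
    linear_combination h

/-- Infinitesimal scaling of t, x and the dependent variables. Each condition is t D_t - x D_x of an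
equation plus a constant multiple of that equation, the constant being its scaling weight. -/
theorem isSymmetry_Omega : IsSymmetry Omega := by
  apply isSymmetry_of_def
  · intro α
    have hx := congrArg dX (eqn_qt α)
    have ht := congrArg dT (eqn_qt α)
    have h := eqn_qt α
    cases α with
    | zero =>
      simp only [prev, map_add, dX_mul, dT_mul, map_zero, cXZ, cXT, cZT] at h hx ht
      simp only [defQt, Omega_u, Omega_q, uz_eq, qx_eq, prev, map_zero, map_add, map_sub, dX_mul,
        dT_mul, dZ_mul, dX_vt, dT_vt, dZ_vt, dX_x, dT_x, dZ_x, dX_natCast, dT_natCast, dZ_natCast,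
        dZ_two, dZ_three, cXZ, cXT, cZT]
      push_cast
      linear_combination vt * ht - X .x * hx + h
    | succ α =>
      simp only [prev, map_add, dX_mul, dT_mul, map_zero, cXZ, cXT, cZT] at h hx ht
      simp only [defQt, Omega_u, Omega_q, uz_eq, qx_eq, prev, map_zero, map_add, map_sub, dX_mul,
        dT_mul, dZ_mul, dX_vt, dT_vt, dZ_vt, dX_x, dT_x, dZ_x, dX_natCast, dT_natCast, dZ_natCast,
        dZ_two, dZ_three, cXZ, cXT, cZT]
      push_cast
      linear_combination vt * ht - X .x * hx - (α : Laurent) * h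
  · intro α
    have hx := congrArg dX (eqn_qy α)
    have ht := congrArg dT (eqn_qy α)
    have h := eqn_qy α
    cases α with
    | zero =>
      simp only [prev, map_add, dX_mul, dT_mul, map_zero, cXY, cXT, cTY] at h hx ht
      simp only [defQy, Omega_u, Omega_q, ux_eq, qx_eq, prev, map_zero, map_add, map_sub, dX_mul,
        dY_mul, dX_vt, dY_vt, dX_x, dY_x, dX_natCast, dY_natCast, dX_two, dX_three, cXY, cXT]
      push_cast
      linear_combination vt * ht - X .x * hx
    | succ α =>
      simp only [prev, map_add, dX_mul, dT_mul, map_zero, cXY, cXT, cTY] at h hx ht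
      simp only [defQy, Omega_u, Omega_q, ux_eq, qx_eq, prev, map_zero, map_add, map_sub, dX_mul,
        dY_mul, dX_vt, dY_vt, dX_x, dY_x, dX_natCast, dY_natCast, dX_two, dX_three, cXY, cXT]
      push_cast
      linear_combination vt * ht - X .x * hx - ((α : Laurent) + 1) * h
  · intro α
    have hx := congrArg dX (eqn_mt α)
    have ht := congrArg dT (eqn_mt α)
    have h := eqn_mt α
    cases α with
    | zero =>
      simp only [prev, map_sub, dX_mul, dT_mul, map_zero, cXZ, cXT, cZT, dX_vz, dT_vz,
        dX_ti, dT_ti] at h hx ht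
      simp only [defMt, Omega_u, Omega_m, uz_eq, mx_eq, prev, map_zero, map_add, map_sub, dX_mul,
        dT_mul, dZ_mul, dX_vt, dT_vt, dZ_vt, dX_x, dT_x, dZ_x, dZ_two, dZ_three, cXZ, cXT, cZT]
      linear_combination vt * ht - X .x * hx + h + vz * ti * dZ (depX (.m 0)) * vt_mul_ti
    | succ α =>
      simp only [prev, map_sub, dX_mul, dT_mul, map_zero, cXZ, cXT, cZT, dX_vz, dT_vz,
        dX_ti, dT_ti] at h hx ht
      simp only [defMt, Omega_u, Omega_m, uz_eq, mx_eq, prev, map_zero, map_add, map_sub, dX_mul,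
        dT_mul, dZ_mul, dX_vt, dT_vt, dZ_vt, dX_x, dT_x, dZ_x, dZ_two, dZ_three, cXZ, cXT, cZT]
      linear_combination vt * ht - X .x * hx + h +
        (vz * ti * dZ (depX (.m (α + 1))) + ti * dZ (depX (.m α))) * vt_mul_ti
  · intro α
    have hx := congrArg dX (eqn_my α)
    have ht := congrArg dT (eqn_my α)
    have h := eqn_my α
    cases α with
    | zero =>
      simp only [prev, map_sub, dX_mul, dT_mul, map_zero, cXY, cXT, cTY, dX_vz, dT_vz,
        dX_ti, dT_ti] at h hx ht
      simp only [defMy, Omega_u, Omega_m, ux_eq, mx_eq, prev, map_zero, map_add, map_sub, dX_mul,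
        dY_mul, dX_vt, dY_vt, dX_x, dY_x, dX_two, dX_three, cXY, cXT]
      linear_combination vt * ht - X .x * hx + vz * ti * dX (depX (.m 0)) * vt_mul_ti
    | succ α =>
      simp only [prev, map_sub, dX_mul, dT_mul, map_zero, cXY, cXT, cTY, dX_vz, dT_vz,
        dX_ti, dT_ti] at h hx ht
      simp only [defMy, Omega_u, Omega_m, ux_eq, mx_eq, prev, map_zero, map_add, map_sub, dX_mul,
        dY_mul, dX_vt, dY_vt, dX_x, dY_x, dX_two, dX_three, cXY, cXT]
      linear_combination vt * ht - X .x * hx +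
        (vz * ti * dX (depX (.m (α + 1))) + ti * dX (depX (.m α))) * vt_mul_ti
  · have hx := congrArg dX eqn_rx_zero
    have ht := congrArg dT eqn_rx_zero
    have h := eqn_rx_zero
    simp only [map_sub, dX_mul, dT_mul, cXY, cXT, cTY] at hx ht
    simp only [defRx0, Omega_u, Omega_r, ux_eq, map_add, map_sub, dX_mul, dY_mul, dX_vt, dY_vt, dX_x,
      dY_x, dX_natCast, dX_two, dX_three, dY_two, dY_three, cXY, cXT]
    push_cast
    linear_combination vt * ht - X .x * hx + 2 * h
  · have hx := congrArg dX eqn_rz_zero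
    have ht := congrArg dT eqn_rz_zero
    have h := eqn_rz_zero
    simp only [map_sub, dX_mul, dT_mul, cXZ, cXT, cZT] at hx ht
    simp only [defRz0, Omega_u, Omega_r, ux_eq, uz_eq, map_add, map_sub, dX_mul, dT_mul, dZ_mul,
      dX_vt, dT_vt, dZ_vt, dX_x, dT_x, dZ_x, dZ_natCast, dX_two, dX_three, dT_two, dT_three, dZ_two, dZ_three, cXZ, cXT, cZT]
    push_cast
    linear_combination vt * ht - X .x * hx + 3 * h
  · intro n
    have hx := congrArg dX (eqn_rx_succ n)
    have ht := congrArg dT (eqn_rx_succ n)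
    have h := eqn_rx_succ n
    simp only [map_sub, dX_mul, dT_mul, cXY, cXT, cTY] at hx ht
    simp only [defRx, Omega_u, Omega_r, ux_eq, rx_eq, map_add, map_sub, dX_mul, dY_mul, dX_vt, dY_vt,
      dX_x, dY_x, dX_natCast, dY_natCast, dX_two, dX_three, dY_two, dY_three, cXY, cXT]
    push_cast
    linear_combination vt * ht - X .x * hx + (n + 3) * h
  · intro n
    have hx := congrArg dX (eqn_rz_succ n)
    have ht := congrArg dT (eqn_rz_succ n)
    have h := eqn_rz_succ n
    simp only [map_sub, dX_mul, dT_mul, cXZ, cXT, cZT] at hx ht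
    simp only [defRz, Omega_u, Omega_r, uz_eq, rx_eq, map_add, map_sub, dX_mul, dT_mul, dZ_mul, dX_vt,
      dT_vt, dZ_vt, dX_x, dT_x, dZ_x, dX_natCast, dT_natCast, dZ_natCast, dX_two, dX_three, dT_two, dT_three,
      dZ_two, dZ_three, cXZ, cXT, cZT]
    push_cast
    linear_combination vt * ht - X .x * hx + (n + 4) * h

/-! ### Power series and flows of derivations -/

/-- Power series over the Laurent polynomials. -/
abbrev Ser : Type := PowerSeries Laurent

/-- A derivation, applied to the coefficients of a power series. -/
def IsDer.hat {D : Module.End ℝ Laurent} (h : IsDer D) : Derivation ℝ Ser Ser :=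
  Derivation.mk'
    { toFun := fun f => PowerSeries.mk fun n => D (PowerSeries.coeff n f)
      map_add' := fun f g => by ext1 n; simp
      map_smul' := fun c f => by ext1 n; simp }
    fun f g => by
      ext1 n
      simp only [LinearMap.coe_mk, AddHom.coe_mk, PowerSeries.coeff_mk, PowerSeries.coeff_mul,
        map_sum, smul_eq_mul, map_add, h _ _, Finset.sum_add_distrib]
      congr 1
      rw [← Finset.Nat.sum_antidiagonal_swap]
      rfl

@[simp] theorem IsDer.coeff_hat {D : Module.End ℝ Laurent} (h : IsDer D) (f : Ser) (n : ℕ) :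
    PowerSeries.coeff n (h.hat f) = D (PowerSeries.coeff n f) :=
  PowerSeries.coeff_mk n fun n => D (PowerSeries.coeff n f)

/-- The hypotheses say that both series solve dF/dε = V(F), with V acting on coefficients; a
solution is determined by its constant term. -/
theorem ser_ext_of_recursion {F G : Ser} {V : Module.End ℝ Laurent}
    (h0 : PowerSeries.coeff 0 F = PowerSeries.coeff 0 G)
    (hF : ∀ n, V (PowerSeries.coeff n F) = ((n : Laurent) + 1) * PowerSeries.coeff (n + 1) F)
    (hG : ∀ n, V (PowerSeries.coeff n G) = ((n : Laurent) + 1) * PowerSeries.coeff (n + 1) G) :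
    F = G := by
  ext1 n
  induction n with
  | zero => exact h0
  | succ n ih =>
    have h := hF n
    rw [ih, hG n] at h
    have hu : IsUnit ((n : Laurent) + 1) := by
      have : ((n : Laurent) + 1) = algebraMap ℝ Laurent ((n : ℝ) + 1) := by
        rw [map_add, map_natCast, map_one]
      rw [this]
      exact (IsUnit.mk0 ((n : ℝ) + 1) (by positivity)).map (algebraMap ℝ Laurent)
    exact (hu.mul_left_cancel h).symm

theorem flow_coeff (V : Module.End ℝ Laurent) (f : Laurent) (n : ℕ) :
    V ((1 / (n.factorial : ℝ)) • (V ^ n) f) =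
      ((n : Laurent) + 1) * ((1 / ((n + 1).factorial : ℝ)) • (V ^ (n + 1)) f) := by
  have h1 : ((n : Laurent) + 1) = algebraMap ℝ Laurent ((n : ℝ) + 1) := by
    rw [map_add, map_natCast, map_one]
  rw [map_smul, ← pow_succ_apply, h1, ← Algebra.smul_def, smul_smul, Nat.factorial_succ]
  congr 1
  push_cast
  have : (n.factorial : ℝ) ≠ 0 := by positivity
  field_simp

/-- The flow `exp (ε V)` of a derivation `V`, as a ring homomorphism. -/
def IsDer.flow {V : Module.End ℝ Laurent} (h : IsDer V) : Laurent →+* Ser where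
  toFun f := PowerSeries.mk fun n => (1 / (n.factorial : ℝ)) • (V ^ n) f
  map_one' := by
    ext1 n
    cases n with
    | zero => simp
    | succ n => simp [pow_succ, h.one, PowerSeries.coeff_one]
  map_zero' := by ext1 n; simp
  map_add' f g := by ext1 n; simp
  map_mul' f g := by
    -- Both the flow of f g and the product of the flows solve dF/dε = V(F): d/dε and V are
    -- derivations of the ring of power series that agree on each factor, hence on the product.
    refine ser_ext_of_recursion (V := V) (by simp [PowerSeries.coeff_zero_eq_constantCoeff]) ?_ ?_
    · intro n
      simp only [PowerSeries.coeff_mk]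
      exact flow_coeff V _ n
    · have key (f : Laurent) : PowerSeries.derivative Laurent
          (PowerSeries.mk fun n => (1 / (n.factorial : ℝ)) • (V ^ n) f) =
          h.hat (PowerSeries.mk fun n => (1 / (n.factorial : ℝ)) • (V ^ n) f) := by
        ext1 n
        rw [PowerSeries.coeff_derivative, h.coeff_hat, PowerSeries.coeff_mk, PowerSeries.coeff_mk,
          flow_coeff, mul_comm]
      intro n
      rw [← h.coeff_hat, mul_comm (_ + 1), ← PowerSeries.coeff_derivative, Derivation.leibniz,
        Derivation.leibniz, key, key]

theorem IsDer.coeff_flow {V : Module.End ℝ Laurent} (h : IsDer V) (f : Laurent) (n : ℕ) :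
    PowerSeries.coeff n (h.flow f) = (1 / (n.factorial : ℝ)) • (V ^ n) f :=
  PowerSeries.coeff_mk n fun n => (1 / (n.factorial : ℝ)) • (V ^ n) f

/-- Turns the seed operators into explicit generating series without computing iterates of the
operator. -/
theorem IsDer.flow_eq {V : Module.End ℝ Laurent} (h : IsDer V) (s : ℕ → Laurent)
    (hs : ∀ n, V (s n) = ((n : Laurent) + 1) * s (n + 1)) :
    h.flow (s 0) = PowerSeries.mk s :=
  ser_ext_of_recursion (V := V) (by simp [h.coeff_flow])
    (fun n => by simp only [h.coeff_flow]; exact flow_coeff V _ n) (fun n => by simpa using hs n)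

/-- A ring homomorphism sends the unit given by a coordinate to a unit, so the power rule covers
negative exponents. Through it, everything about Q^ν and the like reduces to the exponent 1. -/
theorem IsDer.derivation_flow_pow {V : Module.End ℝ Laurent} (h : IsDer V)
    (D : Derivation ℝ Ser Ser) (a : Coord) (n : ℤ) : D (h.flow (pow a n)) =
      (n : Ser) * h.flow (pow a (n - 1)) * D (h.flow (X a)) := by
  have e (n : ℤ) : h.flow (pow a n) =
      ((Units.map (h.flow : Laurent →* Ser) (unitX a) ^ n : Serˣ) : Ser) := by
    rw [pow_eq_zpow, ← map_zpow]; rfl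
  rw [e, e, derivation_zpow]; rfl

/-! ### The families `Ξ`, `Θ` and `Υ` in terms of power series -/

/-- The sequence with the `q`-components given by a power series. -/
def genQ (F : Ser) : Gen
  | .q α => PowerSeries.coeff α F
  | _ => 0

/-- The sequence with the `m`-components given by a power series. -/
def genM (F : Ser) : Gen
  | .m α => PowerSeries.coeff α F
  | _ => 0

/-- The sequence with the components for `u` and `r_β` given by a power series. -/
def genV (F : Ser) : Gen
  | .u => PowerSeries.coeff 0 F
  | .r n => ((-1) ^ n : ℝ) • PowerSeries.coeff (n + 1) F
  | _ => 0

theorem coeff_X_mul_eq_prev (F : Ser) (n : ℕ) :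
    PowerSeries.coeff n (PowerSeries.X * F) = prev (fun k => PowerSeries.coeff k F) n := by
  cases n <;> simp [prev, PowerSeries.coeff_succ_X_mul]

theorem isDer_opX : IsDer opX := isDer_vf _
theorem isDer_opT : IsDer opT := isDer_vf _
theorem isDer_opV : IsDer opV := isDer_vf _

/-- The flow of `𝔛`. -/
abbrev flowX : Laurent →+* Ser := isDer_opX.flow
/-- The flow of `𝔗`. -/
abbrev flowT : Laurent →+* Ser := isDer_opT.flow
/-- The flow of `𝔙`. -/
abbrev flowV : Laurent →+* Ser := isDer_opV.flow

theorem Xi_eq (A : Laurent) : Xi A = genQ (flowX A) := by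
  funext d; cases d <;> simp [Xi, genQ, IsDer.coeff_flow]

theorem Theta_eq (A : Laurent) : Theta A = genM (flowT A) := by
  funext d; cases d <;> simp [Theta, genM, IsDer.coeff_flow]

theorem Upsilon_eq (A : Laurent) : Upsilon A = genV (flowV A) := by
  funext d; cases d <;> simp [Upsilon, genV, IsDer.coeff_flow, smul_smul, div_eq_mul_inv]

/-- The generating series of the `q_α`. -/
def serQ : Ser := PowerSeries.mk fun α => depX (.q α)
/-- The generating series of the `m_α`. -/
def serM : Ser := PowerSeries.mk fun α => depX (.m α)

/-- The coefficients of the generating series of `y`, `x`, `u` and the `r_β`. -/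
def coeffY : ℕ → Laurent
  | 0 => X .y
  | 1 => X .x
  | 2 => -depX .u
  | n + 3 => ((-1) ^ (n + 1) : ℝ) • depX (.r n)

/-- The coefficients of `t + z ε`. -/
def coeffT : ℕ → Laurent
  | 0 => X .t
  | 1 => X .z
  | _ + 2 => 0

/-- The generating series of `y`, `x`, `u` and the `r_β`. -/
def serY : Ser := PowerSeries.mk coeffY
/-- The power series `t + z ε`. -/
def serT : Ser := PowerSeries.mk coeffT

theorem flowX_q : flowX (X (.q 0 0 0)) = serQ :=
  isDer_opX.flow_eq (fun α => depX (.q α)) fun _ => vf_X _ _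

theorem flowT_m : flowT (X (.m 0 0 0)) = serM :=
  isDer_opT.flow_eq (fun α => depX (.m α)) fun _ => vf_X _ _

theorem opV_y : opV (X .y) = X .x := vf_X _ _
theorem opV_x : opV (X .x) = -2 * depX .u := vf_X _ _
theorem opV_z : opV (X .z) = 0 := vf_X _ _
theorem opV_t : opV (X .t) = X .z := vf_X _ _
theorem opV_u : opV (depX .u) = 3 * depX (.r 0) := vf_X _ _
theorem opV_r (n : ℕ) : opV (depX (.r n)) = -(((n : Laurent) + 4) * depX (.r (n + 1))) := vf_X _ _

/-- The numerical coefficients in 𝔙 are the positions in Y: -u stands at ε² and ±r_i at ε^(i+2), so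
𝔙 must multiply by 3 and by i + 3 respectively. -/
theorem flowV_y : flowV (X .y) = serY :=
  isDer_opV.flow_eq coeffY fun n => by
    rcases n with _ | _ | _ | n
    · simp [coeffY, opV_y]
    · simp only [coeffY, opV_x]; push_cast; ring
    · simp only [coeffY, map_neg, opV_u, zero_add, pow_one, neg_smul, one_smul]; push_cast; ring
    · simp only [coeffY, map_smul, opV_r]
      rw [pow_succ (-1 : ℝ) (n + 1), mul_neg_one, neg_smul, smul_neg, mul_neg, mul_smul_comm]
      push_cast; ring_nf

theorem flowV_t : flowV (X .t) = serT :=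
  isDer_opV.flow_eq coeffT fun n => by
    rcases n with _ | _ | n
    · simp [coeffT, opV_t]
    · simp [coeffT, opV_z]
    · simp [coeffT]

theorem IsDer.hat_mk {D : Module.End ℝ Laurent} (h : IsDer D) (s : ℕ → Laurent) :
    h.hat (PowerSeries.mk s) = PowerSeries.mk fun n => D (s n) := by
  ext1 n; simp

theorem evo_genQ (Q : Gen) (F : Ser) (d : Dep) :
    evo Q (genQ F d) = genQ ((isDer_evo Q).hat F) d := by cases d <;> simp [genQ]

theorem evo_genM (Q : Gen) (F : Ser) (d : Dep) :
    evo Q (genM F d) = genM ((isDer_evo Q).hat F) d := by cases d <;> simp [genM]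

theorem evo_genV (Q : Gen) (F : Ser) (d : Dep) :
    evo Q (genV F d) = genV ((isDer_evo Q).hat F) d := by cases d <;> simp [genV]

theorem genV_sub (F G : Ser) : genV (F - G) = genV F - genV G := by
  funext d; cases d <;> simp [genV, smul_sub]
theorem genQ_smul (c : ℝ) (F : Ser) : genQ (c • F) = c • genQ F := by
  funext d; cases d <;> simp [genQ]
theorem genM_smul (c : ℝ) (F : Ser) : genM (c • F) = c • genM F := by
  funext d; cases d <;> simp [genM]
theorem genV_smul (c : ℝ) (F : Ser) : genV (c • F) = c • genV F := by
  funext d; cases d <;> simp [genV]; rw [smul_comm]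
@[simp] theorem genQ_zero : genQ 0 = 0 := by funext d; cases d <;> simp [genQ]
@[simp] theorem genM_zero : genM 0 = 0 := by funext d; cases d <;> simp [genM]
@[simp] theorem genV_zero : genV 0 = 0 := by funext d; cases d <;> simp [genV]

/-- The operator `D₁ - a D₂ - ε D₃` on power series. -/
def derComb {D₁ D₂ D₃ : Module.End ℝ Laurent} (h₁ : IsDer D₁) (h₂ : IsDer D₂) (h₃ : IsDer D₃)
    (a b : Laurent) : Derivation ℝ Ser Ser :=
  h₁.hat - PowerSeries.C a • h₂.hat - (PowerSeries.C b * PowerSeries.X) • h₃.hat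

theorem coeff_derComb {D₁ D₂ D₃ : Module.End ℝ Laurent} (h₁ : IsDer D₁) (h₂ : IsDer D₂)
    (h₃ : IsDer D₃) (a b : Laurent) (F : Ser) (n : ℕ) :
    PowerSeries.coeff n (derComb h₁ h₂ h₃ a b F) =
      D₁ (PowerSeries.coeff n F) - a * D₂ (PowerSeries.coeff n F) -
        b * D₃ (prev (fun k => PowerSeries.coeff k F) n) := by
  rw [map_prev]
  simp only [derComb, Derivation.sub_apply, Derivation.smul_apply, smul_eq_mul, map_sub,
    IsDer.coeff_hat, PowerSeries.coeff_C_mul, mul_assoc, coeff_X_mul_eq_prev]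

/-- With zero u-component, the linearized q-equations are the coefficients of (D_t - u_z D_x - ε
D_z) F = 0 and (D_y - u_x D_x - ε D_x) F = 0. They are first-order homogeneous, so their solutions
are closed under products. -/
theorem isSymmetry_genQ {F : Ser} (ht : derComb isDer_dT isDer_dX isDer_dZ uz 1 F = 0)
    (hy : derComb isDer_dY isDer_dX isDer_dX ux 1 F = 0) : IsSymmetry (genQ F) := by
  apply isSymmetry_of_def
  · intro α
    have h := congrArg (PowerSeries.coeff α) ht
    rw [coeff_derComb, map_zero] at h
    simp only [defQt, genQ, map_zero]
    linear_combination h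
  · intro α
    have h := congrArg (PowerSeries.coeff α) hy
    rw [coeff_derComb, map_zero] at h
    simp only [defQy, genQ, map_zero]
    linear_combination h
  all_goals intros; simp [defMt, defMy, defRx0, defRz0, defRx, defRz, genQ, prev_zero]

theorem isSymmetry_genM {F : Ser}
    (ht : derComb isDer_dT isDer_dX isDer_dZ uz (-ti) F + PowerSeries.C (vz * ti) *
      isDer_dZ.hat F = 0)
    (hy : derComb isDer_dY isDer_dX isDer_dX ux (-ti) F + PowerSeries.C (vz * ti) *
      isDer_dX.hat F = 0) : IsSymmetry (genM F) := by
  apply isSymmetry_of_def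
  iterate 2 · intros; simp [defQt, defQy, genM, prev_zero]
  · intro α
    have h := congrArg (PowerSeries.coeff α) ht
    rw [map_add, coeff_derComb, map_zero, PowerSeries.coeff_C_mul, IsDer.coeff_hat] at h
    simp only [defMt, genM, map_zero]
    linear_combination h
  · intro α
    have h := congrArg (PowerSeries.coeff α) hy
    rw [map_add, coeff_derComb, map_zero, PowerSeries.coeff_C_mul, IsDer.coeff_hat] at h
    simp only [defMy, genM, map_zero]
    linear_combination h
  all_goals intros; simp [defRx0, defRz0, defRx, defRz, genM]

/-- The constant terms of the two hypotheses make the x- and z-derivatives of the u-component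
vanish. This kills its contribution to the q- and m-equations and to the coefficients r_{β,x},
leaving the linear recursion for the r-components. -/
theorem isSymmetry_genV {F : Ser}
    (hx : isDer_dX.hat F - PowerSeries.X * (isDer_dY.hat F - PowerSeries.C ux * isDer_dX.hat F) = 0)
    (hz : isDer_dZ.hat F - PowerSeries.X * (isDer_dT.hat F - PowerSeries.C uz * isDer_dX.hat F) = 0) :
    IsSymmetry (genV F) := by
  have cx (n : ℕ) := congrArg (PowerSeries.coeff n) hx
  have cz (n : ℕ) := congrArg (PowerSeries.coeff n) hz
  simp only [map_sub, coeff_X_mul_eq_prev, PowerSeries.coeff_C_mul, IsDer.coeff_hat, map_zero]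
    at cx cz
  have x0 : dX (PowerSeries.coeff 0 F) = 0 := by simpa [prev] using cx 0
  have z0 : dZ (PowerSeries.coeff 0 F) = 0 := by simpa [prev] using cz 0
  apply isSymmetry_of_def
  iterate 4 · intros; simp only [defQt, defQy, defMt, defMy, genV, prev_zero, x0, z0, map_zero]; ring
  · have h := cx 1
    simp only [prev] at h
    simp only [defRx0, genV, _root_.pow_zero, one_smul]
    linear_combination h + ux * x0
  · have h := cz 1
    simp only [prev] at h
    simp only [defRz0, genV, _root_.pow_zero, one_smul]
    linear_combination h + ux * z0
  · intro n
    have h := cx (n + 2)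
    simp only [prev] at h
    have h' : dX (PowerSeries.coeff (n + 1 + 1) F) =
        dY (PowerSeries.coeff (n + 1) F) - ux * dX (PowerSeries.coeff (n + 1) F) := by
      linear_combination h
    simp only [defRx, genV, map_smul, x0, pow_succ, mul_neg_one, neg_smul, mul_smul_comm, map_neg,
      h', mul_zero, sub_zero, smul_sub]
    abel
  · intro n
    have h := cz (n + 2)
    simp only [prev] at h
    have h' : dZ (PowerSeries.coeff (n + 1 + 1) F) =
        dT (PowerSeries.coeff (n + 1) F) - uz * dX (PowerSeries.coeff (n + 1) F) := by
      linear_combination h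
    simp only [defRz, genV, map_smul, z0, pow_succ, mul_neg_one, neg_smul, mul_smul_comm, map_neg,
      h', mul_zero, sub_zero, smul_sub]
    abel

/-! ### The families `Ξ`, `Θ` and `Υ` consist of symmetries -/

theorem IsDer.flow_pow_eq_zero {V : Module.End ℝ Laurent} (h : IsDer V) (D : Derivation ℝ Ser Ser)
    (a : Coord) (h0 : D (h.flow (X a)) = 0) (n : ℤ) : D (h.flow (pow a n)) = 0 := by
  rw [h.derivation_flow_pow, h0, mul_zero]

theorem flowV_eq_zero (D : Derivation ℝ Ser Ser) (hy : D serY = 0) (ht : D serT = 0) (m n : ℤ) :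
    D (flowV (pow .y m * pow .t n)) = 0 := by
  rw [map_mul, D.leibniz, isDer_opV.flow_pow_eq_zero D .y (by rwa [flowV_y]),
    isDer_opV.flow_pow_eq_zero D .t (by rwa [flowV_t]), smul_zero, smul_zero, add_zero]

theorem isSymmetry_Xi (ν : ℤ) : IsSymmetry (Xi (pow (.q 0 0 0) ν)) := by
  rw [Xi_eq]
  refine isSymmetry_genQ (isDer_opX.flow_pow_eq_zero (derComb _ _ _ _ _) _ ?_ ν)
    (isDer_opX.flow_pow_eq_zero (derComb _ _ _ _ _) _ ?_ ν) <;> rw [flowX_q] <;> ext1 n <;>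
    rw [coeff_derComb, map_zero]
  · have h := eqn_qt n
    rw [← map_prev, ← uz_eq] at h
    simp only [serQ, PowerSeries.coeff_mk]
    linear_combination h
  · have h := eqn_qy n
    rw [← map_prev, ← ux_eq] at h
    simp only [serQ, PowerSeries.coeff_mk]
    linear_combination h

theorem isSymmetry_Theta (ν : ℤ) : IsSymmetry (Theta (pow (.m 0 0 0) ν)) := by
  rw [Theta_eq]
  refine isSymmetry_genM
    (isDer_opT.flow_pow_eq_zero
      (derComb _ _ _ _ _ + PowerSeries.C (vz * ti) • isDer_dZ.hat) _ ?_ ν)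
    (isDer_opT.flow_pow_eq_zero
      (derComb _ _ _ _ _ + PowerSeries.C (vz * ti) • isDer_dX.hat) _ ?_ ν) <;>
    rw [flowT_m] <;> ext1 n <;>
    rw [Derivation.add_apply, map_add, coeff_derComb, map_zero, Derivation.smul_apply, smul_eq_mul,
      PowerSeries.coeff_C_mul, IsDer.coeff_hat]
  · have h := eqn_mt n
    rw [← map_prev, ← uz_eq] at h
    simp only [serM, PowerSeries.coeff_mk]
    linear_combination h
  · have h := eqn_my n
    rw [← map_prev, ← ux_eq] at h
    simp only [serM, PowerSeries.coeff_mk]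
    linear_combination h

/-- The covering equations for r_β say that D_x - ε(D_y - u_x D_x) and D_z - ε(D_t - u_z D_x)
annihilate Y; that they annihilate T is immediate. Hence they annihilate all Y^m T^n. -/
theorem isSymmetry_Upsilon (m n : ℤ) : IsSymmetry (Upsilon (pow .y m * pow .t n)) := by
  rw [Upsilon_eq]
  refine isSymmetry_genV
    (flowV_eq_zero (isDer_dX.hat - (PowerSeries.X : Ser) • (isDer_dY.hat - PowerSeries.C ux •
      isDer_dX.hat)) ?_ ?_ m n)
    (flowV_eq_zero (isDer_dZ.hat - (PowerSeries.X : Ser) • (isDer_dT.hat - PowerSeries.C uz •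
      isDer_dX.hat)) ?_ ?_ m n) <;>
  ext1 k <;> simp only [Derivation.sub_apply, Derivation.smul_apply, smul_eq_mul, map_sub,
    coeff_X_mul_eq_prev, PowerSeries.coeff_C_mul, IsDer.coeff_hat, map_zero, serY, serT,
    PowerSeries.coeff_mk] <;> rcases k with _ | _ | _ | _ | k
  all_goals
    simp only [prev, coeffY, coeffT, map_neg, map_smul, map_zero, dX_x, dX_y, dX_z, dX_t, dY_x, dY_y,
      dY_z, dY_t, dZ_x, dZ_y, dZ_z, dZ_t, dT_x, dT_y, dT_z, dT_t, eqn_rx_zero, eqn_rz_zero,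
      eqn_rx_succ, eqn_rz_succ, ← ux_eq, ← uz_eq, zero_add, pow_succ,
      _root_.pow_zero, one_smul, neg_smul, neg_neg, mul_zero, mul_one, sub_zero, sub_self, mul_neg, mul_smul_comm, smul_sub]
  all_goals ring

/-! ### Lie derivatives of the recursion operators along the seed generators -/

/-- The Lie derivative `L_P A (Q) = {P, A Q} - A {P, Q}` of an operator `A`. -/
def lieD (P : Gen) (A : Gen ≃ₗ[ℝ] Gen) (Q : Gen) : Gen := jacobi P (A Q) - A (jacobi P Q)

theorem jacobi_apply (P Q : Gen) (d : Dep) : jacobi P Q d = evo P (Q d) - evo Q (P d) := rfl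

theorem Rq_apply (P : Gen) : Rq P = RqFun P := rfl
theorem Rm_apply (P : Gen) (d : Dep) : Rm P d = vt * Rq P d + vz * P d := rfl

theorem evo_prev (P : Gen) (f : ℕ → Laurent) (α : ℕ) :
    evo P (prev f α) = prev (fun β => evo P (f β)) α := map_prev _ f α

/-- The coefficients u_x, q_{α,x}, m_{α,x}, r_{β,x} of R^q are the x-derivatives of the dependent
variables, and E_P sends them to the x-derivatives of the components of P. -/
theorem evo_Rq {P : Gen} (hP : IsSymmetry P) (Q : Gen) (d : Dep) :
    evo P (Rq Q d) = Q .u * dX (P d) + Rq (fun e => evo P (Q e)) d := by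
  rw [Rq_apply, Rq_apply]
  cases d <;> simp only [RqFun, map_add, map_sub, evo_mul, evo_ux', evo_qx, evo_mx, hP.evo_rx,
    evo_prev, evo_ti, evo_vz] <;> ring

/-- The terms E_P(Q) cancel, so Q is never differentiated by E_P. What remains is, for fixed Q, an
expression in derivations applied to the components of P. -/
theorem lieD_Rq {P : Gen} (hP : IsSymmetry P) (Q : Gen) (d : Dep) :
    lieD P Rq Q d = Q .u * dX (P d) - evo (Rq Q) (P d) + RqFun (fun e => evo Q (P e)) d := by
  have h : jacobi P Q = (fun e => evo P (Q e)) - fun e => evo Q (P e) := rfl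
  rw [lieD, Pi.sub_apply, jacobi_apply, evo_Rq hP, h, map_sub, Pi.sub_apply, ← Rq_apply]
  ring

theorem lieD_Rm (P Q : Gen) (d : Dep) :
    lieD P Rm Q d = vt * lieD P Rq Q d + vt * evo (Rq Q) (P d) + vz * evo Q (P d)
      - evo (Rm Q) (P d) := by
  rw [lieD, lieD, Pi.sub_apply, Pi.sub_apply, jacobi_apply, jacobi_apply, Rm_apply, Rm_apply,
    map_add, evo_mul, evo_mul, evo_vt, evo_vz, jacobi_apply]
  ring

/-- The derivation Q_u D_x - E_{R^q(Q)} + ε E_Q, where Q_u is the u-component of Q, annihilates the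
generating series of the q_α: this is the definition of R^q on q-components. Hence it annihilates
all powers of that series. -/
theorem lieD_Rq_Xi (ν : ℤ) (Q : Gen) : lieD (Xi (pow (.q 0 0 0) ν)) Rq Q = 0 := by
  have key := isDer_opX.flow_pow_eq_zero (PowerSeries.C (Q .u) • isDer_dX.hat -
    (isDer_evo (Rq Q)).hat + (PowerSeries.X : Ser) • (isDer_evo Q).hat) (.q 0 0 0) (by
      rw [flowX_q]
      ext1 n
      simp only [Derivation.sub_apply, Derivation.add_apply, Derivation.smul_apply, smul_eq_mul,
        map_sub, map_add, coeff_X_mul_eq_prev, PowerSeries.coeff_C_mul, IsDer.coeff_hat, map_zero,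
        serQ, PowerSeries.coeff_mk, evo_depX, Rq_apply, RqFun, ← qx_eq]
      ring) ν
  funext d
  rw [lieD_Rq (isSymmetry_Xi ν), Xi_eq]
  cases d with
  | q α =>
    have h := congrArg (PowerSeries.coeff α) key
    simp only [Derivation.sub_apply, Derivation.add_apply, Derivation.smul_apply, smul_eq_mul,
      map_sub, map_add, coeff_X_mul_eq_prev, PowerSeries.coeff_C_mul, IsDer.coeff_hat,
      map_zero] at h
    simp only [RqFun]
    simp only [genQ, map_zero, Pi.zero_apply]
    linear_combination h
  | _ =>
    simp only [RqFun]
    simp [genQ, prev_zero]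

/-- As for `Ξ`, with the derivation Q_u D_x - E_{R^q(Q)} - (z + ε) t⁻¹ E_Q read off from the
m-components of R^q. -/
theorem lieD_Rq_Theta (ν : ℤ) (Q : Gen) : lieD (Theta (pow (.m 0 0 0) ν)) Rq Q = 0 := by
  have key := isDer_opT.flow_pow_eq_zero (PowerSeries.C (Q .u) • isDer_dX.hat -
    (isDer_evo (Rq Q)).hat - (PowerSeries.C (vz * ti)) • (isDer_evo Q).hat
    - (PowerSeries.C ti) • (PowerSeries.X : Ser) • (isDer_evo Q).hat) (.m 0 0 0) (by
      rw [flowT_m]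
      ext1 n
      simp only [Derivation.sub_apply, Derivation.smul_apply, smul_eq_mul,
        map_sub, coeff_X_mul_eq_prev, PowerSeries.coeff_C_mul, IsDer.coeff_hat, map_zero,
        serM, PowerSeries.coeff_mk, evo_depX, Rq_apply, RqFun, ← mx_eq]
      ring) ν
  funext d
  rw [lieD_Rq (isSymmetry_Theta ν), Theta_eq]
  cases d with
  | m α =>
    have h := congrArg (PowerSeries.coeff α) key
    simp only [Derivation.sub_apply, Derivation.smul_apply, smul_eq_mul,
      map_sub, coeff_X_mul_eq_prev, PowerSeries.coeff_C_mul, IsDer.coeff_hat,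
      map_zero] at h
    simp only [RqFun]
    simp only [genM, map_zero, Pi.zero_apply]
    linear_combination h
  | _ =>
    simp only [RqFun]
    simp [genM, prev_zero]

/-- Here the derivation is ε(Q_u D_x - E_{R^q(Q)}) + E_Q, which annihilates Y by the u- and
r-components of R^q, and T because T contains no dependent variable. -/
theorem lieD_Rq_Upsilon (m n : ℤ) (Q : Gen) :
    lieD (Upsilon (pow .y m * pow .t n)) Rq Q = 0 := by
  have key := flowV_eq_zero ((PowerSeries.X : Ser) • (PowerSeries.C (Q .u) • isDer_dX.hat -
    (isDer_evo (Rq Q)).hat) + (isDer_evo Q).hat) (by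
      ext1 n
      simp only [Derivation.sub_apply, Derivation.add_apply, Derivation.smul_apply, smul_eq_mul,
        map_sub, map_add, coeff_X_mul_eq_prev, PowerSeries.coeff_C_mul, IsDer.coeff_hat, map_zero,
        serY, PowerSeries.coeff_mk]
      rcases n with _ | _ | _ | _ | n
      all_goals
        simp only [prev, coeffY, map_neg, map_smul, dX_x, dX_y, evo_x, evo_y, evo_depX, Rq_apply,
          RqFun, ← ux_eq, ← rx_eq, pow_succ, _root_.pow_zero, mul_neg_one, mul_neg, neg_smul,
          one_smul, neg_neg, smul_sub, mul_smul_comm, mul_one]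
      all_goals ring_nf)
    (by
      ext1 n
      simp only [Derivation.sub_apply, Derivation.add_apply, Derivation.smul_apply, smul_eq_mul,
        map_sub, map_add, coeff_X_mul_eq_prev, PowerSeries.coeff_C_mul, IsDer.coeff_hat, map_zero,
        serT, PowerSeries.coeff_mk]
      rcases n with _ | _ | n <;> simp [prev, coeffT]
      cases n <;> simp [coeffT]) m n
  have c (k : ℕ) := congrArg (PowerSeries.coeff k) key
  simp only [Derivation.sub_apply, Derivation.add_apply, Derivation.smul_apply, smul_eq_mul,
      map_sub, map_add, coeff_X_mul_eq_prev, PowerSeries.coeff_C_mul, IsDer.coeff_hat,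
      map_zero] at c
  have c0 := c 0
  simp only [prev, zero_add] at c0
  funext d
  rw [lieD_Rq (isSymmetry_Upsilon m n), Upsilon_eq]
  cases d with
  | u =>
    have h := c 1
    simp only [prev] at h
    simp only [RqFun]
    simp only [genV, c0, Pi.zero_apply, _root_.pow_zero, one_smul]
    linear_combination h
  | r k =>
    have h := c (k + 2)
    simp only [prev] at h
    have h' : evo Q (PowerSeries.coeff (k + 1 + 1) (flowV (pow .y m * pow .t n))) =
      evo (Rq Q) (PowerSeries.coeff (k + 1) (flowV (pow .y m * pow .t n))) -
      Q .u * dX (PowerSeries.coeff (k + 1) (flowV (pow .y m * pow .t n))) := by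
      linear_combination h
    simp only [RqFun]
    simp only [genV, c0, Pi.zero_apply, map_smul, h', pow_succ, mul_neg_one, neg_smul,
      map_neg, mul_smul_comm, smul_sub, mul_zero]
    abel
  | _ =>
    simp only [RqFun]
    simp only [genV, map_zero, c0, prev_zero, Pi.zero_apply]
    ring

/-! Sequences on which evolutionary vector fields act linearly over functions. -/

/-- The components involve dependent variables only without derivatives, so the evolutionary field
acts on them through the values of its generating function alone, and those of R^m(Q) are t R^q(Q) +
z Q. -/
theorem evo_Rm_Xi (ν : ℤ) (Q : Gen) (d : Dep) : evo (Rm Q) (Xi (pow (.q 0 0 0) ν) d) =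
    vt * evo (Rq Q) (Xi (pow (.q 0 0 0) ν) d) + vz * evo Q (Xi (pow (.q 0 0 0) ν) d) := by
  have key := isDer_opX.flow_pow_eq_zero ((isDer_evo (Rm Q)).hat - PowerSeries.C vt •
    (isDer_evo (Rq Q)).hat - PowerSeries.C vz • (isDer_evo Q).hat) (.q 0 0 0) (by
      rw [flowX_q]
      ext1 n
      simp only [Derivation.sub_apply, Derivation.smul_apply, smul_eq_mul, map_sub,
        PowerSeries.coeff_C_mul, IsDer.coeff_hat, map_zero, serQ, PowerSeries.coeff_mk, evo_depX,
        Rm_apply]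
      ring) ν
  rw [Xi_eq]
  cases d with
  | q α =>
    have h := congrArg (PowerSeries.coeff α) key
    simp only [Derivation.sub_apply, Derivation.smul_apply, smul_eq_mul, map_sub,
      PowerSeries.coeff_C_mul, IsDer.coeff_hat, map_zero] at h
    simp only [genQ]
    linear_combination h
  | _ => simp [genQ]

theorem evo_Rm_Theta (ν : ℤ) (Q : Gen) (d : Dep) : evo (Rm Q) (Theta (pow (.m 0 0 0) ν) d) =
    vt * evo (Rq Q) (Theta (pow (.m 0 0 0) ν) d) + vz * evo Q (Theta (pow (.m 0 0 0) ν) d) := by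
  have key := isDer_opT.flow_pow_eq_zero ((isDer_evo (Rm Q)).hat - PowerSeries.C vt •
    (isDer_evo (Rq Q)).hat - PowerSeries.C vz • (isDer_evo Q).hat) (.m 0 0 0) (by
      rw [flowT_m]
      ext1 n
      simp only [Derivation.sub_apply, Derivation.smul_apply, smul_eq_mul, map_sub,
        PowerSeries.coeff_C_mul, IsDer.coeff_hat, map_zero, serM, PowerSeries.coeff_mk, evo_depX,
        Rm_apply]
      ring) ν
  rw [Theta_eq]
  cases d with
  | m α =>
    have h := congrArg (PowerSeries.coeff α) key
    simp only [Derivation.sub_apply, Derivation.smul_apply, smul_eq_mul, map_sub,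
      PowerSeries.coeff_C_mul, IsDer.coeff_hat, map_zero] at h
    simp only [genM]
    linear_combination h
  | _ => simp [genM]

theorem evo_Rm_Upsilon (m n : ℤ) (Q : Gen) (d : Dep) :
    evo (Rm Q) (Upsilon (pow .y m * pow .t n) d) =
      vt * evo (Rq Q) (Upsilon (pow .y m * pow .t n) d) +
        vz * evo Q (Upsilon (pow .y m * pow .t n) d) := by
  have key := flowV_eq_zero ((isDer_evo (Rm Q)).hat - PowerSeries.C vt •
    (isDer_evo (Rq Q)).hat - PowerSeries.C vz • (isDer_evo Q).hat) (by
      ext1 n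
      simp only [Derivation.sub_apply, Derivation.smul_apply, smul_eq_mul, map_sub,
        PowerSeries.coeff_C_mul, IsDer.coeff_hat, map_zero, serY, PowerSeries.coeff_mk]
      rcases n with _ | _ | _ | n <;>
        simp only [coeffY, map_neg, map_smul, evo_x, evo_y, evo_depX, Rm_apply, smul_add,
          mul_smul_comm] <;> ring)
    (by
      ext1 n
      simp only [Derivation.sub_apply, Derivation.smul_apply, smul_eq_mul, map_sub,
        PowerSeries.coeff_C_mul, IsDer.coeff_hat, map_zero, serT, PowerSeries.coeff_mk]
      rcases n with _ | _ | n <;> simp [coeffT]) m n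
  have c (k : ℕ) := congrArg (PowerSeries.coeff k) key
  simp only [Derivation.sub_apply, Derivation.smul_apply, smul_eq_mul, map_sub,
      PowerSeries.coeff_C_mul, IsDer.coeff_hat, map_zero] at c
  have c' (k : ℕ) := sub_eq_iff_eq_add.mp (sub_eq_zero.mp (c k))
  rw [Upsilon_eq]
  cases d with
  | u => simp only [genV]; rw [c' 0]; ring
  | r k => simp only [genV, map_smul]; rw [c' (k + 1)]; simp only [mul_smul_comm, smul_add]; abel
  | _ => simp [genV]

/-- The action of the evolutionary vector field of a symmetry on `Ω`. -/
def actOmega (Q : Gen) : Gen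
  | .u => vt * dT (Q .u) - X .x * dX (Q .u) + 2 * Q .u
  | .q α => vt * dT (Q (.q α)) - X .x * dX (Q (.q α)) - (α : Laurent) * Q (.q α)
  | .m α => vt * dT (Q (.m α)) - X .x * dX (Q (.m α))
  | .r n => vt * dT (Q (.r n)) - X .x * dX (Q (.r n)) + ((n : Laurent) + 3) * Q (.r n)

/-- The action of the evolutionary vector field of a symmetry on `Ψ`. -/
def actPsi (Q : Gen) : Gen
  | .m α => dZ (Q (.m α)) - ((α : Laurent) + 1) * Q (.m (α + 1))
  | d => dZ (Q d)

theorem evo_natCast (Q : Gen) (n : ℕ) : evo Q (n : Laurent) = 0 := (isDer_evo Q).natCast n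
theorem evo_one (Q : Gen) : evo Q 1 = 0 := (isDer_evo Q).one
theorem evo_two (Q : Gen) : evo Q 2 = 0 := (isDer_evo Q).ofNat 2
theorem evo_three (Q : Gen) : evo Q 3 = 0 := (isDer_evo Q).ofNat 3

/-! ### Lie derivatives along `Ω` and `Ψ` -/

theorem evo_Omega {Q : Gen} (hQ : IsSymmetry Q) (d : Dep) : evo Q (Omega d) = actOmega Q d := by
  cases d <;> simp only [Omega_u, Omega_q, Omega_m, Omega_r, actOmega, map_add, map_sub, evo_mul,
    evo_vt, evo_x, hQ.evo_dT, hQ.evo_dX, evo_depX, evo_natCast, evo_two, evo_three] <;> ring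

theorem evo_Psi {Q : Gen} (hQ : IsSymmetry Q) (d : Dep) : evo Q (Psi d) = actPsi Q d := by
  cases d <;> simp only [Psi_u, Psi_q, Psi_m, Psi_r, actPsi, map_add, map_sub, evo_mul,
    hQ.evo_dZ, evo_depX, evo_natCast, evo_one] <;> ring

theorem lieD_Rq_Omega {Q : Gen} (hQ : IsSymmetry Q) : lieD Omega Rq Q = Rq Q := by
  funext d
  rw [lieD_Rq isSymmetry_Omega, evo_Omega (isSymmetry_Rq hQ)]
  simp only [evo_Omega hQ, Rq_apply]
  cases d with
  | u =>
    simp only [RqFun, actOmega, Omega_u, map_add, map_sub, dX_mul, dT_mul, ux_eq, dX_vt, dX_x,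
      dX_two, cXT]
    push_cast
    ring
  | q α =>
    cases α with
    | zero =>
      simp only [RqFun, actOmega, Omega_q, map_add, map_sub, dX_mul, dT_mul, qx_eq, dX_vt, dX_x,
        dX_natCast, cXT, prev, map_zero]
      push_cast
      ring
    | succ α =>
      simp only [RqFun, actOmega, Omega_q, map_add, map_sub, dX_mul, dT_mul, qx_eq, dX_vt, dX_x,
        dX_natCast, cXT, prev]
      push_cast
      ring
  | m α =>
    cases α with
    | zero =>
      simp only [RqFun, actOmega, Omega_m, map_add, map_sub, dX_mul, dT_mul, mx_eq, dX_vt, dX_x,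
        cXT, prev, map_zero, dX_vz, dT_vz, dX_ti, dT_ti]
      linear_combination (-vz * ti * Q (.m 0)) * vt_mul_ti
    | succ α =>
      simp only [RqFun, actOmega, Omega_m, map_add, map_sub, dX_mul, dT_mul, mx_eq, dX_vt, dX_x,
        cXT, prev, dX_vz, dT_vz, dX_ti, dT_ti]
      linear_combination (-vz * ti * Q (.m (α + 1)) - ti * Q (.m α)) * vt_mul_ti
  | r n =>
    simp only [RqFun, actOmega, Omega_r, map_add, map_sub, dX_mul, dT_mul, rx_eq, dX_vt, dX_x,
      dX_natCast, dX_three, cXT]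
    push_cast
    ring

theorem lieD_Rq_Psi {Q : Gen} (hQ : IsSymmetry Q) : lieD Psi Rq Q = 0 := by
  funext d
  rw [lieD_Rq isSymmetry_Psi, evo_Psi (isSymmetry_Rq hQ)]
  simp only [evo_Psi hQ, Rq_apply, Pi.zero_apply]
  cases d with
  | u =>
    simp only [RqFun, actPsi, Psi_u, map_add, dZ_mul, ux_eq, cXZ]
    ring
  | q α =>
    cases α <;> simp only [RqFun, actPsi, Psi_q, map_add, dZ_mul, qx_eq, cXZ, prev, map_zero] <;>
      ring
  | m α =>
    cases α <;> simp only [RqFun, actPsi, Psi_m, map_add, map_sub, dX_mul, dZ_mul, mx_eq, cXZ,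
      prev, map_zero, dX_one, dX_natCast, dZ_vz, dZ_ti] <;> push_cast <;> ring
  | r n =>
    simp only [RqFun, actPsi, Psi_r, map_add, map_sub, dZ_mul, rx_eq, cXZ]
    ring

/-- The scaling of R^q by Ω is offset by the explicit factor t in R^m = t R^q + z. In the same way,
the z-derivative in Ψ meets only the explicit z of R^m and yields -id in the next lemma. -/
theorem lieD_Rm_Omega {Q : Gen} (hQ : IsSymmetry Q) : lieD Omega Rm Q = 0 := by
  funext d
  rw [lieD_Rm, lieD_Rq_Omega hQ, evo_Omega hQ, evo_Omega (isSymmetry_Rq hQ),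
    evo_Omega (isSymmetry_Rm hQ)]
  cases d <;> simp only [actOmega, Rm_apply, map_add, dX_mul, dT_mul, dX_vt, dX_vz, dT_vt, dT_vz,
    Pi.zero_apply] <;> ring

theorem lieD_Rm_Psi {Q : Gen} (hQ : IsSymmetry Q) : lieD Psi Rm Q = -Q := by
  funext d
  rw [lieD_Rm, lieD_Rq_Psi hQ, evo_Psi hQ, evo_Psi (isSymmetry_Rq hQ),
    evo_Psi (isSymmetry_Rm hQ)]
  cases d <;> simp only [actPsi, Rm_apply, map_add, dZ_mul, dZ_vt, dZ_vz, Pi.zero_apply,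
    Pi.neg_apply] <;> ring

theorem lieD_Rm_Xi (ν : ℤ) (Q : Gen) : lieD (Xi (pow (.q 0 0 0) ν)) Rm Q = 0 := by
  funext d
  rw [lieD_Rm, lieD_Rq_Xi, evo_Rm_Xi]
  simp

theorem lieD_Rm_Theta (ν : ℤ) (Q : Gen) : lieD (Theta (pow (.m 0 0 0) ν)) Rm Q = 0 := by
  funext d
  rw [lieD_Rm, lieD_Rq_Theta, evo_Rm_Theta]
  simp

theorem lieD_Rm_Upsilon (m n : ℤ) (Q : Gen) :
    lieD (Upsilon (pow .y m * pow .t n)) Rm Q = 0 := by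
  funext d
  rw [lieD_Rm, lieD_Rq_Upsilon, evo_Rm_Upsilon]
  simp

/-! ### Jacobi brackets of the seed generators -/

/-- The derivative of power series with respect to the formal variable. -/
def dE : Derivation ℝ Ser Ser := (PowerSeries.derivative Laurent).restrictScalars ℝ

theorem coeff_dE (F : Ser) (n : ℕ) :
    PowerSeries.coeff n (dE F) = PowerSeries.coeff (n + 1) F * ((n : Laurent) + 1) :=
  PowerSeries.coeff_derivative F n

theorem coeff_X_smul_dE (F : Ser) (n : ℕ) :
    PowerSeries.coeff n ((PowerSeries.X : Ser) * dE F) =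
      (n : Laurent) * PowerSeries.coeff n F := by
  rw [coeff_X_mul_eq_prev]
  cases n with
  | zero => simp [prev]
  | succ n => simp only [prev, coeff_dE]; push_cast; ring

theorem hat_evo_serQ (Q : Gen) :
    (isDer_evo Q).hat serQ = PowerSeries.mk fun α => Q (.q α) := by
  simp only [serQ, IsDer.hat_mk, evo_depX]

theorem hat_evo_serM (Q : Gen) :
    (isDer_evo Q).hat serM = PowerSeries.mk fun α => Q (.m α) := by
  simp only [serM, IsDer.hat_mk, evo_depX]

theorem hat_evo_serQ_eq_zero {Q : Gen} (h : ∀ α, Q (.q α) = 0) : (isDer_evo Q).hat serQ = 0 := by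
  ext1 n; simp [serQ, evo_depX, h]

theorem hat_evo_serM_eq_zero {Q : Gen} (h : ∀ α, Q (.m α) = 0) : (isDer_evo Q).hat serM = 0 := by
  ext1 n; simp [serM, evo_depX, h]

theorem hat_evo_serT (Q : Gen) : (isDer_evo Q).hat serT = 0 := by
  ext1 n
  rcases n with _ | _ | n <;> simp [serT, coeffT, evo_t, evo_z]

theorem hat_evo_serY_eq_zero {Q : Gen} (hu : Q .u = 0) (hr : ∀ n, Q (.r n) = 0) :
    (isDer_evo Q).hat serY = 0 := by
  ext1 n
  rcases n with _ | _ | _ | n <;> simp [serY, coeffY, evo_x, evo_y, evo_depX, hu, hr]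

/-- The dependent variables first appear in Y at ε², with the opposite sign to `genV`. -/
theorem hat_evo_genV_serY (F : Ser) :
    (isDer_evo (genV F)).hat serY = -(PowerSeries.X * (PowerSeries.X * F)) := by
  ext1 n
  rw [map_neg, coeff_X_mul_eq_prev, IsDer.coeff_hat, serY, PowerSeries.coeff_mk]
  rcases n with _ | _ | _ | n
  · simp [coeffY, evo_y, prev]
  · simp [coeffY, evo_x, prev]
  · simp [coeffY, evo_depX, prev, genV]
  · simp only [coeffY, map_smul, evo_depX, genV, prev, PowerSeries.coeff_succ_X_mul, smul_smul]
    -- The sign of the variable in Y times its sign in `genV` is (-1)^(2n+1) = -1.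
    rw [← pow_add, show n + 1 + n = 2 * n + 1 by ring, pow_succ, pow_mul]
    simp

theorem flowX_pow (ν : ℤ) (D : Derivation ℝ Ser Ser) : D (flowX (pow (.q 0 0 0) ν)) =
    (ν : Ser) * flowX (pow (.q 0 0 0) (ν - 1)) * D serQ := by
  rw [isDer_opX.derivation_flow_pow, flowX_q]

theorem flowT_pow (ν : ℤ) (D : Derivation ℝ Ser Ser) : D (flowT (pow (.m 0 0 0) ν)) =
    (ν : Ser) * flowT (pow (.m 0 0 0) (ν - 1)) * D serM := by
  rw [isDer_opT.derivation_flow_pow, flowT_m]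

theorem flowV_pow (m n : ℤ) (D : Derivation ℝ Ser Ser) : D (flowV (pow .y m * pow .t n)) =
    (m : Ser) * flowV (pow .y (m - 1) * pow .t n) * D serY +
      (n : Ser) * flowV (pow .y m * pow .t (n - 1)) * D serT := by
  rw [map_mul, D.leibniz, isDer_opV.derivation_flow_pow, isDer_opV.derivation_flow_pow, flowV_y,
    flowV_t, map_mul, map_mul, smul_eq_mul, smul_eq_mul]
  ring

/-- On series without constant term R^q is division by ε, so R^m = t R^q + z is multiplication by
T/ε. This explains why brackets with `Υ` come with powers of R^m. -/
theorem Rm_genV_X_mul (F : Ser) : Rm (genV (PowerSeries.X * F)) = genV (serT * F) := by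
  have hT : serT = PowerSeries.C vt + PowerSeries.X * PowerSeries.C vz := by
    ext1 n
    rw [map_add, coeff_X_mul_eq_prev]
    rcases n with _ | _ | n
    · simp [serT, coeffT, prev, vt]
    · simp [serT, coeffT, prev, vz, PowerSeries.coeff_C]
    · simp [serT, coeffT, prev, PowerSeries.coeff_C]
  funext d
  rw [Rm_apply, Rq_apply, hT, add_mul, mul_assoc]
  cases d with
  | u => simp [RqFun, genV]
  | q α => cases α <;> simp [RqFun, genV, prev]
  | m α => cases α <;> simp [RqFun, genV, prev]
  | r n =>
    simp only [RqFun, genV, map_add, PowerSeries.coeff_succ_X_mul, PowerSeries.coeff_C_mul,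
      PowerSeries.coeff_zero_X_mul, pow_succ, smul_add, mul_neg_one, neg_smul, mul_smul_comm]
    simp

theorem intCast_mul_eq_smul (n : ℤ) (F : Ser) : (n : Ser) * F = (n : ℝ) • F := by
  rw [← map_intCast (algebraMap ℝ Ser), ← Algebra.smul_def]

theorem jacobi_skew (P Q : Gen) : jacobi P Q = -jacobi Q P := by
  funext d; simp [jacobi]

theorem jacobi_Psi_Omega : jacobi Psi Omega = 0 := by
  funext d
  rw [jacobi_apply, evo_Omega isSymmetry_Psi, evo_Psi isSymmetry_Omega]
  cases d <;> simp only [actOmega, actPsi, Psi_u, Psi_q, Psi_m, Psi_r, Omega_u, Omega_q, Omega_m,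
    Omega_r, map_add, map_sub, dX_mul, dZ_mul, dT_mul, dZ_vt, dZ_x, dX_natCast, dZ_natCast,
    dT_natCast, dX_one, dT_one, dZ_two, dZ_three, cXZ, cZT, Pi.zero_apply] <;> ring

theorem jacobi_Psi_Xi (ν : ℤ) : jacobi Psi (Xi (pow (.q 0 0 0) ν)) = 0 := by
  have key := flowX_pow ν ((isDer_evo Psi).hat - isDer_dZ.hat)
  have h0 : ((isDer_evo Psi).hat - isDer_dZ.hat) serQ = 0 := by
    ext1 n; simp [serQ, evo_depX, Psi_q]
  rw [h0, mul_zero] at key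
  funext d
  rw [jacobi_apply, evo_Psi (isSymmetry_Xi ν), Xi_eq]
  cases d with
  | q α => simpa [genQ, actPsi] using congrArg (PowerSeries.coeff α) key
  | _ => simp [genQ, actPsi]

/-- E_Ψ - D_z + d/dε annihilates the generating series of the m_α. The term d/dε is the correction
in the m-components of Ψ. -/
theorem jacobi_Psi_Theta (ν : ℤ) : jacobi Psi (Theta (pow (.m 0 0 0) ν)) = 0 := by
  have key := flowT_pow ν ((isDer_evo Psi).hat - isDer_dZ.hat + dE)
  have h0 : ((isDer_evo Psi).hat - isDer_dZ.hat + dE) serM = 0 := by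
    ext1 n; simp [serM, evo_depX, Psi_m, coeff_dE]; ring
  rw [h0, mul_zero] at key
  funext d
  rw [jacobi_apply, evo_Psi (isSymmetry_Theta ν), Theta_eq]
  cases d with
  | m α =>
    have h := congrArg (PowerSeries.coeff α) key
    simp only [Derivation.sub_apply, Derivation.add_apply, map_sub, map_add, IsDer.coeff_hat,
      coeff_dE, map_zero] at h
    simp only [genM, actPsi, Pi.zero_apply]
    linear_combination h
  | _ => simp [genM, actPsi]

/-- E_Ψ - D_z annihilates Y and sends T to -ε, so the bracket has the series -n ε Y^m T^(n-1).
Applying R^m trades ε for T and returns to the same family, whence the form of the statement. -/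
theorem jacobi_Psi_Upsilon (m n : ℤ) :
    Rm (jacobi Psi (Upsilon (pow .y m * pow .t n))) =
      -((n : ℝ) • Upsilon (pow .y m * pow .t n)) := by
  have key := flowV_pow m n ((isDer_evo Psi).hat - isDer_dZ.hat)
  have hY : ((isDer_evo Psi).hat - isDer_dZ.hat) serY = 0 := by
    ext1 n
    rcases n with _ | _ | _ | n <;>
      simp [serY, coeffY, evo_depX, Psi_u, Psi_r, evo_y, evo_x,
        -PowerSeries.coeff_zero_eq_constantCoeff]
  have hT : ((isDer_evo Psi).hat - isDer_dZ.hat) serT = -PowerSeries.X := by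
    ext1 n
    rcases n with _ | _ | n <;>
      simp [serT, coeffT, evo_z, evo_t, PowerSeries.coeff_X,
        -PowerSeries.coeff_zero_eq_constantCoeff]
  have hJ : jacobi Psi (Upsilon (pow .y m * pow .t n)) =
      genV (((isDer_evo Psi).hat - isDer_dZ.hat) (flowV (pow .y m * pow .t n))) := by
    funext d
    rw [jacobi_apply, evo_Psi (isSymmetry_Upsilon m n), Upsilon_eq]
    cases d <;> simp only [genV, actPsi, smul_sub, Derivation.sub_apply, map_sub, map_smul,
      IsDer.coeff_hat, map_zero, mul_zero, sub_zero]
  rw [hJ, key, hY, hT, Upsilon_eq, mul_zero, zero_add,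
    show (n : Ser) * flowV (pow .y m * pow .t (n - 1)) * -PowerSeries.X =
      PowerSeries.X * -((n : Ser) * flowV (pow .y m * pow .t (n - 1))) by ring, Rm_genV_X_mul,
    ← flowV_t, mul_neg, mul_left_comm, ← map_mul, mul_left_comm, X, pow_mul_pow,
    intCast_mul_eq_smul, ← neg_smul, genV_smul, neg_smul, add_sub_cancel]

theorem jacobi_Omega_Xi (ν : ℤ) : jacobi Omega (Xi (pow (.q 0 0 0) ν)) = 0 := by
  have key := flowX_pow ν ((isDer_evo Omega).hat - PowerSeries.C vt • isDer_dT.hat +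
    PowerSeries.C (X .x) • isDer_dX.hat + (PowerSeries.X : Ser) • dE)
  rw [show ((isDer_evo Omega).hat - PowerSeries.C vt • isDer_dT.hat +
      PowerSeries.C (X .x) • isDer_dX.hat + (PowerSeries.X : Ser) • dE) serQ = 0 by
    ext1 n
    simp only [Derivation.sub_apply, Derivation.add_apply, Derivation.smul_apply, smul_eq_mul,
      map_sub, map_add, IsDer.coeff_hat, coeff_X_smul_dE, PowerSeries.coeff_C_mul, map_zero, serQ,
      PowerSeries.coeff_mk, evo_depX, Omega_q]
    ring, mul_zero] at key
  funext d
  rw [jacobi_apply, evo_Omega (isSymmetry_Xi ν), Xi_eq]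
  cases d with
  | q α =>
    have h := congrArg (PowerSeries.coeff α) key
    simp only [Derivation.sub_apply, Derivation.add_apply, Derivation.smul_apply, smul_eq_mul,
      map_sub, map_add, IsDer.coeff_hat, coeff_X_smul_dE, PowerSeries.coeff_C_mul, map_zero] at h
    simp only [genQ, actOmega, Pi.zero_apply]
    linear_combination h
  | _ => simp [genQ, actOmega]

theorem jacobi_Omega_Theta (ν : ℤ) : jacobi Omega (Theta (pow (.m 0 0 0) ν)) = 0 := by
  have key := flowT_pow ν ((isDer_evo Omega).hat - PowerSeries.C vt • isDer_dT.hat +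
    PowerSeries.C (X .x) • isDer_dX.hat)
  rw [show ((isDer_evo Omega).hat - PowerSeries.C vt • isDer_dT.hat +
      PowerSeries.C (X .x) • isDer_dX.hat) serM = 0 by
    ext1 n
    simp only [Derivation.sub_apply, Derivation.add_apply, Derivation.smul_apply, smul_eq_mul,
      map_sub, map_add, IsDer.coeff_hat, PowerSeries.coeff_C_mul, map_zero, serM,
      PowerSeries.coeff_mk, evo_depX, Omega_m]
    ring, mul_zero] at key
  funext d
  rw [jacobi_apply, evo_Omega (isSymmetry_Theta ν), Theta_eq]
  cases d with
  | m α =>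
    have h := congrArg (PowerSeries.coeff α) key
    simp only [Derivation.sub_apply, Derivation.add_apply, Derivation.smul_apply, smul_eq_mul,
      map_sub, map_add, IsDer.coeff_hat, PowerSeries.coeff_C_mul, map_zero] at h
    simp only [genM, actOmega, Pi.zero_apply]
    linear_combination h
  | _ => simp [genM, actOmega]

/-- E_Ω - t D_t + x D_x - ε d/dε annihilates Y and sends T to -T, which contributes -n. The
remaining -2 is the difference between the scaling weight of a component in Ω and its position in
the series. -/
theorem jacobi_Omega_Upsilon (m n : ℤ) : jacobi Omega (Upsilon (pow .y m * pow .t n)) =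
    ((-n - 2 : ℤ) : ℝ) • Upsilon (pow .y m * pow .t n) := by
  have key := flowV_pow m n ((isDer_evo Omega).hat - PowerSeries.C vt • isDer_dT.hat +
    PowerSeries.C (X .x) • isDer_dX.hat - (PowerSeries.X : Ser) • dE)
  have hY : ((isDer_evo Omega).hat - PowerSeries.C vt • isDer_dT.hat +
      PowerSeries.C (X .x) • isDer_dX.hat - (PowerSeries.X : Ser) • dE) serY = 0 := by
    ext1 n
    simp only [Derivation.sub_apply, Derivation.add_apply, Derivation.smul_apply, smul_eq_mul,
      map_sub, map_add, IsDer.coeff_hat, coeff_X_smul_dE, PowerSeries.coeff_C_mul, map_zero, serY,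
      PowerSeries.coeff_mk]
    rcases n with _ | _ | _ | n <;> simp only [coeffY, map_neg, map_smul, evo_depX, evo_x, evo_y,
      dX_x, dX_y, dT_x, dT_y, Omega_u, Omega_r, mul_smul_comm, smul_add, smul_sub] <;>
      push_cast
    · ring
    · ring
    · ring
    · rw [show ((n : Laurent) + 1 + 1 + 1) = n + 3 by ring]; abel
  have hT : ((isDer_evo Omega).hat - PowerSeries.C vt • isDer_dT.hat +
      PowerSeries.C (X .x) • isDer_dX.hat - (PowerSeries.X : Ser) • dE) serT = -serT := by
    ext1 n
    simp only [Derivation.sub_apply, Derivation.add_apply, Derivation.smul_apply, smul_eq_mul,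
      map_sub, map_add, IsDer.coeff_hat, coeff_X_smul_dE, PowerSeries.coeff_C_mul, map_neg, serT,
      PowerSeries.coeff_mk]
    rcases n with _ | _ | n <;> simp [coeffT, evo_t, evo_z, vt]
  rw [hY, hT, mul_zero, zero_add] at key
  have hn : (n : Ser) * flowV (pow .y m * pow .t (n - 1)) * -serT =
      -(PowerSeries.C (n : Laurent) * flowV (pow .y m * pow .t n)) := by
    rw [← flowV_t, mul_neg, mul_assoc, ← map_mul, mul_assoc, X, pow_mul_pow, sub_add_cancel,
      map_intCast]
  rw [hn] at key
  funext d
  rw [jacobi_apply, evo_Omega (isSymmetry_Upsilon m n), Upsilon_eq]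
  have c (k : ℕ) := congrArg (PowerSeries.coeff k) key
  simp only [Derivation.sub_apply, Derivation.add_apply, Derivation.smul_apply, smul_eq_mul,
      map_sub, map_add, IsDer.coeff_hat, coeff_X_smul_dE, PowerSeries.coeff_C_mul, map_neg] at c
  cases d with
  | u =>
    have h := c 0
    simp only [genV, actOmega, Pi.smul_apply]
    simp only [Algebra.smul_def, map_intCast]
    push_cast at h ⊢
    linear_combination h
  | r k =>
    have h := c (k + 1)
    simp only [genV, actOmega, Pi.smul_apply, map_smul]
    simp only [Algebra.smul_def, map_intCast]
    push_cast at h ⊢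
    linear_combination (-1) ^ k * h
  | _ => simp [genV, actOmega]

theorem evo_Xi_Xi (μ ν : ℤ) (d : Dep) :
    evo (Xi (pow (.q 0 0 0) μ)) (Xi (pow (.q 0 0 0) ν) d) =
      (ν : ℝ) • Xi (pow (.q 0 0 0) (μ + ν - 1)) d := by
  rw [Xi_eq (pow _ ν), evo_genQ, flowX_pow, hat_evo_serQ, Xi_eq, Xi_eq]
  have : (PowerSeries.mk fun α => genQ (flowX (pow (.q 0 0 0) μ)) (.q α)) =
      flowX (pow (.q 0 0 0) μ) := by ext1 n; simp [genQ]
  rw [this, mul_assoc, ← map_mul, pow_mul_pow, intCast_mul_eq_smul, genQ_smul, Pi.smul_apply,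
    show ν - 1 + μ = μ + ν - 1 by ring]

theorem evo_Theta_Theta (μ ν : ℤ) (d : Dep) :
    evo (Theta (pow (.m 0 0 0) μ)) (Theta (pow (.m 0 0 0) ν) d) =
      (ν : ℝ) • Theta (pow (.m 0 0 0) (μ + ν - 1)) d := by
  rw [Theta_eq (pow _ ν), evo_genM, flowT_pow, hat_evo_serM, Theta_eq, Theta_eq]
  have : (PowerSeries.mk fun α => genM (flowT (pow (.m 0 0 0) μ)) (.m α)) =
      flowT (pow (.m 0 0 0) μ) := by ext1 n; simp [genM]
  rw [this, mul_assoc, ← map_mul, pow_mul_pow, intCast_mul_eq_smul, genM_smul, Pi.smul_apply,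
    show ν - 1 + μ = μ + ν - 1 by ring]

theorem jacobi_Xi_Xi (μ ν : ℤ) : jacobi (Xi (pow (.q 0 0 0) μ)) (Xi (pow (.q 0 0 0) ν)) =
    ((ν - μ : ℤ) : ℝ) • Xi (pow (.q 0 0 0) (μ + ν - 1)) := by
  funext d
  rw [jacobi_apply, evo_Xi_Xi, evo_Xi_Xi, add_comm ν μ, ← sub_smul, Pi.smul_apply, Int.cast_sub]

theorem jacobi_Theta_Theta (μ ν : ℤ) :
    jacobi (Theta (pow (.m 0 0 0) μ)) (Theta (pow (.m 0 0 0) ν)) =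
      ((ν - μ : ℤ) : ℝ) • Theta (pow (.m 0 0 0) (μ + ν - 1)) := by
  funext d
  rw [jacobi_apply, evo_Theta_Theta, evo_Theta_Theta, add_comm ν μ, ← sub_smul, Pi.smul_apply,
    Int.cast_sub]

/-- E of the sequence with series F sends Y to -ε² F and T to 0. The factor ε² is absorbed by two
applications of R^m, giving T². -/
theorem evo_Upsilon_Upsilon (k l m n : ℤ) :
    (fun d => evo (Upsilon (pow .y k * pow .t l)) (Upsilon (pow .y m * pow .t n) d)) =
      -((m : ℝ) • genV (PowerSeries.X * (PowerSeries.X *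
        flowV (pow .y (k + m - 1) * pow .t (l + n))))) := by
  funext d
  rw [Upsilon_eq (_ * pow .t n), evo_genV, flowV_pow, hat_evo_serT, Upsilon_eq, hat_evo_genV_serY,
    mul_zero, add_zero]
  have : (m : Ser) * flowV (pow .y (m - 1) * pow .t n) *
      -(PowerSeries.X * (PowerSeries.X * flowV (pow .y k * pow .t l))) =
      (m : Ser) * -(PowerSeries.X * (PowerSeries.X *
        (flowV (pow .y k * pow .t l * (pow .y (m - 1) * pow .t n))))) := by
    rw [map_mul flowV (pow .y k * pow .t l)]; ring
  rw [this, mul_mul_mul_comm, pow_mul_pow, pow_mul_pow, intCast_mul_eq_smul, genV_smul,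
    add_sub_assoc, ← zero_sub, genV_sub, genV_zero, zero_sub, smul_neg]

theorem jacobi_Upsilon_Upsilon (k l m n : ℤ) :
    Rm (Rm (jacobi (Upsilon (pow .y k * pow .t l)) (Upsilon (pow .y m * pow .t n)))) =
      ((k - m : ℤ) : ℝ) • Upsilon (pow .y (k + m - 1) * pow .t (l + n + 2)) := by
  have : jacobi (Upsilon (pow .y k * pow .t l)) (Upsilon (pow .y m * pow .t n)) =
      (fun d => evo (Upsilon (pow .y k * pow .t l)) (Upsilon (pow .y m * pow .t n) d)) -
      (fun d => evo (Upsilon (pow .y m * pow .t n)) (Upsilon (pow .y k * pow .t l) d)) := rfl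
  rw [this, evo_Upsilon_Upsilon, evo_Upsilon_Upsilon, add_comm m k, add_comm n l, Int.cast_sub,
    sub_smul, sub_neg_eq_add, neg_add_eq_sub, ← sub_smul, map_smul, map_smul, Rm_genV_X_mul,
    mul_left_comm, Rm_genV_X_mul, ← sub_smul, Upsilon_eq, ← flowV_t, ← map_mul, ← map_mul]
  congr 3
  have h : pow .t (l + n + 2) = X .t * X .t * pow .t (l + n) := by
    rw [X, pow_mul_pow, pow_mul_pow, show l + n + 2 = 1 + 1 + (l + n) by ring]
  rw [h]
  ring

/-- The two seeds have nonzero components for disjoint sets of dependent variables, and each one's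
coefficients contain only its own set. -/
theorem jacobi_Xi_Upsilon (ν m n : ℤ) :
    jacobi (Xi (pow (.q 0 0 0) ν)) (Upsilon (pow .y m * pow .t n)) = 0 := by
  funext d
  rw [jacobi_apply, Upsilon_eq, evo_genV, Xi_eq, evo_genQ, flowV_pow, flowX_pow, hat_evo_serT,
    hat_evo_serY_eq_zero rfl fun _ => rfl, hat_evo_serQ_eq_zero fun _ => rfl]
  simp

theorem jacobi_Xi_Theta (μ ν : ℤ) :
    jacobi (Xi (pow (.q 0 0 0) μ)) (Theta (pow (.m 0 0 0) ν)) = 0 := by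
  funext d
  rw [jacobi_apply, Theta_eq, evo_genM, Xi_eq, evo_genQ, flowT_pow, flowX_pow, 
    hat_evo_serM_eq_zero fun _ => rfl, hat_evo_serQ_eq_zero fun _ => rfl]
  simp

theorem jacobi_Upsilon_Theta (m n ν : ℤ) :
    jacobi (Upsilon (pow .y m * pow .t n)) (Theta (pow (.m 0 0 0) ν)) = 0 := by
  funext d
  rw [jacobi_apply, Upsilon_eq, evo_genV, Theta_eq, evo_genM, flowV_pow, flowT_pow, hat_evo_serT,
    hat_evo_serY_eq_zero rfl fun _ => rfl, hat_evo_serM_eq_zero fun _ => rfl]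
  simp

/-! ### The group generated by the recursion operators -/

theorem Rq_mul (f : Laurent) (P : Gen) (d : Dep) : Rq (fun e => f * P e) d = f * Rq P d := by
  simp only [Rq_apply]
  cases d with
  | u => simp only [RqFun]; ring
  | q α => cases α <;> simp only [RqFun, prev] <;> ring
  | m α => cases α <;> simp only [RqFun, prev] <;> ring
  | r n => simp only [RqFun]; ring

theorem Rm_mul (f : Laurent) (P : Gen) (d : Dep) : Rm (fun e => f * P e) d = f * Rm P d := by
  rw [Rm_apply, Rq_mul, Rm_apply]; ring

theorem commute_Rq_Rm : Commute Rq Rm := by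
  refine LinearEquiv.ext fun P => funext fun d => ?_
  have h : Rm P = (fun e => vt * Rq P e) + fun e => vz * P e := rfl
  rw [LinearEquiv.mul_apply, LinearEquiv.mul_apply, h, map_add, Pi.add_apply, Rq_mul, Rq_mul,
    Rm_apply]

/-- The coefficients of the components of `P.u` in the total `x`-derivative of `R^q(P)`. -/
def dXcoeff : Gen
  | .u => dX ux
  | .q α => dX (qx α)
  | .m α => dX (mx α)
  | .r n => dX (rx (n + 1))

/-! ### Nijenhuis concomitants of the recursion operators -/

theorem dX_Rq (P : Gen) (d : Dep) :
    dX (Rq P d) = P .u * dXcoeff d + Rq (fun e => dX (P e)) d := by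
  rw [Rq_apply, Rq_apply]
  cases d with
  | u => simp only [RqFun, dXcoeff, map_add, dX_mul]; ring
  | q α => cases α <;> simp only [RqFun, prev, dXcoeff, map_add, dX_mul, map_zero] <;> ring
  | m α =>
    cases α <;> simp only [RqFun, prev, dXcoeff, map_sub, dX_mul, map_zero, dX_ti, dX_vz] <;> ring
  | r n => simp only [RqFun, dXcoeff, map_sub, dX_mul]; ring

theorem lieD_Rq' {P : Gen} (hP : IsSymmetry P) (Q : Gen) : lieD P Rq Q =
    (fun d => Q .u * dX (P d)) - (fun d => evo (Rq Q) (P d)) + Rq (fun d => evo Q (P d)) :=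
  funext fun d => lieD_Rq hP Q d

/-- Expanding with `evo_Rq` and `dX_Rq` produces one term in the product of the u-components of P
and Q, symmetric and so cancelling, and terms in the u-component of P times D_x Q, which cancel in
pairs. -/
theorem lieD_Rq_Rq {P Q : Gen} (hP : IsSymmetry P) (hQ : IsSymmetry Q) :
    lieD (Rq P) Rq Q = Rq (lieD P Rq Q) := by
  have h1 : (fun d => evo Q (Rq P d)) =
      (fun d => P .u * dX (Q d)) + Rq (fun d => evo Q (P d)) := funext fun d => evo_Rq hQ P d
  have h2 : (fun d => evo (Rq Q) (Rq P d)) =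
      (fun d => P .u * dX (Rq Q d)) + Rq (fun d => evo (Rq Q) (P d)) :=
    funext fun d => evo_Rq (isSymmetry_Rq hQ) P d
  rw [lieD_Rq' (isSymmetry_Rq hP), lieD_Rq' hP, h1, h2]
  simp only [map_add, map_sub]
  funext d
  simp only [Pi.add_apply, Pi.sub_apply, dX_Rq, Rq_mul]
  ring

theorem lieD_Rm_Rq {P Q : Gen} (hP : IsSymmetry P) (hQ : IsSymmetry Q) :
    lieD (Rm P) Rq Q = Rm (lieD P Rq Q) := by
  funext d
  rw [Rm_apply, ← lieD_Rq_Rq hP hQ, lieD_Rq (isSymmetry_Rm hP), lieD_Rq (isSymmetry_Rq hP),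
    lieD_Rq hP]
  have h : (fun e => evo Q (Rm P e)) =
      (fun e => vt * evo Q (Rq P e)) + fun e => vz * evo Q (P e) := by
    funext e; simp only [Rm_apply, map_add, evo_mul, evo_vt, evo_vz, Pi.add_apply]; ring
  simp only [← Rq_apply]
  rw [h, map_add, Pi.add_apply, Rq_mul, Rq_mul, Rm_apply]
  simp only [map_add, evo_mul, dX_mul, evo_vt, evo_vz, dX_vt, dX_vz]
  ring

/-- The deviation of `P ↦ evo Q (P d)` from linearity of `Q` over functions of `z` and `t`. -/
def evoDefect (Q P : Gen) : Gen := fun d =>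
  vt * evo (Rq Q) (P d) + vz * evo Q (P d) - evo (Rm Q) (P d)

theorem lieD_Rm' (P Q : Gen) : lieD P Rm Q = (fun d => vt * lieD P Rq Q d) + evoDefect Q P := by
  funext d; rw [lieD_Rm, Pi.add_apply, evoDefect]; ring

/-- By `evo_Rq`, the terms outside R^q carry D_x of t R^q(Q) + z Q - R^m(Q), which vanishes because
t and z do not depend on x. -/
theorem evoDefect_Rq {Q : Gen} (hQ : IsSymmetry Q) (P : Gen) :
    evoDefect Q (Rq P) = Rq (evoDefect Q P) := by
  have h : evoDefect Q P = (fun d => vt * evo (Rq Q) (P d)) + (fun d => vz * evo Q (P d)) -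
    fun d => evo (Rm Q) (P d) := rfl
  rw [h, map_sub, map_add]
  funext d
  rw [Pi.sub_apply, Pi.add_apply, Rq_mul, Rq_mul, evoDefect, evo_Rq hQ, evo_Rq (isSymmetry_Rq hQ),
    evo_Rq (isSymmetry_Rm hQ), Rm_apply, map_add, dX_mul, dX_mul, dX_vt, dX_vz]
  ring

theorem evoDefect_Rm {Q : Gen} (hQ : IsSymmetry Q) (P : Gen) :
    evoDefect Q (Rm P) = Rm (evoDefect Q P) := by
  funext d
  rw [Rm_apply, ← evoDefect_Rq hQ]
  simp only [evoDefect, Rm_apply, map_add, evo_mul, evo_vt, evo_vz]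
  ring

theorem lieD_Rq_Rm {P Q : Gen} (hP : IsSymmetry P) (hQ : IsSymmetry Q) :
    lieD (Rq P) Rm Q = Rq (lieD P Rm Q) := by
  rw [lieD_Rm', lieD_Rm', lieD_Rq_Rq hP hQ, evoDefect_Rq hQ, map_add]
  congr 1
  funext d
  rw [Rq_mul]

theorem lieD_Rm_Rm {P Q : Gen} (hP : IsSymmetry P) (hQ : IsSymmetry Q) :
    lieD (Rm P) Rm Q = Rm (lieD P Rm Q) := by
  rw [lieD_Rm', lieD_Rm', lieD_Rm_Rq hP hQ, evoDefect_Rm hQ, map_add]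
  congr 1
  funext d
  rw [Rm_mul]

/-! ### Lie derivatives on the group generated by the recursion operators -/

theorem lieD_mul (P : Gen) (A B : Gen ≃ₗ[ℝ] Gen) (Q : Gen) :
    lieD P (A * B) Q = lieD P A (B Q) + A (lieD P B Q) := by
  simp only [lieD, LinearEquiv.mul_apply, map_sub]; abel

theorem lieD_one (P Q : Gen) : lieD P 1 Q = 0 := by
  simp [lieD]

theorem lieD_inv (P : Gen) (A : Gen ≃ₗ[ℝ] Gen) (Q : Gen) :
    lieD P A⁻¹ Q = -A⁻¹ (lieD P A (A⁻¹ Q)) := by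
  have h := lieD_mul P A A⁻¹ Q
  rw [mul_inv_cancel, lieD_one] at h
  have h2 := congrArg (A⁻¹ : Gen ≃ₗ[ℝ] Gen) h
  rw [map_zero, map_add, ← LinearEquiv.mul_apply A⁻¹ A, inv_mul_cancel, LinearEquiv.coe_one,
    id] at h2
  exact (neg_eq_of_add_eq_zero_right h2.symm).symm

/-- The automorphisms that preserve symmetries. -/
def symGroup : Subgroup (Gen ≃ₗ[ℝ] Gen) where
  carrier := {A | ∀ P, IsSymmetry (A P) ↔ IsSymmetry P}
  one_mem' _ := Iff.rfl
  mul_mem' {A B} hA hB P := (hA (B P)).trans (hB P)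
  inv_mem' {A} hA P := by
    rw [← hA (A⁻¹ P), ← LinearEquiv.mul_apply A A⁻¹, mul_inv_cancel]; rfl

theorem Rq_mem_symGroup : Rq ∈ symGroup := fun _ => ⟨isSymmetry_of_Rq, isSymmetry_Rq⟩
theorem Rm_mem_symGroup : Rm ∈ symGroup := fun _ => ⟨isSymmetry_of_Rm, isSymmetry_Rm⟩

/-- The automorphisms `A` for which the Nijenhuis concomitant with `B` vanishes. -/
def nijLeft (B : Gen ≃ₗ[ℝ] Gen) : Subgroup (Gen ≃ₗ[ℝ] Gen) where
  carrier := {A | A ∈ symGroup ∧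
    ∀ P Q, IsSymmetry P → IsSymmetry Q → lieD (A P) B Q = A (lieD P B Q)}
  one_mem' := ⟨one_mem _, fun _ _ _ _ => rfl⟩
  mul_mem' {A₁ A₂} h₁ h₂ := ⟨mul_mem h₁.1 h₂.1, fun P Q hP hQ => by
    rw [LinearEquiv.mul_apply, h₁.2 _ _ ((h₂.1 P).2 hP) hQ, h₂.2 P Q hP hQ]; rfl⟩
  inv_mem' {A} h := ⟨inv_mem h.1, fun P Q hP hQ => by
    have e (S : Gen) : A (A⁻¹ S) = S := by
      rw [← LinearEquiv.mul_apply, mul_inv_cancel]; rfl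
    apply A.injective
    rw [← h.2 _ _ ((inv_mem h.1 P).2 hP) hQ, e, e]⟩

/-- The automorphisms `B` that commute with `A` and for which the Nijenhuis concomitant with `A`
vanishes. -/
def nijRight (A : Gen ≃ₗ[ℝ] Gen) : Subgroup (Gen ≃ₗ[ℝ] Gen) where
  carrier := {B | B ∈ symGroup ∧ Commute A B ∧
    ∀ P Q, IsSymmetry P → IsSymmetry Q → lieD (A P) B Q = A (lieD P B Q)}
  one_mem' := ⟨one_mem _, Commute.one_right _, fun _ _ _ _ => by simp [lieD_one]⟩
  mul_mem' {B₁ B₂} h₁ h₂ := ⟨mul_mem h₁.1 h₂.1, h₁.2.1.mul_right h₂.2.1, fun P Q hP hQ => by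
    rw [lieD_mul, lieD_mul, h₁.2.2 _ _ hP ((h₂.1 Q).2 hQ), h₂.2.2 P Q hP hQ, map_add,
      ← LinearEquiv.mul_apply B₁ A, ← h₁.2.1.eq]; rfl⟩
  inv_mem' {B} h := ⟨inv_mem h.1, h.2.1.inv_right, fun P Q hP hQ => by
    rw [lieD_inv, lieD_inv, h.2.2 _ _ hP ((inv_mem h.1 Q).2 hQ), map_neg,
      ← LinearEquiv.mul_apply B⁻¹ A, ← h.2.1.inv_right.eq]; rfl⟩

theorem R_mem {H : Subgroup (Gen ≃ₗ[ℝ] Gen)} (hq : Rq ∈ H) (hm : Rm ∈ H) (i j : ℤ) : R i j ∈ H :=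
  mul_mem (zpow_mem (inv_mem hq) i) (zpow_mem hm j)

theorem commute_R (i j : ℤ) {A : Gen ≃ₗ[ℝ] Gen} (hq : Commute A Rq) (hm : Commute A Rm) :
    Commute A (R i j) :=
  ((hq.inv_right).zpow_right i).mul_right (hm.zpow_right j)

/-- Extension from generators to the group in two rounds: for a generator in the second slot the
admissible first slots form a subgroup, and then, with R_i^j fixed in the first slot, so do the
admissible second slots. -/
theorem lieD_R_R (i j k l : ℤ) {P Q : Gen} (hP : IsSymmetry P) (hQ : IsSymmetry Q) :
    lieD (R i j P) (R k l) Q = R i j (lieD P (R k l) Q) := by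
  have h : R k l ∈ nijRight (R i j) := R_mem (H := nijRight (R i j))
    ⟨Rq_mem_symGroup, (commute_R i j (Commute.refl _) commute_Rq_Rm).symm,
      (R_mem (H := nijLeft Rq) ⟨Rq_mem_symGroup, fun _ _ => lieD_Rq_Rq⟩
        ⟨Rm_mem_symGroup, fun _ _ => lieD_Rm_Rq⟩ i j).2⟩
    ⟨Rm_mem_symGroup, (commute_R i j commute_Rq_Rm.symm (Commute.refl _)).symm,
      (R_mem (H := nijLeft Rm) ⟨Rq_mem_symGroup, fun _ _ => lieD_Rq_Rm⟩
        ⟨Rm_mem_symGroup, fun _ _ => lieD_Rm_Rm⟩ i j).2⟩ k l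
  exact h.2.2 P Q hP hQ

theorem R_mul_R (i j k l : ℤ) : R i j * R k l = R (i + k) (j + l) := by
  rw [R, R, R, zpow_add, zpow_add, mul_assoc, mul_assoc,
    ← mul_assoc (Rm ^ j) (Rq⁻¹ ^ k), ((commute_Rq_Rm.inv_left.zpow_left k).zpow_right j).symm.eq,
    mul_assoc]

theorem R_zero_zero : R 0 0 = 1 := by simp [R]

theorem R_apply_R (i j k l : ℤ) (P : Gen) : R i j (R k l P) = R (i + k) (j + l) P := by
  rw [← R_mul_R]; rfl

theorem isSymmetry_R (i j : ℤ) {P : Gen} (hP : IsSymmetry P) : IsSymmetry (R i j P) :=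
  (R_mem Rq_mem_symGroup Rm_mem_symGroup i j P).2 hP

/-- Moving R_k^l out of the bracket costs its Lie derivative along R_i^j(P), which is R_i^j of the
one along P. Skew-symmetry then allows R_i^j to be moved out in the same way. -/
theorem jacobi_R_R (i j k l : ℤ) {P Q : Gen} (hP : IsSymmetry P) (hQ : IsSymmetry Q) :
    jacobi (R i j P) (R k l Q) = R (i + k) (j + l) (jacobi P Q) +
      R i j (lieD P (R k l) Q) - R k l (lieD Q (R i j) P) := by
  have h := lieD_R_R i j k l hP hQ
  rw [← h, lieD, lieD, jacobi_skew _ (R i j P), jacobi_skew Q P, map_neg, map_sub, map_neg, map_neg,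
    R_apply_R, add_comm k i, add_comm l j]
  abel

/-- The factor K allows for a Lie derivative that is not a multiple of A itself: along Ψ, R^m goes
to -id = -R^m K with K the inverse of R^m. -/
theorem lieD_zpow {P : Gen} {A K : Gen ≃ₗ[ℝ] Gen} (hA : A ∈ symGroup) (hK : Commute A K) (c : ℝ)
    (h : ∀ Q, IsSymmetry Q → lieD P A Q = c • A (K Q)) (n : ℤ) :
    ∀ Q, IsSymmetry Q → lieD P (A ^ n) Q = ((n : ℝ) * c) • (A ^ n) (K Q) := by
  have hK' (Q : Gen) : K (A Q) = A (K Q) := by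
    rw [← LinearEquiv.mul_apply, ← LinearEquiv.mul_apply, hK.eq]
  have e (n : ℤ) (Q : Gen) : (A ^ (n + 1)) Q = (A ^ n) (A Q) := by rw [zpow_add_one]; rfl
  induction n using Int.induction_on with
  | zero => intro Q _; rw [zpow_zero, lieD_one]; simp
  | succ n ih =>
    intro Q hQ
    rw [zpow_add_one, lieD_mul, ih _ ((hA Q).2 hQ), h Q hQ, hK', map_smul, ← add_smul]
    push_cast
    rw [add_mul, one_mul]; rfl
  | pred n ih =>
    intro Q hQ
    have hQ' := (inv_mem hA Q).2 hQ
    have h1 := ih _ hQ'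
    have e1 : A ^ (-(n : ℤ)) = A ^ (-(n : ℤ) - 1) * A := by rw [← zpow_add_one, sub_add_cancel]
    have e2 : A (A⁻¹ Q) = Q := by rw [← LinearEquiv.mul_apply, mul_inv_cancel]; rfl
    rw [e1, lieD_mul, h _ hQ', e2, LinearEquiv.mul_apply, ← hK', e2, map_smul] at h1
    rw [eq_sub_of_add_eq h1, ← sub_smul]
    push_cast
    congr 1; ring

/-! ### The bracket table -/

theorem isSymmetry_seed (s : Seed) : IsSymmetry (seed s) := by
  cases s with
  | Ω => exact isSymmetry_Omega
  | Ψ => exact isSymmetry_Psi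
  | Ξ ν => exact isSymmetry_Xi ν
  | Υ ν => exact isSymmetry_Upsilon _ _
  | Θ ν => exact isSymmetry_Theta ν

theorem isSymmetry_hier (s : Seed) (i j : ℤ) : IsSymmetry (hier s i j) :=
  isSymmetry_R i j (isSymmetry_seed s)

/-- The sign in front of i arises because R_i^j contains R^q to the power -i. -/
theorem lieD_R (P : Gen) {K₁ K₂ : Gen ≃ₗ[ℝ] Gen} (h₁ : Commute Rq K₁) (h₂ : Commute Rm K₂)
    (c₁ c₂ : ℝ) (hq : ∀ Q, IsSymmetry Q → lieD P Rq Q = c₁ • Rq (K₁ Q))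
    (hm : ∀ Q, IsSymmetry Q → lieD P Rm Q = c₂ • Rm (K₂ Q)) (i j : ℤ) {Q : Gen}
    (hQ : IsSymmetry Q) : lieD P (R i j) Q =
      (-i * c₁ : ℝ) • (Rq⁻¹ ^ i) (K₁ ((Rm ^ j) Q)) + (j * c₂ : ℝ) • R i j (K₂ Q) := by
  have e : Rq⁻¹ ^ i = Rq ^ (-i) := by rw [inv_zpow, zpow_neg]
  rw [R, lieD_mul, e, lieD_zpow Rq_mem_symGroup h₁ c₁ hq _ _ ((zpow_mem Rm_mem_symGroup j Q).2 hQ),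
    lieD_zpow Rm_mem_symGroup h₂ c₂ hm _ _ hQ, map_smul]
  push_cast
  rfl

theorem lieD_Omega_R (i j : ℤ) {Q : Gen} (hQ : IsSymmetry Q) :
    lieD (seed .Ω) (R i j) Q = -(i : ℝ) • R i j Q := by
  rw [seed, lieD_R Omega (K₁ := 1) (K₂ := 1) (Commute.one_right _) (Commute.one_right _) 1 0
    (fun Q hQ => by rw [lieD_Rq_Omega hQ]; simp) (fun Q hQ => by rw [lieD_Rm_Omega hQ]; simp) i j hQ]
  simp [R]

theorem lieD_Psi_R (i j : ℤ) {Q : Gen} (hQ : IsSymmetry Q) :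
    lieD (seed .Ψ) (R i j) Q = -(j : ℝ) • R i (j - 1) Q := by
  rw [seed, lieD_R Psi (K₁ := 1) (K₂ := Rm⁻¹) (Commute.one_right _) (Commute.refl Rm).inv_right 0 (-1)
    (fun Q hQ => by rw [lieD_Rq_Psi hQ]; simp) (fun Q hQ => by
      rw [lieD_Rm_Psi hQ, ← LinearEquiv.mul_apply, mul_inv_cancel]; simp) i j hQ,
    R, R, zpow_sub_one, ← mul_assoc]
  simp

theorem lieD_R_eq_zero (P : Gen) (hq : ∀ Q, lieD P Rq Q = 0) (hm : ∀ Q, lieD P Rm Q = 0)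
    (i j : ℤ) {Q : Gen} (hQ : IsSymmetry Q) : lieD P (R i j) Q = 0 := by
  rw [lieD_R P (K₁ := 1) (K₂ := 1) (Commute.one_right _) (Commute.one_right _) 0 0
    (fun Q _ => by rw [hq]; simp) (fun Q _ => by rw [hm]; simp) i j hQ]
  simp

theorem lieD_Xi_R (ν i j : ℤ) {Q : Gen} (hQ : IsSymmetry Q) :
    lieD (seed (.Ξ ν)) (R i j) Q = 0 :=
  lieD_R_eq_zero _ (lieD_Rq_Xi ν) (lieD_Rm_Xi ν) i j hQ

theorem lieD_Theta_R (ν i j : ℤ) {Q : Gen} (hQ : IsSymmetry Q) :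
    lieD (seed (.Θ ν)) (R i j) Q = 0 :=
  lieD_R_eq_zero _ (lieD_Rq_Theta ν) (lieD_Rm_Theta ν) i j hQ

theorem lieD_Upsilon_R (ν i j : ℤ) {Q : Gen} (hQ : IsSymmetry Q) :
    lieD (seed (.Υ ν)) (R i j) Q = 0 :=
  lieD_R_eq_zero _ (lieD_Rq_Upsilon _ _) (lieD_Rm_Upsilon _ _) i j hQ

theorem jacobi_hier (s s' : Seed) (i k j l : ℤ) : jacobi (hier s i k) (hier s' j l) =
    R (i + j) (k + l) (jacobi (seed s) (seed s')) + R i k (lieD (seed s) (R j l) (seed s')) -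
      R j l (lieD (seed s') (R i k) (seed s)) :=
  jacobi_R_R i k j l (isSymmetry_seed s) (isSymmetry_seed s')

theorem Rm_eq_R : Rm = R 0 1 := by simp [R]

theorem eq_R_of_Rm {P Q : Gen} (h : Rm P = Q) : P = R 0 (-1) Q := by
  rw [← h, Rm_eq_R, R_apply_R]; simp [R_zero_zero]

theorem jacobi_Psi_Psi (i k j l : ℤ) : jacobi (hier .Ψ i k) (hier .Ψ j l) =
    ((k - l : ℤ) : ℝ) • hier .Ψ (i + j) (k + l - 1) := by
  rw [jacobi_hier]
  have h0 : jacobi (seed .Ψ) (seed .Ψ) = 0 := funext fun d => sub_self _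
  have h := isSymmetry_seed .Ψ
  rw [h0, map_zero, lieD_Psi_R j l h, lieD_Psi_R i k h, map_smul, map_smul, R_apply_R, R_apply_R,
    zero_add, add_comm j i, show l + (k - 1) = k + l - 1 by ring,
    show k + (l - 1) = k + l - 1 by ring, ← sub_smul, hier]
  push_cast
  congr 1; ring

theorem jacobi_Psi_Omega_hier (i k j l : ℤ) : jacobi (hier .Ψ i k) (hier .Ω j l) =
    (i : ℝ) • hier .Ψ (i + j) (k + l) - (l : ℝ) • hier .Ω (i + j) (k + l - 1) := by
  rw [jacobi_hier]
  have h0 : jacobi (seed .Ψ) (seed .Ω) = 0 := jacobi_Psi_Omega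
  rw [h0, map_zero, lieD_Psi_R j l (isSymmetry_seed .Ω), lieD_Omega_R i k (isSymmetry_seed .Ψ),
    map_smul, map_smul, R_apply_R, R_apply_R, zero_add, add_comm j i, add_comm l k,
    show k + (l - 1) = k + l - 1 by ring, hier, hier]
  module

theorem jacobi_Omega_Omega (i k j l : ℤ) : jacobi (hier .Ω i k) (hier .Ω j l) =
    ((i - j : ℤ) : ℝ) • hier .Ω (i + j) (k + l) := by
  rw [jacobi_hier]
  have h0 : jacobi (seed .Ω) (seed .Ω) = 0 := funext fun d => sub_self _
  have h := isSymmetry_seed .Ω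
  rw [h0, map_zero, lieD_Omega_R j l h, lieD_Omega_R i k h, map_smul, map_smul, R_apply_R,
    R_apply_R, zero_add, add_comm j i, add_comm l k, hier]
  push_cast
  module

/-- Common form for s in the families `Ξ`, `Υ`, `Θ`: the constant c comes from the bracket of seeds,
and -l from the action of Ψ on (R^m)^l. -/
theorem jacobi_Psi_hier (s : Seed) (c : ℝ) (h0 : jacobi (seed .Ψ) (seed s) = c • R 0 (-1) (seed s))
    (hs : ∀ i j : ℤ, lieD (seed s) (R i j) (seed .Ψ) = 0) (i k j l : ℤ) :
    jacobi (hier .Ψ i k) (hier s j l) = (c - l) • hier s (i + j) (k + l - 1) := by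
  rw [jacobi_hier]
  rw [h0, map_smul, hs, map_zero, lieD_Psi_R j l (isSymmetry_seed s), map_smul, R_apply_R,
    R_apply_R, add_zero, show k + (l - 1) = k + l - 1 by ring, hier, ← sub_eq_add_neg]
  module

theorem jacobi_Omega_hier (s : Seed) (c : ℝ) (h0 : jacobi (seed .Ω) (seed s) = c • seed s)
    (hs : ∀ i j : ℤ, lieD (seed s) (R i j) (seed .Ω) = 0) (i k j l : ℤ) :
    jacobi (hier .Ω i k) (hier s j l) = (c - j) • hier s (i + j) (k + l) := by
  rw [jacobi_hier]
  rw [h0, map_smul, hs, map_zero, lieD_Omega_R j l (isSymmetry_seed s), map_smul, R_apply_R, hier]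
  module

theorem jacobi_hier_of_lieD (s s' : Seed) (hs : ∀ i j : ℤ, lieD (seed s) (R i j) (seed s') = 0)
    (hs' : ∀ i j : ℤ, lieD (seed s') (R i j) (seed s) = 0) (i k j l : ℤ) :
    jacobi (hier s i k) (hier s' j l) = R (i + j) (k + l) (jacobi (seed s) (seed s')) := by
  rw [jacobi_hier, hs, hs']; simp

theorem jacobi_Psi_Xi_hier (ν i k j l : ℤ) : jacobi (hier .Ψ i k) (hier (.Ξ ν) j l) =
    -((l : ℝ) • hier (.Ξ ν) (i + j) (k + l - 1)) := by
  rw [jacobi_Psi_hier _ 0 (by rw [zero_smul]; exact jacobi_Psi_Xi ν)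
    fun i j => lieD_Xi_R ν i j isSymmetry_Psi]
  module

theorem jacobi_Psi_Theta_hier (ν i k j l : ℤ) : jacobi (hier .Ψ i k) (hier (.Θ ν) j l) =
    -((l : ℝ) • hier (.Θ ν) (i + j) (k + l - 1)) := by
  rw [jacobi_Psi_hier _ 0 (by rw [zero_smul]; exact jacobi_Psi_Theta ν)
    fun i j => lieD_Theta_R ν i j isSymmetry_Psi]
  module

theorem jacobi_Psi_Upsilon_hier (ν i k j l : ℤ) : jacobi (hier .Ψ i k) (hier (.Υ ν) j l) =
    -(((l - 2 * ν : ℤ) : ℝ) • hier (.Υ ν) (i + j) (k + l - 1)) := by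
  -- The constant is minus the exponent of t in (y/t²)^ν.
  rw [jacobi_Psi_hier _ (2 * ν) (by
    rw [seed, seed, eq_R_of_Rm (jacobi_Psi_Upsilon ν (-2 * ν)), ← neg_smul, map_smul]
    push_cast; congr 1; ring) fun i j => lieD_Upsilon_R ν i j isSymmetry_Psi]
  push_cast
  module

theorem jacobi_Omega_Xi_hier (ν i k j l : ℤ) : jacobi (hier .Ω i k) (hier (.Ξ ν) j l) =
    -((j : ℝ) • hier (.Ξ ν) (i + j) (k + l)) := by
  rw [jacobi_Omega_hier _ 0 (by rw [zero_smul]; exact jacobi_Omega_Xi ν)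
    fun i j => lieD_Xi_R ν i j isSymmetry_Omega]
  module

theorem jacobi_Omega_Theta_hier (ν i k j l : ℤ) : jacobi (hier .Ω i k) (hier (.Θ ν) j l) =
    -((j : ℝ) • hier (.Θ ν) (i + j) (k + l)) := by
  rw [jacobi_Omega_hier _ 0 (by rw [zero_smul]; exact jacobi_Omega_Theta ν)
    fun i j => lieD_Theta_R ν i j isSymmetry_Omega]
  module

theorem jacobi_Omega_Upsilon_hier (ν i k j l : ℤ) : jacobi (hier .Ω i k) (hier (.Υ ν) j l) =
    -(((j + 2 - 2 * ν : ℤ) : ℝ) • hier (.Υ ν) (i + j) (k + l)) := by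
  rw [jacobi_Omega_hier _ (2 * ν - 2) (by
    rw [seed, seed, jacobi_Omega_Upsilon]
    push_cast; congr 1; ring) fun i j => lieD_Upsilon_R ν i j isSymmetry_Omega]
  push_cast
  module

theorem jacobi_Xi_Xi_hier (μ ν i k j l : ℤ) : jacobi (hier (.Ξ μ) i k) (hier (.Ξ ν) j l) =
    ((ν - μ : ℤ) : ℝ) • hier (.Ξ (μ + ν - 1)) (i + j) (k + l) := by
  rw [jacobi_hier_of_lieD _ _ (fun i j => lieD_Xi_R μ i j (isSymmetry_seed _))
    fun i j => lieD_Xi_R ν i j (isSymmetry_seed _), seed, seed, jacobi_Xi_Xi, map_smul]; rfl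

theorem jacobi_Theta_Theta_hier (μ ν i k j l : ℤ) :
    jacobi (hier (.Θ μ) i k) (hier (.Θ ν) j l) =
      ((ν - μ : ℤ) : ℝ) • hier (.Θ (μ + ν - 1)) (i + j) (k + l) := by
  rw [jacobi_hier_of_lieD _ _ (fun i j => lieD_Theta_R μ i j (isSymmetry_seed _))
    fun i j => lieD_Theta_R ν i j (isSymmetry_seed _), seed, seed, jacobi_Theta_Theta, map_smul]; rfl

theorem jacobi_Upsilon_Upsilon_hier (μ ν i k j l : ℤ) :
    jacobi (hier (.Υ μ) i k) (hier (.Υ ν) j l) =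
      ((μ - ν : ℤ) : ℝ) • hier (.Υ (μ + ν - 1)) (i + j) (k + l - 2) := by
  rw [jacobi_hier_of_lieD _ _ (fun i j => lieD_Upsilon_R μ i j (isSymmetry_seed _))
    fun i j => lieD_Upsilon_R ν i j (isSymmetry_seed _), seed, seed,
    eq_R_of_Rm (eq_R_of_Rm (jacobi_Upsilon_Upsilon μ (-2 * μ) ν (-2 * ν))), map_smul, map_smul,
    map_smul, R_apply_R, R_apply_R, hier, seed]
  congr 3 <;> ring_nf

theorem jacobi_Xi_Upsilon_hier (μ ν i k j l : ℤ) :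
    jacobi (hier (.Ξ μ) i k) (hier (.Υ ν) j l) = 0 := by
  rw [jacobi_hier_of_lieD _ _ (fun i j => lieD_Xi_R μ i j (isSymmetry_seed _))
    fun i j => lieD_Upsilon_R ν i j (isSymmetry_seed _), seed, seed, jacobi_Xi_Upsilon, map_zero]

theorem jacobi_Xi_Theta_hier (μ ν i k j l : ℤ) :
    jacobi (hier (.Ξ μ) i k) (hier (.Θ ν) j l) = 0 := by
  rw [jacobi_hier_of_lieD _ _ (fun i j => lieD_Xi_R μ i j (isSymmetry_seed _))
    fun i j => lieD_Theta_R ν i j (isSymmetry_seed _), seed, seed, jacobi_Xi_Theta, map_zero]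

theorem jacobi_Upsilon_Theta_hier (μ ν i k j l : ℤ) :
    jacobi (hier (.Υ μ) i k) (hier (.Θ ν) j l) = 0 := by
  rw [jacobi_hier_of_lieD _ _ (fun i j => lieD_Upsilon_R μ i j (isSymmetry_seed _))
    fun i j => lieD_Theta_R ν i j (isSymmetry_seed _), seed, seed, jacobi_Upsilon_Theta, map_zero]

/-! ### Linear independence of the hierarchies -/

/-- Eigenvectors are linearly independent if those with the same eigenvalue are. -/
theorem linearIndepOn_of_eigenvalues {K M ι : Type*} [Field K] [AddCommGroup M] [Module K M]
    (f : Module.End K M) {v : ι → M} {c : ι → K} (hf : ∀ i, f (v i) = c i • v i) {s : Set ι}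
    (h : ∀ a, LinearIndepOn K v {i | i ∈ s ∧ c i = a}) : LinearIndepOn K v s := by
  classical
  rw [linearIndepOn_iff]
  intro l hl h0
  have hind := (iSupIndep_iff_finsetSum_eq_zero_imp_eq_zero _).1 f.eigenspaces_iSupIndep
    (l.support.image c) (fun a => Finsupp.linearCombination K v (l.filter (fun i => c i = a)))
    (fun a _ => by
      rw [Finsupp.linearCombination_apply]
      refine Submodule.sum_mem _ fun i hi => Submodule.smul_mem _ _ ?_
      rw [Module.End.mem_eigenspace_iff, hf]
      rw [Finsupp.support_filter, Finset.mem_filter] at hi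
      rw [hi.2])
    (by
      rw [← map_sum, ← h0]
      congr 1
      ext i
      rw [Finsupp.finsetSum_apply]
      simp only [Finsupp.filter_apply]
      rw [Finset.sum_ite_eq]
      split_ifs with hi
      · rfl
      · rw [Finset.mem_image] at hi
        by_contra hne
        exact hi ⟨i, Finsupp.mem_support_iff.2 (Ne.symm hne), rfl⟩)
  ext i
  by_contra hi
  -- The sum over the indices with a given eigenvalue vanishes because eigenspaces are independent;
  -- the hypothesis for that eigenvalue then removes its coefficients.
  have hm : c i ∈ l.support.image c :=
    Finset.mem_image_of_mem _ (Finsupp.mem_support_iff.2 hi)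
  have h1 := (linearIndepOn_iff.1 (h (c i))) (l.filter fun j => c j = c i) (by
    rw [Finsupp.mem_supported] at hl ⊢
    intro j hj
    rw [Finsupp.support_filter, Finset.mem_coe, Finset.mem_filter] at hj
    exact ⟨hl hj.1, hj.2⟩) (hind _ hm)
  have h2 := DFunLike.congr_fun h1 i
  rw [Finsupp.filter_apply_pos (fun j => c j = c i) l rfl] at h2
  exact hi h2

/-- The Jacobi bracket with a given sequence. -/
def adj (P : Gen) : Module.End ℝ Gen where
  toFun Q := jacobi P Q
  map_add' Q S := by funext d; simp [jacobi, evo_add]; ring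
  map_smul' c Q := by funext d; simp [jacobi, evo_smul, smul_sub]

theorem adj_apply (P Q : Gen) : adj P Q = jacobi P Q := rfl

/-- The elements of the hierarchies, as an indexed family. -/
def hierFamily (p : Seed × ℤ × ℤ) : Gen := hier p.1 p.2.1 p.2.2

/-- The eigenvalues of the bracket with `Ω`. -/
def weightOmega : Seed × ℤ × ℤ → ℤ
  | (.Υ ν, i, _) => -(i + 2 - 2 * ν)
  | (_, i, _) => -i
/-- The eigenvalues of the bracket with `R_0^1(Ψ)`. -/
def weightPsi : Seed × ℤ × ℤ → ℤ
  | (.Υ ν, _, j) => -(j - 2 * ν)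
  | (.Ψ, _, j) => 1 - j
  | (_, _, j) => -j
/-- The eigenvalues of the bracket with `Ξ(q_0)`. -/
def weightXi : Seed × ℤ × ℤ → ℤ
  | (.Ξ ν, _, _) => ν - 1
  | _ => 0
/-- The eigenvalues of the bracket with `Θ(m_0)`. -/
def weightTheta : Seed × ℤ × ℤ → ℤ
  | (.Θ ν, _, _) => ν - 1
  | _ => 0
/-- The eigenvalues of the bracket with `R_0^2(Υ(y/t²))`. -/
def weightUpsilon : Seed × ℤ × ℤ → ℤ
  | (.Υ ν, _, _) => 1 - ν
  | _ => 0

theorem adj_Omega (p : Seed × ℤ × ℤ) :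
    adj (hier .Ω 0 0) (hierFamily p) = ((weightOmega p : ℤ) : ℝ) • hierFamily p := by
  obtain ⟨s, i, j⟩ := p
  rw [adj_apply, hierFamily]
  cases s <;> simp only [weightOmega, jacobi_Omega_Omega, jacobi_Omega_Xi_hier,
    jacobi_Omega_Theta_hier, jacobi_Omega_Upsilon_hier, jacobi_skew _ (hier .Ψ i j),
    jacobi_Psi_Omega_hier, zero_add, add_zero, zero_sub, Int.cast_zero, zero_smul, sub_zero,
    Int.cast_neg, neg_smul]

theorem adj_Psi (p : Seed × ℤ × ℤ) :
    adj (hier .Ψ 0 1) (hierFamily p) = ((weightPsi p : ℤ) : ℝ) • hierFamily p := by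
  obtain ⟨s, i, j⟩ := p
  rw [adj_apply, hierFamily]
  cases s <;> simp only [weightPsi, jacobi_Psi_Psi, jacobi_Psi_Xi_hier,
    jacobi_Psi_Theta_hier, jacobi_Psi_Upsilon_hier, add_sub_cancel_left,
    jacobi_Psi_Omega_hier, zero_add, add_zero, zero_sub, Int.cast_zero, zero_smul, sub_zero,
    Int.cast_neg, neg_smul]

theorem adj_Xi (p : Seed × ℤ × ℤ) :
    adj (hier (.Ξ 1) 0 0) (hierFamily p) = ((weightXi p : ℤ) : ℝ) • hierFamily p := by
  obtain ⟨s, i, j⟩ := p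
  rw [adj_apply, hierFamily]
  cases s <;> simp only [weightXi, jacobi_skew _ (hier .Ψ i j), jacobi_skew _ (hier .Ω i j),
    jacobi_Psi_Xi_hier, jacobi_Omega_Xi_hier, jacobi_Xi_Xi_hier, jacobi_Xi_Upsilon_hier,
    jacobi_Xi_Theta_hier, add_sub_cancel_left, zero_add, Int.cast_zero, zero_smul, neg_zero]

theorem adj_Theta (p : Seed × ℤ × ℤ) :
    adj (hier (.Θ 1) 0 0) (hierFamily p) = ((weightTheta p : ℤ) : ℝ) • hierFamily p := by
  obtain ⟨s, i, j⟩ := p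
  rw [adj_apply, hierFamily]
  cases s
  case Ξ ν => rw [jacobi_skew, jacobi_Xi_Theta_hier]; simp [weightTheta]
  case Υ ν => rw [jacobi_skew, jacobi_Upsilon_Theta_hier]; simp [weightTheta]
  all_goals simp only [weightTheta, jacobi_skew _ (hier .Ψ i j), jacobi_skew _ (hier .Ω i j),
    jacobi_Psi_Theta_hier, jacobi_Omega_Theta_hier, jacobi_Theta_Theta_hier,
    add_sub_cancel_left, zero_add, Int.cast_zero, zero_smul, neg_zero]

theorem adj_Upsilon (p : Seed × ℤ × ℤ) :
    adj (hier (.Υ 1) 0 2) (hierFamily p) = ((weightUpsilon p : ℤ) : ℝ) • hierFamily p := by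
  obtain ⟨s, i, j⟩ := p
  rw [adj_apply, hierFamily]
  cases s
  case Ξ ν => rw [jacobi_skew, jacobi_Xi_Upsilon_hier]; simp [weightUpsilon]
  all_goals simp only [weightUpsilon, jacobi_skew _ (hier .Ψ i j), jacobi_skew _ (hier .Ω i j),
    jacobi_Psi_Upsilon_hier, jacobi_Omega_Upsilon_hier, jacobi_Upsilon_Upsilon_hier,
    jacobi_Upsilon_Theta_hier, mul_one, sub_self,
    add_sub_cancel_left, zero_add, Int.cast_zero, zero_smul, neg_zero]

theorem pow_coord_ne_zero (a : Coord) (n : ℤ) : pow a n ≠ 0 := by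
  rw [pow_eq_zpow]; exact Units.ne_zero _

/-- The recursion operators are invertible, so one nonzero component of the seed suffices. -/
theorem hier_ne_zero_of_seed {s : Seed} (d : Dep) (h : seed s d ≠ 0) (i j : ℤ) :
    hier s i j ≠ 0 := fun h0 => h <| by
  rw [hier, LinearEquiv.map_eq_zero_iff] at h0
  rw [h0]; rfl

theorem hier_Xi_ne_zero (ν i j : ℤ) : hier (.Ξ ν) i j ≠ 0 :=
  hier_ne_zero_of_seed (.q 0) (by simpa [seed, Xi] using pow_coord_ne_zero _ _) i j

theorem hier_Theta_ne_zero (ν i j : ℤ) : hier (.Θ ν) i j ≠ 0 :=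
  hier_ne_zero_of_seed (.m 0) (by simpa [seed, Theta] using pow_coord_ne_zero _ _) i j

theorem hier_Upsilon_ne_zero (ν i j : ℤ) : hier (.Υ ν) i j ≠ 0 :=
  hier_ne_zero_of_seed .u (by
    simp only [seed, Upsilon]
    rw [pow_eq_zpow, pow_eq_zpow, ← Units.val_mul]; exact Units.ne_zero _) i j

/-- The index families of elements of the hierarchies with the same weights. -/
def resonant (i j : ℤ) : Fin 5 → Seed × ℤ × ℤ :=
  ![(.Ω, i, j), (.Ψ, i, j + 1), (.Ξ 1, i, j), (.Θ 1, i, j), (.Υ 1, i, j + 2)]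

/-- The bracket with R_k^l(Ξ(q_0²)) kills the members from `Θ` and `Υ` and sends the other three to
multiples of one nonzero element, with factors k, l and -1. The choices (0,0), (1,0), (0,1) isolate
the three coefficients. Brackets with Θ(m_0²) and Υ((y/t²)²) isolate the last two. -/
theorem linearIndependent_resonant (i j : ℤ) :
    LinearIndependent ℝ (hierFamily ∘ resonant i j) := by
  rw [Fintype.linearIndependent_iff]
  intro g hg
  simp only [Fin.sum_univ_five, Function.comp_apply, resonant, hierFamily, Matrix.cons_val] at hg
  have hX (k l : ℤ) : -(k : ℝ) * g 0 - l * g 1 + g 2 = 0 := by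
    have h := congrArg (adj (hier (.Ξ 2) k l)) hg
    simp only [map_add, map_smul, map_zero, adj_apply, jacobi_skew (hier (.Ξ 2) k l) (hier .Ψ _ _),
      jacobi_skew (hier (.Ξ 2) k l) (hier .Ω _ _), jacobi_Psi_Xi_hier, jacobi_Omega_Xi_hier,
      jacobi_Xi_Xi_hier, jacobi_Xi_Upsilon_hier, jacobi_Xi_Theta_hier] at h
    rw [show j + 1 + l - 1 = j + l by ring, show (2 + 1 - 1 : ℤ) = 2 by rfl, add_comm k i,
      add_comm l j] at h
    have h' : (-(k : ℝ) * g 0 - l * g 1 + g 2) • hier (.Ξ 2) (i + k) (j + l) = 0 := by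
      rw [← neg_eq_zero, ← h]; push_cast; module
    exact (smul_eq_zero.1 h').resolve_right (hier_Xi_ne_zero _ _ _)
  have h2 : g 2 = 0 := by simpa using hX 0 0
  have h0 : g 0 = 0 := by simpa [h2] using hX 1 0
  have h1 : g 1 = 0 := by simpa [h2] using hX 0 1
  simp only [h0, h1, h2, zero_smul, zero_add] at hg
  have h3 : g 3 = 0 := by
    have h := congrArg (adj (hier (.Θ 2) 0 0)) hg
    simp only [map_add, map_smul, map_zero, adj_apply, jacobi_Theta_Theta_hier,
      jacobi_skew (hier (.Θ 2) 0 0) (hier (.Υ _) _ _), jacobi_Upsilon_Theta_hier] at h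
    simpa [hier_Theta_ne_zero] using h
  have h4 : g 4 = 0 := by
    have h := congrArg (adj (hier (.Υ 2) 0 0)) hg
    simp only [h3, zero_smul, zero_add, map_smul, map_zero, adj_apply,
      jacobi_Upsilon_Upsilon_hier] at h
    simpa [hier_Upsilon_ne_zero] using h
  intro n
  fin_cases n <;> assumption

theorem linearIndepOn_resonant (i j : ℤ) :
    LinearIndepOn ℝ hierFamily (Set.range (resonant i j)) := by
  refine (linearIndepOn_range_iff ?_ _).2 (linearIndependent_resonant i j)
  intro a b h
  fin_cases a <;> fin_cases b <;> simp [resonant] at h ⊢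

theorem mem_range_resonant {i j : ℤ} {p : Seed × ℤ × ℤ} (h1 : weightOmega p = -i)
    (h2 : weightPsi p = -j) (h3 : weightXi p = 0) (h4 : weightTheta p = 0)
    (h5 : weightUpsilon p = 0) : p ∈ Set.range (resonant i j) := by
  obtain ⟨s, k, l⟩ := p
  cases s with
  | Ω =>
    simp only [weightOmega, weightPsi] at h1 h2
    obtain ⟨rfl, rfl⟩ : k = i ∧ l = j := ⟨by lia, by lia⟩
    exact ⟨0, rfl⟩
  | Ψ =>
    simp only [weightOmega, weightPsi] at h1 h2
    obtain ⟨rfl, rfl⟩ : k = i ∧ l = j + 1 := ⟨by lia, by lia⟩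
    exact ⟨1, rfl⟩
  | Ξ ν =>
    simp only [weightOmega, weightPsi, weightXi] at h1 h2 h3
    obtain ⟨rfl, rfl, rfl⟩ : k = i ∧ l = j ∧ ν = 1 := ⟨by lia, by lia, by lia⟩
    exact ⟨2, rfl⟩
  | Θ ν =>
    simp only [weightOmega, weightPsi, weightTheta] at h1 h2 h4
    obtain ⟨rfl, rfl, rfl⟩ : k = i ∧ l = j ∧ ν = 1 := ⟨by lia, by lia, by lia⟩
    exact ⟨3, rfl⟩
  | Υ ν =>
    simp only [weightOmega, weightPsi, weightUpsilon] at h1 h2 h5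
    obtain ⟨rfl, rfl, rfl⟩ : k = i ∧ l = j + 2 ∧ ν = 1 := ⟨by lia, by lia, by lia⟩
    exact ⟨4, rfl⟩

/-- If one of the last three weights is nonzero, it determines the family and the exponent ν, and
the first two weights then fix i and j; so at most one element has these weights. If all three
vanish, the elements lie in a resonant quintuple. -/
theorem linearIndepOn_weights (w₁ w₂ w₃ w₄ w₅ : ℤ) : LinearIndepOn ℝ hierFamily
    {p | weightOmega p = w₁ ∧ weightPsi p = w₂ ∧ weightXi p = w₃ ∧ weightTheta p = w₄ ∧
      weightUpsilon p = w₅} := by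
  by_cases h : w₃ = 0 ∧ w₄ = 0 ∧ w₅ = 0
  · obtain ⟨rfl, rfl, rfl⟩ := h
    refine (linearIndepOn_resonant (-w₁) (-w₂)).mono ?_
    rintro p ⟨h1, h2, h3, h4, h5⟩
    exact mem_range_resonant (by rw [h1, neg_neg]) (by rw [h2, neg_neg]) h3 h4 h5
  · by_cases hs : ∃ p : Seed × ℤ × ℤ, weightOmega p = w₁ ∧ weightPsi p = w₂ ∧ weightXi p = w₃ ∧
        weightTheta p = w₄ ∧ weightUpsilon p = w₅
    · obtain ⟨p, h1, h2, h3, h4, h5⟩ := hs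
      have hp : hierFamily p ≠ 0 := by
        obtain ⟨s, i, j⟩ := p
        cases s with
        | Ξ ν => exact hier_Xi_ne_zero _ _ _
        | Θ ν => exact hier_Theta_ne_zero _ _ _
        | Υ ν => exact hier_Upsilon_ne_zero _ _ _
        | _ => exact absurd ⟨h3.symm, h4.symm, h5.symm⟩ h
      refine ((linearIndepOn_singleton_iff ℝ).2 hp).mono ?_
      rintro q ⟨e1, e2, e3, e4, e5⟩
      rw [Set.mem_singleton_iff]
      obtain ⟨s, i, j⟩ := p
      obtain ⟨s', i', j'⟩ := q
      subst h1 h2 h3 h4 h5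
      cases s <;> cases s' <;>
        simp only [weightOmega, weightPsi, weightXi, weightTheta, weightUpsilon, Prod.mk.injEq,
          Seed.Ξ.injEq, Seed.Θ.injEq, Seed.Υ.injEq, reduceCtorEq, true_and, false_and] at * <;>
        lia
    · exact (linearIndepOn_empty ℝ hierFamily).mono fun p hp => (hs ⟨p, hp⟩).elim

/-- Splits successively along the five diagonal operators. The case distinction is needed because
the eigenvalues range over ℝ while the weights are integers. -/
theorem linearIndependent_hierFamily : LinearIndependent ℝ hierFamily := by
  rw [← linearIndepOn_univ_iff]
  refine linearIndepOn_of_eigenvalues _ adj_Omega fun a₁ => ?_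
  refine linearIndepOn_of_eigenvalues _ adj_Psi fun a₂ => ?_
  refine linearIndepOn_of_eigenvalues _ adj_Xi fun a₃ => ?_
  refine linearIndepOn_of_eigenvalues _ adj_Theta fun a₄ => ?_
  refine linearIndepOn_of_eigenvalues _ adj_Upsilon fun a₅ => ?_
  by_cases hs : ∃ p : Seed × ℤ × ℤ, (weightOmega p : ℝ) = a₁ ∧ (weightPsi p : ℝ) = a₂ ∧
      (weightXi p : ℝ) = a₃ ∧ (weightTheta p : ℝ) = a₄ ∧ (weightUpsilon p : ℝ) = a₅
  · obtain ⟨p, rfl, rfl, rfl, rfl, rfl⟩ := hs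
    refine (linearIndepOn_weights (weightOmega p) (weightPsi p) (weightXi p) (weightTheta p)
      (weightUpsilon p)).mono ?_
    rintro q ⟨⟨⟨⟨⟨_, h1⟩, h2⟩, h3⟩, h4⟩, h5⟩
    exact ⟨by exact_mod_cast h1, by exact_mod_cast h2, by exact_mod_cast h3,
      by exact_mod_cast h4, by exact_mod_cast h5⟩
  · refine (linearIndepOn_empty ℝ hierFamily).mono fun q hq => (hs ⟨q, ?_⟩).elim
    obtain ⟨⟨⟨⟨⟨_, h1⟩, h2⟩, h3⟩, h4⟩, h5⟩ := hq
    exact ⟨h1, h2, h3, h4, h5⟩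

/-! ### The Lie algebra spanned by the hierarchies -/

theorem V_eq_span_range : V = Submodule.span ℝ (Set.range hierFamily) := by
  rw [V]
  congr 1
  ext P
  constructor
  · rintro ⟨s, i, j, rfl⟩; exact ⟨(s, i, j), rfl⟩
  · rintro ⟨⟨s, i, j⟩, rfl⟩; exact ⟨s, i, j, rfl⟩

theorem hier_mem_V (s : Seed) (i j : ℤ) : hier s i j ∈ V :=
  Submodule.subset_span ⟨s, i, j, rfl⟩

theorem V_le_sym : V ≤ sym :=
  Submodule.span_le.2 fun _ ⟨s, i, j, h⟩ => h ▸ isSymmetry_hier s i j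

theorem jacobi_hier_mem (s s' : Seed) (i k j l : ℤ) :
    jacobi (hier s i k) (hier s' j l) ∈ V := by
  have h (s i j) := hier_mem_V s i j
  cases s <;> cases s' <;>
    simp only [jacobi_Psi_Psi, jacobi_Psi_Omega_hier, jacobi_Omega_Omega, jacobi_Psi_Xi_hier,
      jacobi_Psi_Theta_hier, jacobi_Psi_Upsilon_hier, jacobi_Omega_Xi_hier,
      jacobi_Omega_Theta_hier, jacobi_Omega_Upsilon_hier, jacobi_Xi_Xi_hier,
      jacobi_Theta_Theta_hier, jacobi_Upsilon_Upsilon_hier, jacobi_Xi_Upsilon_hier,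
      jacobi_Xi_Theta_hier, jacobi_Upsilon_Theta_hier, jacobi_skew _ (hier .Ψ j l),
      jacobi_skew (hier (.Ξ _) i k) (hier .Ω j l), jacobi_skew (hier (.Υ _) i k) (hier .Ω j l),
      jacobi_skew (hier (.Θ _) i k) (hier .Ω j l),
      jacobi_skew (hier (.Υ _) i k) (hier (.Ξ _) j l),
      jacobi_skew (hier (.Θ _) i k) (hier (.Ξ _) j l),
      jacobi_skew (hier (.Θ _) i k) (hier (.Υ _) j l), neg_zero, zero_mem]
  all_goals
    repeat' first
      | apply neg_mem
      | apply sub_mem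
      | apply Submodule.smul_mem
      | apply h

theorem jacobi_mem_V {P Q : Gen} (hP : P ∈ V) (hQ : Q ∈ V) : jacobi P Q ∈ V := by
  have h1 (s : Seed) (i j : ℤ) {Q : Gen} (hQ : Q ∈ V) : jacobi (hier s i j) Q ∈ V := by
    have : V ≤ V.comap (adj (hier s i j)) :=
      Submodule.span_le.2 fun Q ⟨s', k, l, h⟩ => h ▸ jacobi_hier_mem s s' i j k l
    exact this hQ
  have h2 : V ≤ V.comap (adj Q) := Submodule.span_le.2 fun P ⟨s, i, j, h⟩ => by
    subst h
    change jacobi Q (hier s i j) ∈ V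
    rw [jacobi_skew]
    exact neg_mem (h1 s i j hQ)
  rw [jacobi_skew]
  exact neg_mem (h2 hP)

/-- R_k^0 ∘ R_0^j = R_k^j, so the summand is spanned by a block of the independent family.
Directness and the sum are then read off from the partition of the index set by k. -/
theorem map_V0 (k : ℤ) : V0.map (R k 0).toLinearMap =
    Submodule.span ℝ (hierFamily '' {p | p.2.1 = k}) := by
  rw [V0, Submodule.map_span]
  congr 1
  ext P
  constructor
  · rintro ⟨_, ⟨s, j, rfl⟩, rfl⟩
    exact ⟨(s, k, j), rfl, by
      change R k j (seed s) = R k 0 (R 0 j (seed s))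
      rw [R_apply_R, add_zero, zero_add]⟩
  · rintro ⟨⟨s, i, j⟩, rfl, rfl⟩
    exact ⟨_, ⟨s, j, rfl⟩, by
      change R i 0 (R 0 j (seed s)) = R i j (seed s)
      rw [R_apply_R, add_zero, zero_add]⟩

theorem iSupIndep_map_V0 : iSupIndep fun k : ℤ => V0.map (R k 0).toLinearMap := by
  intro k
  have h := linearIndependent_hierFamily.disjoint_span_image
    (s := {p | p.2.1 = k}) (t := {p | p.2.1 ≠ k}) (Set.disjoint_left.2 fun p h1 h2 => h2 h1)
  simp only [map_V0]
  refine h.mono_right (iSup₂_le fun l hl => Submodule.span_mono (Set.image_mono ?_))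
  rintro p rfl
  exact hl

theorem iSup_map_V0 : (⨆ k : ℤ, V0.map (R k 0).toLinearMap) = V := by
  simp only [map_V0]
  rw [V_eq_span_range, ← Submodule.span_iUnion, ← Set.image_iUnion, ← Set.image_univ]
  congr 2
  exact Set.eq_univ_of_forall fun p => Set.mem_iUnion.2 ⟨_, rfl⟩

theorem not_finiteDimensional_V : ¬ FiniteDimensional ℝ V := by
  intro h
  have hli : LinearIndependent ℝ fun n : ℤ => (⟨hier .Ω n 0, hier_mem_V _ _ _⟩ : V) := by
    refine LinearIndependent.of_comp V.subtype ?_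
    exact linearIndependent_hierFamily.comp (fun n : ℤ => ((.Ω, n, 0) : Seed × ℤ × ℤ))
      fun m n hmn => by simpa using hmn
  have := hli.finite_of_isNoetherian
  exact not_finite ℤ

theorem exists_lieSubalgebra : ∃ h : SymIsLie,
    letI := symLieRing h
    letI := symLieAlgebra h
    ∃ W : LieSubalgebra ℝ sym, W.toSubmodule.map sym.subtype = V := by
  refine ⟨symIsLie, ?_⟩
  let := symLieRing symIsLie
  let := symLieAlgebra symIsLie
  refine ⟨{ V.comap sym.subtype with lie_mem' := fun {P Q} hP hQ => ?_ }, ?_⟩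
  · exact jacobi_mem_V hP hQ
  · exact (Submodule.map_comap_subtype _ _).trans (inf_eq_right.2 V_le_sym)

end RYME

end

/-! ### The proposition -/

open RYME in
theorem mainTheorem5 :
    -- the symmetries form a Lie algebra under the Jacobi bracket, and `V` is a subalgebra of it
    (∃ h : SymIsLie,
      letI := symLieRing h
      letI := symLieAlgebra h
      ∃ W : LieSubalgebra ℝ sym, W.toSubmodule.map sym.subtype = V) ∧
    -- `V` is infinite-dimensional
    ¬ FiniteDimensional ℝ V ∧
    -- `V` is the direct sum of the spaces `R_k^0(V_0)`
    iSupIndep (fun k : ℤ => V0.map (R k 0).toLinearMap) ∧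
    (⨆ k : ℤ, V0.map (R k 0).toLinearMap) = V ∧
    -- the bracket table
    (∀ i k j l : ℤ,
      jacobi (hier .Ψ i k) (hier .Ψ j l) = ((k - l : ℤ) : ℝ) • hier .Ψ (i + j) (k + l - 1) ∧
      jacobi (hier .Ψ i k) (hier .Ω j l) =
        (i : ℝ) • hier .Ψ (i + j) (k + l) - (l : ℝ) • hier .Ω (i + j) (k + l - 1) ∧
      jacobi (hier .Ω i k) (hier .Ω j l) = ((i - j : ℤ) : ℝ) • hier .Ω (i + j) (k + l) ∧
      ∀ μ ν : ℤ,
        jacobi (hier .Ψ i k) (hier (.Ξ ν) j l) = -((l : ℝ) • hier (.Ξ ν) (i + j) (k + l - 1)) ∧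
        jacobi (hier .Ψ i k) (hier (.Υ ν) j l) =
          -(((l - 2 * ν : ℤ) : ℝ) • hier (.Υ ν) (i + j) (k + l - 1)) ∧
        jacobi (hier .Ψ i k) (hier (.Θ ν) j l) = -((l : ℝ) • hier (.Θ ν) (i + j) (k + l - 1)) ∧
        jacobi (hier .Ω i k) (hier (.Ξ ν) j l) = -((j : ℝ) • hier (.Ξ ν) (i + j) (k + l)) ∧
        jacobi (hier .Ω i k) (hier (.Υ ν) j l) =
          -(((j + 2 - 2 * ν : ℤ) : ℝ) • hier (.Υ ν) (i + j) (k + l)) ∧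
        jacobi (hier .Ω i k) (hier (.Θ ν) j l) = -((j : ℝ) • hier (.Θ ν) (i + j) (k + l)) ∧
        jacobi (hier (.Ξ μ) i k) (hier (.Ξ ν) j l) =
          ((ν - μ : ℤ) : ℝ) • hier (.Ξ (μ + ν - 1)) (i + j) (k + l) ∧
        jacobi (hier (.Υ μ) i k) (hier (.Υ ν) j l) =
          ((μ - ν : ℤ) : ℝ) • hier (.Υ (μ + ν - 1)) (i + j) (k + l - 2) ∧
        jacobi (hier (.Θ μ) i k) (hier (.Θ ν) j l) =
          ((ν - μ : ℤ) : ℝ) • hier (.Θ (μ + ν - 1)) (i + j) (k + l) ∧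
        jacobi (hier (.Ξ μ) i k) (hier (.Υ ν) j l) = 0 ∧
        jacobi (hier (.Ξ μ) i k) (hier (.Θ ν) j l) = 0 ∧
        jacobi (hier (.Υ μ) i k) (hier (.Θ ν) j l) = 0) ∧
    -- for each fixed `k`, the elements `R_j^k(P)`, `P` a seed generator, are linearly independent
    (∀ k : ℤ, LinearIndependent ℝ (fun p : ℤ × Seed => hier p.2 p.1 k)) := by
  refine ⟨exists_lieSubalgebra, not_finiteDimensional_V, iSupIndep_map_V0, iSup_map_V0,
    fun i k j l => ⟨jacobi_Psi_Psi i k j l, jacobi_Psi_Omega_hier i k j l,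
      jacobi_Omega_Omega i k j l, fun μ ν => ⟨jacobi_Psi_Xi_hier ν i k j l,
        jacobi_Psi_Upsilon_hier ν i k j l, jacobi_Psi_Theta_hier ν i k j l,
        jacobi_Omega_Xi_hier ν i k j l, jacobi_Omega_Upsilon_hier ν i k j l,
        jacobi_Omega_Theta_hier ν i k j l, jacobi_Xi_Xi_hier μ ν i k j l,
        jacobi_Upsilon_Upsilon_hier μ ν i k j l, jacobi_Theta_Theta_hier μ ν i k j l,
        jacobi_Xi_Upsilon_hier μ ν i k j l, jacobi_Xi_Theta_hier μ ν i k j l,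
        jacobi_Upsilon_Theta_hier μ ν i k j l⟩⟩, fun k => ?_⟩
  exact linearIndependent_hierFamily.comp (fun p : ℤ × Seed => ((p.2, p.1, k) : Seed × ℤ × ℤ))
    fun p q h => by
      obtain ⟨i, s⟩ := p
      obtain ⟨j, s'⟩ := q
      simp only [Prod.mk.injEq, and_true] at h ⊢
      exact ⟨h.2, h.1⟩
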